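/- Let $G=(V,E)$ be a finite simple undirected graph with $n$ vertices and $m$ edges, with positive edge capacities $c:E\to\mathbb{R}_{>0}$, and let $k\in\mathbb{N}$. A $k$-cut is a set of edges $C\subseteq E$ whose removal leaves at least $k$ connected components; its cost is $\sum_{e\in C}c_e$. A vector $x:E\to\mathbb{R}$ is feasible for the linear program (C) if $x_e\ge 0$ for all $e\in E$ and $$\sum_{e\in F}x_e\;\ge\;|F|+k-n\qquad\text{for all forests } F\subseteq E ;$$ its cost is $\sum_{e\in E}c_ex_e$. There is a deterministic algorithm (a fixed program on a real RAM with unit-cost operations, whose integer operations are addition, subtraction, comparison and indexing, and whose real operations are the four arithmetic operations and comparison, without rounding) which, given $n$, $m$, $k$, a list of the edges of $G$, the capacities $c$ and any feasible solution $x$ of (C), computes a $k$-cut $C$ with $$\sum_{e\in C}c_e\;\le\;2\Bigl(1-\frac1n\Bigr)\sum_{e\in E}c_ex_e$$ in $O(m\log n)$ time; that is, there is an absolute constant $A$ such that the number of steps is at most $A\,(m\log n+1)$ on every such input. -/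

import Mathlib

/-! ## Fractional and integral `k`-cuts of a finite simple graph -/

namespace KCut

/-- A set of edges of `G` that contains no cycle. -/
def IsForest {V : Type*} (G : SimpleGraph V) (F : Finset G.edgeSet) : Prop :=
  (SimpleGraph.fromEdgeSet ((fun e : G.edgeSet => (e : Sym2 V)) '' (F : Set G.edgeSet))).IsAcyclic

/-- Feasibility for the knapsack-covering relaxation of `k`-cut:
`x ≥ 0` and `∑_{e ∈ F} x_e ≥ |F| + k - n` for all forests `F` of `G`. -/
def IsFeasible {n : ℕ} (G : SimpleGraph (Fin n)) (k : ℕ) (x : G.edgeSet → ℝ) : Prop :=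
  (∀ e, 0 ≤ x e) ∧
    ∀ F : Finset G.edgeSet, IsForest G F → (F.card : ℝ) + (k : ℝ) - (n : ℝ) ≤ ∑ e ∈ F, x e

/-- A set of edges whose removal leaves at least `k` connected components. -/
def IsKCut {n : ℕ} (G : SimpleGraph (Fin n)) (k : ℕ) (C : Finset G.edgeSet) : Prop :=
  k ≤ Nat.card
    (G.deleteEdges ((fun e : G.edgeSet => (e : Sym2 (Fin n))) '' (C : Set G.edgeSet))).ConnectedComponent

end KCut

/-! ## A real RAM with a step count

A machine with random access to integer cells and to real cells. Integers can be added,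
subtracted and compared, and serve as addresses; reals can be added, subtracted, multiplied,
divided and compared. An integer can be converted to a real but not conversely (there is no
rounding), and programs contain no constants but natural numbers. Programs are finite texts of a
structured language, and every evaluation of an operation, memory access, test or assignment takes
one step. -/

namespace RealRAM

/-- The memory: cell number `i` of the integer array number `a` is `nat a i`, and cell number `i`
of the real array number `a` is `real a i`. A program mentions only finitely many arrays. -/
@[ext]
structure State where
  nat : ℕ → ℕ → ℕ
  real : ℕ → ℕ → ℝ

/-- Integer expressions; `get a i` reads cell `i` of the integer array `a`. -/
inductive NExp where
  | lit (c : ℕ)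
  | get (a : ℕ) (i : NExp)
  | add (e f : NExp)
  | sub (e f : NExp)

/-- Real expressions; `get a i` reads cell `i` of the real array `a`. -/
inductive RExp where
  | ofNat (e : NExp)
  | get (a : ℕ) (i : NExp)
  | add (e f : RExp)
  | sub (e f : RExp)
  | mul (e f : RExp)
  | div (e f : RExp)

/-- Tests. -/
inductive BExp where
  | natLe (e f : NExp)
  | realLe (e f : RExp)
  | not (b : BExp)
  | and (b d : BExp)

/-- Programs; `setNat a i e` and `setReal a i e` store the value of `e` in cell `i` of the
array `a`. -/
inductive Prog where
  | skip
  | setNat (a : ℕ) (i e : NExp)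
  | setReal (a : ℕ) (i : NExp) (e : RExp)
  | seq (p q : Prog)
  | ite (b : BExp) (p q : Prog)
  | loop (b : BExp) (p : Prog)

def NExp.eval (s : State) : NExp → ℕ
  | lit c => c
  | get a i => s.nat a (i.eval s)
  | add e f => e.eval s + f.eval s
  | sub e f => e.eval s - f.eval s

noncomputable def RExp.eval (s : State) : RExp → ℝ
  | ofNat e => (e.eval s : ℝ)
  | get a i => s.real a (i.eval s)
  | add e f => e.eval s + f.eval s
  | sub e f => e.eval s - f.eval s
  | mul e f => e.eval s * f.eval s
  | div e f => e.eval s / f.eval s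

def BExp.eval (s : State) : BExp → Prop
  | natLe e f => e.eval s ≤ f.eval s
  | realLe e f => e.eval s ≤ f.eval s
  | not b => ¬ b.eval s
  | and b d => b.eval s ∧ d.eval s

/-- The number of steps for the evaluation of an expression. -/
def NExp.cost : NExp → ℕ
  | lit _ => 1
  | get _ i => i.cost + 1
  | add e f => e.cost + f.cost + 1
  | sub e f => e.cost + f.cost + 1

/-- The number of steps for the evaluation of an expression. -/
def RExp.cost : RExp → ℕ
  | ofNat e => e.cost + 1
  | get _ i => i.cost + 1
  | add e f => e.cost + f.cost + 1
  | sub e f => e.cost + f.cost + 1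
  | mul e f => e.cost + f.cost + 1
  | div e f => e.cost + f.cost + 1

/-- The number of steps for the evaluation of a test. -/
def BExp.cost : BExp → ℕ
  | natLe e f => e.cost + f.cost + 1
  | realLe e f => e.cost + f.cost + 1
  | not b => b.cost + 1
  | and b d => b.cost + d.cost + 1

def State.setNat (s : State) (a i v : ℕ) : State :=
  { s with nat := Function.update s.nat a (Function.update (s.nat a) i v) }

noncomputable def State.setReal (s : State) (a i : ℕ) (v : ℝ) : State :=
  { s with real := Function.update s.real a (Function.update (s.real a) i v) }

/-- `Run p s s' t`: started in memory `s`, the program `p` halts after exactly `t` steps with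
memory `s'`. -/
inductive Run : Prog → State → State → ℕ → Prop
  | skip (s : State) : Run Prog.skip s s 1
  | setNat (s : State) (a : ℕ) (i e : NExp) :
      Run (Prog.setNat a i e) s (s.setNat a (i.eval s) (e.eval s)) (i.cost + e.cost + 1)
  | setReal (s : State) (a : ℕ) (i : NExp) (e : RExp) :
      Run (Prog.setReal a i e) s (s.setReal a (i.eval s) (e.eval s)) (i.cost + e.cost + 1)
  | seq {p q : Prog} {s s₁ s₂ : State} {t₁ t₂ : ℕ} (h₁ : Run p s s₁ t₁) (h₂ : Run q s₁ s₂ t₂) :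
      Run (Prog.seq p q) s s₂ (t₁ + t₂)
  | iteTrue {b : BExp} {p q : Prog} {s s₁ : State} {t : ℕ} (hb : b.eval s) (h : Run p s s₁ t) :
      Run (Prog.ite b p q) s s₁ (b.cost + 1 + t)
  | iteFalse {b : BExp} {p q : Prog} {s s₁ : State} {t : ℕ} (hb : ¬ b.eval s) (h : Run q s s₁ t) :
      Run (Prog.ite b p q) s s₁ (b.cost + 1 + t)
  | loopTrue {b : BExp} {p : Prog} {s s₁ s₂ : State} {t₁ t₂ : ℕ} (hb : b.eval s)
      (h₁ : Run p s s₁ t₁) (h₂ : Run (Prog.loop b p) s₁ s₂ t₂) :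
      Run (Prog.loop b p) s s₂ (b.cost + 1 + t₁ + t₂)
  | loopFalse {b : BExp} {p : Prog} {s : State} (hb : ¬ b.eval s) :
      Run (Prog.loop b p) s s (b.cost + 1)

end RealRAM

namespace KCut

/-- A finite list as the contents of an array, followed by zeros. -/
def toArray {α : Type*} [Zero α] {m : ℕ} (f : Fin m → α) : ℕ → α :=
  fun i => if h : i < m then f ⟨i, h⟩ else 0

/-- The initial memory for a graph with `n` vertices and `m` edges given as a list. Integer array
`0` holds `n, m, k`; the `i`-th edge joins the vertices in cell `i` of the integer arrays `1` and
`2`, and has its capacity in cell `i` of the real array `0` and its fractional value in cell `i`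
of the real array `1`. Everything else is zero. -/
noncomputable def inputState {n m : ℕ} (k : ℕ) (u v : Fin m → Fin n) (c x : Fin m → ℝ) :
    RealRAM.State where
  nat := fun a =>
    if a = 0 then toArray ![n, m, k]
    else if a = 1 then toArray (fun i => (u i : ℕ))
    else if a = 2 then toArray (fun i => (v i : ℕ))
    else fun _ => 0
  real := fun a =>
    if a = 0 then toArray c
    else if a = 1 then toArray x
    else fun _ => 0

/-- The set of edges that a final memory describes: the `i`-th edge belongs to it iff cell `i`
of the integer array `3` holds the value `1`. -/
def Outputs {n m : ℕ} {G : SimpleGraph (Fin n)} (ε : Fin m ≃ G.edgeSet) (s : RealRAM.State)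
    (C : Finset G.edgeSet) : Prop :=
  ∀ i : Fin m, ε i ∈ C ↔ s.nat 3 i = 1

end KCut

/-! Kruskal's algorithm with weights `x` makes `f` mergers; the `j`-th joins two classes,
represented by `a j` and `b j`. The `2 * f` classes joined in this way are the candidates, each
weighted by the capacity of the edges that leave it. Consider the indicators of the candidates in
`ℝ^n` modulo the span of the final classes. A second greedy run selects a lightest basis of that
quotient, in increasing order of weight. The output is the union of the cuts of its first `q = f + k
- n` members.

Components (`IsRounding.le_card_connectedComponent`): by `acceptedSpan_eq_top`, the basis together
with the final classes spans `ℝ^n`. All these vectors except `f - q` are constant on the components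
left by the cut, so there are at least `n - (f - q) ≥ k` components.

Cost: stop after `j` mergers and omit a heaviest class inside every final class. The indicators of
the other `f - j` classes are independent modulo the final ones, so the greedy choice makes the `f -
j` lightest basis members at most as heavy as these classes. All classes together weigh twice the
capacity between different classes, and the omitted ones carry at least a fraction `1 / n` of this;
that is `level_bound`. Now weight level `j` by the increment of `τ`, the fractional value of the
last merging edge truncated at `1`. An edge crosses only at levels whose increments add up to at
most its own value, so the right sides add up to at most `2 (1 - 1/n) ∑ c x`. Abel summation turns
the left sides into a combination of the basis weights with coefficients in `[0, 1]`. The constraint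
of (C) for the merging edges of value below `1` makes the coefficients add up to at least `q`
(`le_sum_min_of_isFeasible`), so the combination is no smaller than the sum of the `q` lightest
weights. This is `IsRounding.sum_weight_le`.

Time: the candidates form a laminar family, so modulo the final classes their indicators are
potential differences along the edges of a graph with `f + 1` vertices (`IsIntervals`). The linear
greedy algorithm is therefore Kruskal's algorithm on that graph, and `kruskalProg` serves twice. It
takes the edges from a tournament tree and merges by size, which keeps the chains of links
logarithmic. Climbing these links also finds the merger that joins the ends of an edge, from which
all candidate weights follow by inclusion-exclusion. A sweep from the last merger to the first
labels the vertices so that exactly the separated edges can be output. -/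

namespace RealRAM

/-! ### Execution of loop-free programs, and a calculus of running times -/

/-- The state reached by a program without loops (loops are skipped). -/
noncomputable def Prog.exec : Prog → State → State
  | .skip, s => s
  | .setNat a i e, s => s.setNat a (i.eval s) (e.eval s)
  | .setReal a i e, s => s.setReal a (i.eval s) (e.eval s)
  | .seq p q, s => q.exec (p.exec s)
  | .ite b p q, s => open Classical in if b.eval s then p.exec s else q.exec s
  | .loop _ _, s => s

theorem Prog.exec_seq (p q : Prog) (s : State) : (p.seq q).exec s = q.exec (p.exec s) := rfl

theorem Prog.exec_ite_pos {b : BExp} {p q : Prog} {s : State} (h : b.eval s) :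
    (Prog.ite b p q).exec s = p.exec s := by
  simp [Prog.exec, h]

theorem Prog.exec_ite_neg {b : BExp} {p q : Prog} {s : State} (h : ¬ b.eval s) :
    (Prog.ite b p q).exec s = q.exec s := by
  simp [Prog.exec, h]

/-- A program without loops. -/
def Prog.LoopFree : Prog → Prop
  | .seq p q => p.LoopFree ∧ q.LoopFree
  | .ite _ p q => p.LoopFree ∧ q.LoopFree
  | .loop _ _ => False
  | _ => True

/-- An upper bound for the running time of a program without loops. -/
def Prog.maxCost : Prog → ℕ
  | .skip => 1
  | .setNat _ i e => i.cost + e.cost + 1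
  | .setReal _ i e => i.cost + e.cost + 1
  | .seq p q => p.maxCost + q.maxCost
  | .ite b p q => b.cost + 1 + (p.maxCost + q.maxCost)
  | .loop _ _ => 0

/-- The integer arrays that a program may modify. -/
def Prog.writesNat : Prog → List ℕ
  | .setNat a _ _ => [a]
  | .seq p q => p.writesNat ++ q.writesNat
  | .ite _ p q => p.writesNat ++ q.writesNat
  | .loop _ p => p.writesNat
  | _ => []

/-- The real arrays that a program may modify. -/
def Prog.writesReal : Prog → List ℕ
  | .setReal a _ _ => [a]
  | .seq p q => p.writesReal ++ q.writesReal
  | .ite _ p q => p.writesReal ++ q.writesReal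
  | .loop _ p => p.writesReal
  | _ => []

theorem State.setNat_nat (s : State) (a i v a' : ℕ) :
    (s.setNat a i v).nat a' = if a' = a then Function.update (s.nat a) i v else s.nat a' := by
  by_cases h : a' = a
  · subst h; simp [State.setNat]
  · simp [State.setNat, h]

theorem State.setNat_setNat (s : State) (a i v w : ℕ) :
    (s.setNat a i v).setNat a i w = s.setNat a i w := by
  simp [State.setNat]

theorem State.setNat_real (s : State) (a i v : ℕ) : (s.setNat a i v).real = s.real := rfl

theorem State.setReal_real (s : State) (a i : ℕ) (v : ℝ) (a' : ℕ) :
    (s.setReal a i v).real a' = if a' = a then Function.update (s.real a) i v else s.real a' := by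
  by_cases h : a' = a
  · subst h; simp [State.setReal]
  · simp [State.setReal, h]

theorem State.setReal_nat (s : State) (a i : ℕ) (v : ℝ) : (s.setReal a i v).nat = s.nat := rfl

theorem Run.nat_eq {p : Prog} {s s' : State} {t : ℕ} (h : Run p s s' t) {a : ℕ}
    (ha : a ∉ p.writesNat) : s'.nat a = s.nat a := by
  induction h <;> simp_all [Prog.writesNat, State.setNat_nat, State.setReal_nat]

theorem Run.real_eq {p : Prog} {s s' : State} {t : ℕ} (h : Run p s s' t) {a : ℕ}
    (ha : a ∉ p.writesReal) : s'.real a = s.real a := by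
  induction h <;> simp_all [Prog.writesReal, State.setReal_real, State.setNat_real]

theorem Prog.LoopFree.run {p : Prog} (hp : p.LoopFree) (s : State) :
    ∃ t ≤ p.maxCost, Run p s (p.exec s) t := by
  induction p generalizing s with
  | skip => exact ⟨_, le_rfl, .skip s⟩
  | setNat a i e => exact ⟨_, le_rfl, .setNat s a i e⟩
  | setReal a i e => exact ⟨_, le_rfl, .setReal s a i e⟩
  | seq p q ihp ihq =>
    obtain ⟨t, ht, h⟩ := ihp hp.1 s
    obtain ⟨t', ht', h'⟩ := ihq hp.2 (p.exec s)
    exact ⟨_, Nat.add_le_add ht ht', h.seq h'⟩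
  | ite b p q ihp ihq =>
    by_cases hb : b.eval s
    · obtain ⟨t, ht, h⟩ := ihp hp.1 s
      refine ⟨_, ?_, by simpa [Prog.exec, hb] using Run.iteTrue (q := q) hb h⟩
      simp only [Prog.maxCost]; omega
    · obtain ⟨t, ht, h⟩ := ihq hp.2 s
      refine ⟨_, ?_, by simpa [Prog.exec, hb] using Run.iteFalse (p := p) hb h⟩
      simp only [Prog.maxCost]; omega
  | loop b p _ => exact hp.elim

/-- Started in `s`, the program `p` halts within `t` steps in a state with property `Q`. -/
def Halts (p : Prog) (s : State) (t : ℕ) (Q : State → Prop) : Prop :=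
  ∃ s' T, Run p s s' T ∧ T ≤ t ∧ Q s'

theorem Halts.mono {p : Prog} {s : State} {t t' : ℕ} {Q Q' : State → Prop} (h : Halts p s t Q)
    (ht : t ≤ t') (hQ : ∀ s', Q s' → Q' s') : Halts p s t' Q' := by
  obtain ⟨s', T, hr, hT, hq⟩ := h
  exact ⟨s', T, hr, hT.trans ht, hQ s' hq⟩

theorem Halts.seq {p q : Prog} {s : State} {t t' : ℕ} {Q Q' : State → Prop} (h : Halts p s t Q)
    (h' : ∀ s', Q s' → Halts q s' t' Q') : Halts (p.seq q) s (t + t') Q' := by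
  obtain ⟨s', T, hr, hT, hq⟩ := h
  obtain ⟨s'', T', hr', hT', hq'⟩ := h' s' hq
  exact ⟨s'', T + T', hr.seq hr', Nat.add_le_add hT hT', hq'⟩

theorem Prog.LoopFree.halts {p : Prog} (hp : p.LoopFree) {s : State} {Q : State → Prop} {c : ℕ}
    (hc : p.maxCost ≤ c) (h : Q (p.exec s)) : Halts p s c Q := by
  obtain ⟨t, ht, hr⟩ := hp.run s
  exact ⟨_, t, hr, ht.trans hc, h⟩

theorem Halts.setNat {a : ℕ} {i e : NExp} {s : State} {c : ℕ} (hc : i.cost + e.cost + 1 ≤ c) :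
    Halts (.setNat a i e) s c (fun s' => s' = s.setNat a (i.eval s) (e.eval s)) :=
  ⟨_, _, .setNat s a i e, hc, rfl⟩

/-- A halting program leaves the arrays that it does not write unchanged. -/
theorem Halts.frame {p : Prog} {s : State} {t : ℕ} {Q : State → Prop} (h : Halts p s t Q) :
    Halts p s t (fun s' => Q s' ∧ (∀ a, a ∉ p.writesNat → s'.nat a = s.nat a) ∧
      ∀ a, a ∉ p.writesReal → s'.real a = s.real a) := by
  obtain ⟨s', T, hr, hT, hq⟩ := h
  exact ⟨s', T, hr, hT, hq, fun a => hr.nat_eq, fun a => hr.real_eq⟩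

/-- A loop whose `t`-th round preserves the invariant, with at most `B` rounds. -/
theorem Halts.loop {b : BExp} {p : Prog} {I : ℕ → State → Prop} {B c c' : ℕ}
    (hbound : ∀ t s, I t s → b.eval s → t < B)
    (hstep : ∀ t s, I t s → b.eval s → Halts p s c (I (t + 1))) {s : State} (h0 : I 0 s)
    (hc : b.cost + 1 + c ≤ c') :
    Halts (.loop b p) s ((B + 1) * c') (fun s' => ¬ b.eval s' ∧ ∃ t, I t s') := by
  -- Induction on the number of rounds still allowed; when none is left, `hbound` forces the test to
  -- fail.
  suffices H : ∀ d t s, B - t = d → I t s →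
      Halts (.loop b p) s ((d + 1) * c') (fun s' => ¬ b.eval s' ∧ ∃ t, I t s') from
    H B 0 s (by simp) h0
  intro d
  induction d with
  | zero =>
    intro t s hd hI
    have hb : ¬ b.eval s := fun hb => by have := hbound t s hI hb; omega
    exact ⟨s, _, .loopFalse hb, by omega, hb, t, hI⟩
  | succ d ih =>
    intro t s hd hI
    by_cases hb : b.eval s
    · obtain ⟨s', T, hr, hT, hI'⟩ := hstep t s hI hb
      obtain ⟨s'', T', hr', hT', hq⟩ := ih (t + 1) s' (by omega) hI'
      refine ⟨s'', _, .loopTrue hb hr hr', ?_, hq⟩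
      have : (d + 1 + 1) * c' = (d + 1) * c' + c' := by ring
      omega
    · refine ⟨s, _, .loopFalse hb, ?_, hb, t, hI⟩
      have : (d + 1 + 1) * c' = (d + 1) * c' + c' := by ring
      omega

/-- A loop with exactly `B` rounds. -/
theorem Halts.for {b : BExp} {p : Prog} {I : ℕ → State → Prop} {B c c' : ℕ}
    (hcond : ∀ t s, t ≤ B → I t s → (b.eval s ↔ t < B))
    (hstep : ∀ t s, t < B → I t s → Halts p s c (I (t + 1))) {s : State} (h0 : I 0 s)
    (hc : b.cost + 1 + c ≤ c') : Halts (.loop b p) s ((B + 1) * c') (I B) := by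
  refine (Halts.loop (I := fun t s => t ≤ B ∧ I t s) (B := B) (c := c) ?_ ?_ ⟨Nat.zero_le _, h0⟩ hc).mono
    le_rfl ?_
  · rintro t s ⟨ht, hI⟩ hb
    exact (hcond t s ht hI).1 hb
  · rintro t s ⟨ht, hI⟩ hb
    have := (hcond t s ht hI).1 hb
    exact (hstep t s this hI).mono le_rfl fun s' h => ⟨this, h⟩
  · rintro s' ⟨hb, t, ht, hI⟩
    have : ¬ t < B := fun h => hb ((hcond t s' ht hI).2 h)
    obtain rfl : t = B := by omega
    exact hI

/-- The integer variable kept in cell `0` of array `a`. -/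
abbrev NExp.var (a : ℕ) : NExp := .get a (.lit 0)

/-- Assignment to the integer variable kept in cell `0` of array `a`. -/
abbrev Prog.setVar (a : ℕ) (e : NExp) : Prog := .setNat a (.lit 0) e

end RealRAM

namespace KCut

open RealRAM

/-! ## Sequences of mergers -/

/-- The representative of `v` after the first `j` mergers, the `i`-th of which merges the class of
`a i` into the class of `b i`. -/
def rep (a b : ℕ → ℕ) : ℕ → ℕ → ℕ
  | 0, v => v
  | j + 1, v => if rep a b j v = a j then b j else rep a b j v

/-- Every one of `f` mergers joins two different classes, given by their representatives. -/
structure IsMergeSeq (N f : ℕ) (a b : ℕ → ℕ) : Prop where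
  ne : ∀ j < f, a j ≠ b j
  rep_a : ∀ j < f, rep a b j (a j) = a j
  rep_b : ∀ j < f, rep a b j (b j) = b j
  a_lt : ∀ j < f, a j < N
  b_lt : ∀ j < f, b j < N

theorem rep_congr {a b a' b' : ℕ → ℕ} {j : ℕ} (ha : ∀ i < j, a i = a' i) (hb : ∀ i < j, b i = b' i)
    (v : ℕ) : rep a b j v = rep a' b' j v := by
  induction j with
  | zero => rfl
  | succ j ih =>
    simp only [rep]
    rw [ih (fun i hi => ha i (by omega)) (fun i hi => hb i (by omega)), ha j (by omega),
      hb j (by omega)]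

theorem rep_update {a b : ℕ → ℕ} {j f : ℕ} (h : j ≤ f) (x y v : ℕ) :
    rep (Function.update a f x) (Function.update b f y) j v = rep a b j v :=
  rep_congr (fun i hi => Function.update_of_ne (by omega) _ _)
    (fun i hi => Function.update_of_ne (by omega) _ _) v

/-- A representative stays one until it is merged into another class. -/
theorem rep_eq_self {a b : ℕ → ℕ} {j v : ℕ} (hv : ∀ i < j, a i ≠ v) : rep a b j v = v := by
  induction j with
  | zero => rfl
  | succ j ih =>
    have := ih (fun i hi => hv i (by omega))
    simp [rep, this, (hv j (by omega)).symm]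

namespace IsMergeSeq

variable {N f : ℕ} {a b : ℕ → ℕ}

theorem rep_rep_self (h : IsMergeSeq N f a b) {j : ℕ} (hj : j ≤ f) (v : ℕ) :
    rep a b j (rep a b j v) = rep a b j v := by
  induction j with
  | zero => rfl
  | succ j ih =>
    have ih := ih (by omega)
    have h1 := h.ne j (by omega)
    have h2 := h.rep_b j (by omega)
    simp only [rep]
    split_ifs <;> simp_all

theorem rep_rep (h : IsMergeSeq N f a b) {i j : ℕ} (hij : i ≤ j) (hj : j ≤ f) (v : ℕ) :
    rep a b j (rep a b i v) = rep a b j v := by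
  induction j, hij using Nat.le_induction with
  | base => exact h.rep_rep_self hj v
  | succ j hij ih => simp only [rep, ih (by omega)]

theorem rep_lt (h : IsMergeSeq N f a b) {j : ℕ} (hj : j ≤ f) {v : ℕ} (hv : v < N) :
    rep a b j v < N := by
  induction j with
  | zero => exact hv
  | succ j ih =>
    have := h.b_lt j (by omega)
    simp only [rep]
    split_ifs
    · exact this
    · exact ih (by omega)

theorem rep_eq_of_le (h : IsMergeSeq N f a b) {i j : ℕ} (hij : i ≤ j) (hj : j ≤ f) {u v : ℕ}
    (he : rep a b i u = rep a b i v) : rep a b j u = rep a b j v := by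
  rw [← h.rep_rep hij hj u, he, h.rep_rep hij hj]

/-- Mergers create no new representatives: a vertex that a merger sends to itself either was not
moved by it, or is the target `b j`, which represented its class already. -/
theorem rep_eq_self_of_le (h : IsMergeSeq N f a b) {i j : ℕ} (hij : i ≤ j) (hj : j ≤ f) {v : ℕ}
    (he : rep a b j v = v) : rep a b i v = v := by
  induction j, hij using Nat.le_induction with
  | base => exact he
  | succ j hij ih =>
    apply ih (by omega)
    simp only [rep] at he
    split_ifs at he with h1
    · rw [← he]; exact h.rep_b j (by omega)
    · exact he

/-- A lost role is never regained: otherwise `a i` would be fixed at time `i + 1` too, where it is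
represented by `b i`. Hence each vertex loses its role at most once, and the merger number can serve
as a time stamp in `IsLink`. -/
theorem rep_ne_a (h : IsMergeSeq N f a b) {i j : ℕ} (hij : i < j) (hj : j ≤ f) (v : ℕ) :
    rep a b j v ≠ a i := by
  intro he
  have h1 : rep a b j (a i) = a i := by rw [← he, h.rep_rep_self hj]
  have h2 := h.rep_eq_self_of_le (Nat.succ_le_of_lt hij) hj h1
  simp only [rep, h.rep_a i (by omega), if_true] at h2
  exact h.ne i (by omega) h2.symm

theorem rep_succ_a (h : IsMergeSeq N f a b) {j : ℕ} (hj : j < f) : rep a b (j + 1) (a j) = b j := by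
  simp [rep, h.rep_a j hj]

theorem rep_succ_b (h : IsMergeSeq N f a b) {j : ℕ} (hj : j < f) : rep a b (j + 1) (b j) = b j := by
  simp [rep, h.rep_b j hj]

/-- The representatives after `j` mergers. -/
def _root_.KCut.reps (N : ℕ) (a b : ℕ → ℕ) (j : ℕ) : Finset ℕ :=
  (Finset.range N).filter fun v => rep a b j v = v

theorem mem_reps {j v : ℕ} : v ∈ reps N a b j ↔ v < N ∧ rep a b j v = v := by
  simp [reps]

theorem reps_succ (h : IsMergeSeq N f a b) {j : ℕ} (hj : j < f) :
    reps N a b (j + 1) = (reps N a b j).erase (a j) := by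
  ext v
  simp only [Finset.mem_erase, mem_reps]
  constructor
  · rintro ⟨hv, he⟩
    exact ⟨fun hva => h.rep_ne_a (Nat.lt_succ_self j) hj v (he.trans hva), hv,
      h.rep_eq_self_of_le (Nat.le_succ j) hj he⟩
  · rintro ⟨hne, hv, he⟩
    exact ⟨hv, by simp [rep, he, hne]⟩

theorem a_mem_reps (h : IsMergeSeq N f a b) {j : ℕ} (hj : j < f) : a j ∈ reps N a b j :=
  mem_reps.2 ⟨h.a_lt j hj, h.rep_a j hj⟩

theorem card_reps (h : IsMergeSeq N f a b) {j : ℕ} (hj : j ≤ f) :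
    (reps N a b j).card + j = N := by
  induction j with
  | zero => simp [reps, rep]
  | succ j ih =>
    rw [h.reps_succ hj, Finset.card_erase_of_mem (h.a_mem_reps hj)]
    have := ih (by omega)
    have : 0 < (reps N a b j).card := Finset.card_pos.2 ⟨_, h.a_mem_reps hj⟩
    omega

theorem lt_of_pos (h : IsMergeSeq N f a b) (hN : 0 < N) : f < N := by
  have h1 := h.card_reps le_rfl
  have h2 : 0 < (reps N a b f).card :=
    Finset.card_pos.2 ⟨rep a b f 0, mem_reps.2 ⟨h.rep_lt le_rfl hN, h.rep_rep_self le_rfl 0⟩⟩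
  omega

/-- One more merger. -/
theorem snoc (h : IsMergeSeq N f a b) {x y : ℕ} (hxy : x ≠ y) (hx : rep a b f x = x)
    (hy : rep a b f y = y) (hxN : x < N) (hyN : y < N) :
    IsMergeSeq N (f + 1) (Function.update a f x) (Function.update b f y) := by
  have key : ∀ j < f + 1, j < f ∨ j = f := fun j hj => by omega
  constructor
  all_goals
    intro j hj
    rcases key j hj with hj | rfl
  · simp [Function.update_of_ne hj.ne, h.ne j hj]
  · simpa using hxy
  · rw [rep_update hj.le]; simp [Function.update_of_ne hj.ne, h.rep_a j hj]
  · rw [rep_update le_rfl]; simpa using hx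
  · rw [rep_update hj.le]; simp [Function.update_of_ne hj.ne, h.rep_b j hj]
  · rw [rep_update le_rfl]; simpa using hy
  · simp [Function.update_of_ne hj.ne, h.a_lt j hj]
  · simpa using hxN
  · simp [Function.update_of_ne hj.ne, h.b_lt j hj]
  · simpa using hyN

end IsMergeSeq

/-! ### Union by size, with time stamps as links -/

/-- The array `link` holds `0` for representatives and `j + 1` for the vertex `a j` that lost this
role in the `j`-th merger. -/
structure IsLink (f : ℕ) (a link : ℕ → ℕ) : Prop where
  eq_zero_or : ∀ v, link v = 0 ∨ ∃ j < f, link v = j + 1 ∧ a j = v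
  link_a : ∀ j < f, link (a j) = j + 1

theorem IsLink.rep_eq_self {f : ℕ} {a b link : ℕ → ℕ} (h : IsLink f a link) {v j : ℕ}
    (hj : j ≤ f) (hv : link v = 0 ∨ j < link v) : rep a b j v = v := by
  apply KCut.rep_eq_self
  rintro i hi rfl
  have := h.link_a i (by omega)
  omega

theorem IsLink.snoc {f : ℕ} {a link : ℕ → ℕ} (h : IsLink f a link) {x : ℕ} (hx : link x = 0) :
    IsLink (f + 1) (Function.update a f x) (Function.update link x (f + 1)) := by
  constructor
  · intro v
    by_cases hv : v = x
    · subst hv; exact Or.inr ⟨f, by omega, by simp, by simp⟩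
    · rcases h.eq_zero_or v with h0 | ⟨j, hj, hl, ha⟩
      · left; simp [hv, h0]
      · right; exact ⟨j, by omega, by simp [hv, hl], by simp [hj.ne, ha]⟩
  · intro j hj
    by_cases hjf : j = f
    · subst hjf; simp
    · have hj' : j < f := by omega
      have hne : a j ≠ x := by
        intro he
        have := h.link_a j hj'
        rw [he, hx] at this; omega
      simp [hjf, hne, h.link_a j hj']

/-- The numbers `size v + 1` at least double along every link, start as class sizes, and are
bounded by the number of vertices. -/
structure IsSized (N f : ℕ) (a b size : ℕ → ℕ) : Prop where
  double : ∀ j < f, 2 * (size (a j) + 1) ≤ size (b j) + 1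
  lt : ∀ v < N, size v < N
  card : ∀ v < N, rep a b f v = v →
    ((Finset.range N).filter fun w => rep a b f w = v).card = size v + 1

/-- Only the entry of the surviving representative `y` changes, and it grows. It is none of the
earlier `a j`, so earlier links keep their doubling, and `hle` gives the doubling along the new
link. The bound `lt` survives because `size y + 1` is again the cardinality of a set of vertices. -/
theorem IsSized.snoc {N f : ℕ} {a b size : ℕ → ℕ} (h : IsSized N f a b size)
    (hm : IsMergeSeq N f a b) {x y : ℕ} (hxy : x ≠ y) (hx : rep a b f x = x) (hy : rep a b f y = y)
    (hxN : x < N) (hyN : y < N) (hle : size x ≤ size y) :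
    IsSized N (f + 1) (Function.update a f x) (Function.update b f y)
      (Function.update size y (size x + size y + 1)) := by
  have hm' := hm.snoc hxy hx hy hxN hyN
  have hrep : ∀ w, rep (Function.update a f x) (Function.update b f y) (f + 1) w =
      if rep a b f w = x then y else rep a b f w := by
    intro w; simp [rep, rep_update le_rfl]
  have hcard : ∀ v < N, rep (Function.update a f x) (Function.update b f y) (f + 1) v = v →
      ((Finset.range N).filter fun w =>
        rep (Function.update a f x) (Function.update b f y) (f + 1) w = v).card =
      Function.update size y (size x + size y + 1) v + 1 := by
    intro v hv hroot
    simp only [hrep] at hroot ⊢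
    by_cases hvy : v = y
    · subst hvy
      have : ((Finset.range N).filter fun w =>
          (if rep a b f w = x then v else rep a b f w) = v) =
          ((Finset.range N).filter fun w => rep a b f w = x) ∪
          ((Finset.range N).filter fun w => rep a b f w = v) := by
        ext w; simp only [Finset.mem_filter, Finset.mem_union]
        by_cases hw : rep a b f w = x <;> simp [hw, hxy]
      rw [this, Finset.card_union_of_disjoint, h.card x hxN hx, h.card v hv hy]
      · simp; ring
      · rw [Finset.disjoint_left]
        intro w h1 h2
        simp only [Finset.mem_filter] at h1 h2
        exact hxy (h1.2.symm.trans h2.2)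
    · have hvx : v ≠ x := by
        rintro rfl
        rw [if_pos hx] at hroot; exact hvy hroot.symm
      have hv' : rep a b f v = v := by
        by_cases h' : rep a b f v = x
        · rw [if_pos h'] at hroot; exact absurd hroot.symm hvy
        · rwa [if_neg h'] at hroot
      rw [Function.update_of_ne hvy, ← h.card v hv hv']
      congr 1
      ext w
      simp only [Finset.mem_filter]
      by_cases hw : rep a b f w = x
      · simp [hw, Ne.symm hvy, Ne.symm hvx]
      · simp [hw]
  refine ⟨?_, ?_, hcard⟩
  · intro j hj
    by_cases hjf : j = f
    · subst hjf
      simp [Function.update_of_ne hxy]; omega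
    · have hj' : j < f := by omega
      have hd := h.double j hj'
      have hay : a j ≠ y := by
        intro he; exact hm.rep_ne_a hj' le_rfl y (by rw [hy, he])
      rw [Function.update_of_ne hjf, Function.update_of_ne hjf, Function.update_of_ne hay]
      by_cases hby : b j = y
      · rw [hby] at hd ⊢; simp; omega
      · rw [Function.update_of_ne hby]; exact hd
  · intro v hv
    by_cases hvy : v = y
    · subst hvy
      have h1 := hcard v hv (by rw [hrep, hy]; simp)
      have h2 := Finset.card_filter_le (Finset.range N) fun w =>
        rep (Function.update a f x) (Function.update b f v) (f + 1) w = v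
      rw [Finset.card_range] at h2
      omega
    · rw [Function.update_of_ne hvy]; exact h.lt v hv

/-! ### The outcome of Kruskal's algorithm -/

/-- The mergers made by Kruskal's algorithm on `M` edges with ends `U`, `V` and weights `W`; the
`j`-th merger comes from the edge `acc j`. -/
structure IsKruskal (N M : ℕ) (U V : ℕ → ℕ) (W : ℕ → ℝ) (f : ℕ) (acc a b : ℕ → ℕ) : Prop where
  merge : IsMergeSeq N f a b
  le : f ≤ M
  acc_lt : ∀ j < f, acc j < M
  ends : ∀ j < f, (rep a b j (U (acc j)) = a j ∧ rep a b j (V (acc j)) = b j) ∨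
    (rep a b j (U (acc j)) = b j ∧ rep a b j (V (acc j)) = a j)
  mono : ∀ i j, i ≤ j → j < f → W (acc i) ≤ W (acc j)
  span : ∀ i < M, ∃ j ≤ f, rep a b j (U i) = rep a b j (V i) ∧ ∀ j' < j, W (acc j') ≤ W i

theorem IsKruskal.rep_eq {N M : ℕ} {U V : ℕ → ℕ} {W : ℕ → ℝ} {f : ℕ} {acc a b : ℕ → ℕ}
    (h : IsKruskal N M U V W f acc a b) {i : ℕ} (hi : i < M) :
    rep a b f (U i) = rep a b f (V i) := by
  obtain ⟨j, hj, he, -⟩ := h.span i hi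
  exact h.merge.rep_eq_of_le hj le_rfl he

/-- Once an edge has caused a merger its ends stay together, while every accepted edge joins two
different classes. -/
theorem IsKruskal.acc_injective {N M : ℕ} {U V : ℕ → ℕ} {W : ℕ → ℝ} {f : ℕ} {acc a b : ℕ → ℕ}
    (h : IsKruskal N M U V W f acc a b) {i j : ℕ} (hi : i < f) (hj : j < f)
    (he : acc i = acc j) : i = j := by
  have key : ∀ i j, i < j → j < f → acc i ≠ acc j := by
    intro i j hij hj he
    have h1 : rep a b (i + 1) (U (acc i)) = rep a b (i + 1) (V (acc i)) := by
      have := h.merge.ne i (by omega)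
      rcases h.ends i (by omega) with ⟨h1, h2⟩ | ⟨h1, h2⟩ <;> simp [rep, h1, h2]
    have h2 := h.merge.rep_eq_of_le (Nat.succ_le_of_lt hij) hj.le h1
    have h3 := h.merge.ne j hj
    rw [he] at h2
    rcases h.ends j hj with ⟨h4, h5⟩ | ⟨h4, h5⟩
    · exact h3 (by rw [← h4, ← h5, h2])
    · exact h3 (by rw [← h4, ← h5, h2])
  rcases lt_trichotomy i j with hlt | heq | hlt
  · exact absurd he (key i j hlt hj)
  · exact heq
  · exact absurd he.symm (key j i hlt hi)

/-! ## A tournament tree -/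

open Classical in
/-- The better of two players; `0` stands for no player, and `i + 1` for the one with key `W i`. -/
noncomputable def better (W : ℕ → ℝ) (x y : ℕ) : ℕ :=
  if y = 0 then x else if x ≠ 0 ∧ W (x - 1) ≤ W (y - 1) then x else y

/-- The order of players. -/
def PlayerLe (W : ℕ → ℝ) (x y : ℕ) : Prop := y = 0 ∨ (x ≠ 0 ∧ W (x - 1) ≤ W (y - 1))

theorem PlayerLe.refl (W : ℕ → ℝ) (x : ℕ) : PlayerLe W x x := by
  by_cases h : x = 0
  · exact Or.inl h
  · exact Or.inr ⟨h, le_rfl⟩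

theorem PlayerLe.trans {W : ℕ → ℝ} {x y z : ℕ} (h : PlayerLe W x y) (h' : PlayerLe W y z) :
    PlayerLe W x z := by
  rcases h' with h' | ⟨h1, h2⟩
  · exact Or.inl h'
  · rcases h with h | ⟨h3, h4⟩
    · exact absurd h h1
    · exact Or.inr ⟨h3, h4.trans h2⟩

theorem better_le_left (W : ℕ → ℝ) (x y : ℕ) : PlayerLe W (better W x y) x := by
  unfold better
  split_ifs with h1 h2
  · exact .refl W x
  · exact .refl W x
  · by_cases hx : x = 0
    · exact Or.inl hx
    · exact Or.inr ⟨h1, le_of_not_ge fun h => h2 ⟨hx, h⟩⟩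

theorem better_le_right (W : ℕ → ℝ) (x y : ℕ) : PlayerLe W (better W x y) y := by
  unfold better
  split_ifs with h1 h2
  · exact Or.inl h1
  · exact Or.inr h2
  · exact .refl W y

theorem better_eq_or (W : ℕ → ℝ) (x y : ℕ) : better W x y = x ∨ better W x y = y := by
  unfold better
  split_ifs <;> simp

/-- A tournament tree for `M` players, from which the players in `gone` are removed. -/
structure IsTournament (M : ℕ) (W : ℕ → ℝ) (T : ℕ → ℕ) (gone : Finset ℕ) : Prop where
  leaf : ∀ i < M, T (M + i) = if i ∈ gone then 0 else i + 1
  node : ∀ p, 1 ≤ p → p < M → T p = better W (T (p + p)) (T (p + p + 1))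

theorem IsTournament.root_le {M : ℕ} {W : ℕ → ℝ} {T : ℕ → ℕ} {gone : Finset ℕ}
    (h : IsTournament M W T gone) {p : ℕ} (hp : 1 ≤ p) (hpM : p < 2 * M) :
    PlayerLe W (T 1) (T p) := by
  induction p using Nat.strong_induction_on with
  | _ p ih =>
    by_cases h1 : p = 1
    · subst h1; exact .refl _ _
    · have hn := h.node (p / 2) (by omega) (by omega)
      refine (ih (p / 2) (by omega) (by omega) (by omega)).trans ?_
      rcases Nat.even_or_odd' p with ⟨q, hq | hq⟩
      · have e : p / 2 + p / 2 = p := by omega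
        rw [hn, e]; exact better_le_left _ _ _
      · have e : p / 2 + p / 2 + 1 = p := by omega
        rw [hn, e]; exact better_le_right _ _ _

theorem IsTournament.eq_leaf {M : ℕ} {W : ℕ → ℝ} {T : ℕ → ℕ} {gone : Finset ℕ}
    (h : IsTournament M W T gone) {p : ℕ} (hp : 1 ≤ p) (hpM : p < 2 * M) :
    T p = 0 ∨ ∃ i < M, i ∉ gone ∧ T p = i + 1 := by
  -- Children have larger indices than their parent, so the induction runs on the distance to the
  -- end of the tree.
  obtain ⟨d, hd⟩ : ∃ d, d = 2 * M - p := ⟨_, rfl⟩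
  induction d using Nat.strong_induction_on generalizing p with
  | _ d ih =>
    by_cases hpl : M ≤ p
    · obtain ⟨i, rfl⟩ := Nat.exists_eq_add_of_le hpl
      have := h.leaf i (by omega)
      by_cases hi : i ∈ gone
      · left; simpa [hi] using this
      · right; exact ⟨i, by omega, hi, by simpa [hi] using this⟩
    · have hn := h.node p hp (by omega)
      rcases better_eq_or W (T (p + p)) (T (p + p + 1)) with e | e
      · rw [hn, e]; exact ih (2 * M - (p + p)) (by omega) (by omega) (by omega) rfl
      · rw [hn, e]; exact ih (2 * M - (p + p + 1)) (by omega) (by omega) (by omega) rfl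

/-- The root holds a remaining player with the smallest key. -/
theorem IsTournament.root {M : ℕ} {W : ℕ → ℝ} {T : ℕ → ℕ} {gone : Finset ℕ}
    (h : IsTournament M W T gone) (hgone : gone.card < M) :
    ∃ e < M, e ∉ gone ∧ T 1 = e + 1 ∧ ∀ i < M, i ∉ gone → W e ≤ W i := by
  obtain ⟨i, hi, hig⟩ : ∃ i ∈ Finset.range M, i ∉ gone :=
    Finset.exists_mem_notMem_of_card_lt_card (by simpa using hgone)
  rw [Finset.mem_range] at hi
  have key : ∀ i < M, i ∉ gone → T 1 ≠ 0 ∧ W (T 1 - 1) ≤ W i := by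
    intro i hi hig
    have h1 := h.root_le (p := M + i) (by omega) (by omega)
    rw [h.leaf i hi, if_neg hig] at h1
    rcases h1 with h1 | h1
    · omega
    · simpa using h1
  rcases h.eq_leaf (p := 1) le_rfl (by omega) with h0 | ⟨e, he, heg, h1⟩
  · exact absurd h0 (key i hi hig).1
  · refine ⟨e, he, heg, h1, fun i hi hig => ?_⟩
    have := (key i hi hig).2
    rwa [h1, Nat.add_sub_cancel] at this

/-- A tournament tree whose nodes above `p` are not yet up to date. -/
structure IsTournamentBut (M : ℕ) (W : ℕ → ℝ) (T : ℕ → ℕ) (gone : Finset ℕ) (p : ℕ) : Prop where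
  leaf : ∀ i < M, T (M + i) = if i ∈ gone then 0 else i + 1
  node : ∀ q, 1 ≤ q → q < M →
    T q = better W (T (q + q)) (T (q + q + 1)) ∨ ∃ t, 1 ≤ t ∧ p / 2 ^ t = q

/-- Only the parent of the changed leaf reads its value, so every other inner node still satisfies
its equation. -/
theorem IsTournament.remove {M : ℕ} {W : ℕ → ℝ} {T : ℕ → ℕ} {gone : Finset ℕ}
    (h : IsTournament M W T gone) {e : ℕ} :
    IsTournamentBut M W (Function.update T (M + e) 0) (insert e gone) (M + e) := by
  constructor
  · intro i hi
    by_cases hie : i = e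
    · subst hie; simp
    · simp [hie, h.leaf i hi]
  · intro q hq hqM
    by_cases hq2 : (M + e) / 2 = q
    · exact Or.inr ⟨1, le_rfl, by simpa using hq2⟩
    · left
      rw [Function.update_of_ne (by omega), Function.update_of_ne (by omega),
        Function.update_of_ne (by omega), h.node q hq hqM]

/-- Recomputing the parent repairs its equation and can spoil only that of the grandparent, so the
defect moves up one level. -/
theorem IsTournamentBut.step {M : ℕ} {W : ℕ → ℝ} {T : ℕ → ℕ} {gone : Finset ℕ} {p : ℕ}
    (h : IsTournamentBut M W T gone p) (hpM : p < 2 * M) :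
    IsTournamentBut M W (Function.update T (p / 2)
      (better W (T (p / 2 + p / 2)) (T (p / 2 + p / 2 + 1)))) gone (p / 2) := by
  constructor
  · intro i hi
    rw [Function.update_of_ne (by omega), h.leaf i hi]
  · intro q hq hqM
    by_cases h1 : q = p / 2
    · left
      subst h1
      rw [Function.update_self, Function.update_of_ne (by omega), Function.update_of_ne (by omega)]
    · by_cases h2 : p / 2 / 2 = q
      · exact Or.inr ⟨1, le_rfl, by simpa using h2⟩
      · rcases h.node q hq hqM with h3 | ⟨t, ht, h3⟩
        · left
          rw [Function.update_of_ne h1, Function.update_of_ne (by omega),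
            Function.update_of_ne (by omega), h3]
        · right
          obtain ⟨t, rfl⟩ := Nat.exists_eq_add_of_le' ht
          have h4 : p / 2 / 2 ^ t = q := by rw [Nat.div_div_eq_div_mul, ← pow_succ', h3]
          refine ⟨t, ?_, h4⟩
          by_contra ht0
          obtain rfl : t = 0 := by omega
          exact h1 (by simpa using h4.symm)

theorem IsTournamentBut.finish {M : ℕ} {W : ℕ → ℝ} {T : ℕ → ℕ} {gone : Finset ℕ} {p : ℕ}
    (h : IsTournamentBut M W T gone p) (hp : p < 2) : IsTournament M W T gone := by
  refine ⟨h.leaf, fun q hq hqM => ?_⟩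
  rcases h.node q hq hqM with h3 | ⟨t, ht, h3⟩
  · exact h3
  · have : p / 2 ^ t = 0 := Nat.div_eq_of_lt (lt_of_lt_of_le hp (Nat.le_self_pow (by omega) 2))
    omega

/-! ## Kruskal's algorithm, mathematically -/

/-- The state of Kruskal's algorithm after the edges in `gone` have been treated. -/
structure IsPartialKruskal (N M : ℕ) (U V : ℕ → ℕ) (W : ℕ → ℝ) (f : ℕ) (acc a b : ℕ → ℕ)
    (gone : Finset ℕ) : Prop where
  merge : IsMergeSeq N f a b
  le : f ≤ gone.card
  sub : ∀ e ∈ gone, e < M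
  acc_mem : ∀ j < f, acc j ∈ gone
  ends : ∀ j < f, (rep a b j (U (acc j)) = a j ∧ rep a b j (V (acc j)) = b j) ∨
    (rep a b j (U (acc j)) = b j ∧ rep a b j (V (acc j)) = a j)
  mono : ∀ i j, i ≤ j → j < f → W (acc i) ≤ W (acc j)
  span : ∀ i ∈ gone, ∃ j ≤ f, rep a b j (U i) = rep a b j (V i) ∧ ∀ j' < j, W (acc j') ≤ W i
  least : ∀ e ∈ gone, ∀ i < M, i ∉ gone → W e ≤ W i

namespace IsPartialKruskal

variable {N M : ℕ} {U V : ℕ → ℕ} {W : ℕ → ℝ} {f : ℕ} {acc a b : ℕ → ℕ} {gone : Finset ℕ}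

/-- The rejected edge meets `span` at the present time `f`, because by `least` everything accepted
so far is no heavier. -/
theorem reject (h : IsPartialKruskal N M U V W f acc a b gone) {e : ℕ} (he : e < M)
    (heg : e ∉ gone) (hmin : ∀ i < M, i ∉ gone → W e ≤ W i)
    (heq : rep a b f (U e) = rep a b f (V e)) :
    IsPartialKruskal N M U V W f acc a b (insert e gone) where
  merge := h.merge
  le := h.le.trans (Finset.card_le_card (Finset.subset_insert _ _))
  sub := by
    intro i hi
    rcases Finset.mem_insert.1 hi with rfl | hi
    · exact he
    · exact h.sub i hi
  acc_mem j hj := Finset.mem_insert_of_mem (h.acc_mem j hj)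
  ends := h.ends
  mono := h.mono
  span := by
    intro i hi
    rcases Finset.mem_insert.1 hi with rfl | hi
    · exact ⟨f, le_rfl, heq, fun j hj => h.least _ (h.acc_mem j hj) _ he heg⟩
    · exact h.span i hi
  least := by
    intro i hi i' hi' hi'g
    rw [Finset.mem_insert, not_or] at hi'g
    rcases Finset.mem_insert.1 hi with rfl | hi
    · exact hmin i' hi' hi'g.2
    · exact h.least i hi i' hi' hi'g.2

theorem accept (h : IsPartialKruskal N M U V W f acc a b gone) {e x y : ℕ} (he : e < M)
    (heg : e ∉ gone) (hmin : ∀ i < M, i ∉ gone → W e ≤ W i) (hxy : x ≠ y)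
    (hx : x < N) (hy : y < N)
    (heq : (rep a b f (U e) = x ∧ rep a b f (V e) = y) ∨
      (rep a b f (U e) = y ∧ rep a b f (V e) = x)) :
    IsPartialKruskal N M U V W (f + 1) (Function.update acc f e) (Function.update a f x)
      (Function.update b f y) (insert e gone) := by
  have hx' : rep a b f x = x := by
    rcases heq with ⟨h1, h2⟩ | ⟨h1, h2⟩
    · rw [← h1, h.merge.rep_rep_self le_rfl]
    · rw [← h2, h.merge.rep_rep_self le_rfl]
  have hy' : rep a b f y = y := by
    rcases heq with ⟨h1, h2⟩ | ⟨h1, h2⟩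
    · rw [← h2, h.merge.rep_rep_self le_rfl]
    · rw [← h1, h.merge.rep_rep_self le_rfl]
  have key : ∀ j < f + 1, j < f ∨ j = f := fun j hj => by omega
  refine ⟨h.merge.snoc hxy hx' hy' hx hy, ?_, ?_, ?_, ?_, ?_, ?_, ?_⟩
  · rw [Finset.card_insert_of_notMem heg]; have := h.le; omega
  · intro i hi
    rcases Finset.mem_insert.1 hi with rfl | hi
    · exact he
    · exact h.sub i hi
  · intro j hj
    rcases key j hj with hj | rfl
    · rw [Function.update_of_ne hj.ne]; exact Finset.mem_insert_of_mem (h.acc_mem j hj)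
    · simp
  · intro j hj
    rcases key j hj with hj | rfl
    · rw [rep_update hj.le, rep_update hj.le]
      simpa [Function.update_of_ne hj.ne] using h.ends j hj
    · rw [rep_update le_rfl, rep_update le_rfl]
      simpa using heq
  · intro i j hij hj
    rcases key j hj with hj | rfl
    · rw [Function.update_of_ne hj.ne, Function.update_of_ne (by omega)]; exact h.mono i j hij hj
    · rcases hij.lt_or_eq with hij | rfl
      · rw [Function.update_of_ne hij.ne, Function.update_self]
        exact h.least _ (h.acc_mem i hij) e he heg
      · exact le_rfl
  · intro i hi
    rcases Finset.mem_insert.1 hi with rfl | hi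
    · refine ⟨f + 1, le_rfl, ?_, ?_⟩
      · rcases heq with ⟨h1, h2⟩ | ⟨h1, h2⟩ <;> simp [rep, rep_update le_rfl, h1, h2]
      · intro j hj
        rcases key j hj with hj | rfl
        · rw [Function.update_of_ne hj.ne]; exact h.least _ (h.acc_mem j hj) _ he heg
        · simp
    · obtain ⟨j, hj, h1, h2⟩ := h.span i hi
      refine ⟨j, by omega, by rwa [rep_update hj, rep_update hj], fun j' hj' => ?_⟩
      rw [Function.update_of_ne (by omega)]; exact h2 j' hj'
  · intro i hi i' hi' hi'g
    rw [Finset.mem_insert, not_or] at hi'g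
    rcases Finset.mem_insert.1 hi with rfl | hi
    · exact hmin i' hi' hi'g.2
    · exact h.least i hi i' hi' hi'g.2

theorem isKruskal (h : IsPartialKruskal N M U V W f acc a b gone) (hcard : gone.card = M) :
    IsKruskal N M U V W f acc a b := by
  have hall : gone = Finset.range M :=
    Finset.eq_of_subset_of_card_le (fun e he => Finset.mem_range.2 (h.sub e he)) (by simp [hcard])
  exact ⟨h.merge, hcard ▸ h.le, fun j hj => h.sub _ (h.acc_mem j hj), h.ends, h.mono,
    fun i hi => h.span i (by simpa [hall] using hi)⟩

end IsPartialKruskal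

/-! ## Kruskal's algorithm as a program

The arrays are numbered from a base `o`: the ends of the edges are in the integer arrays `o + 1`
and `o + 2`, the weights in the real array `o + 1`, the number of edges in the variable `o + 4`.
The number of mergers is left in the variable `o + 5`, the accepted edges in array `o + 6`, the
merged representatives in `o + 7` and `o + 8`. Array `o + 9` holds the links, `o + 10` the sizes,
`o + 11` the tournament tree, `o + 12` the halves of its indices. -/

/-- Lets the players below node `o + 14` compete. -/
def competeProg (o : ℕ) : Prog :=
  let p := NExp.var (o + 14)
  let l := NExp.get (o + 11) (p.add p)
  let r := NExp.get (o + 11) ((p.add p).add (.lit 1))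
  .ite (.natLe r (.lit 0)) (.setNat (o + 11) p l)
    (.ite (.and (.not (.natLe l (.lit 0)))
        (.realLe (.get (o + 1) (l.sub (.lit 1))) (.get (o + 1) (r.sub (.lit 1)))))
      (.setNat (o + 11) p l) (.setNat (o + 11) p r))

theorem competeProg_exec (o : ℕ) (s : State) :
    (competeProg o).exec s = s.setNat (o + 11) (s.nat (o + 14) 0)
      (better (s.real (o + 1)) (s.nat (o + 11) (s.nat (o + 14) 0 + s.nat (o + 14) 0))
        (s.nat (o + 11) (s.nat (o + 14) 0 + s.nat (o + 14) 0 + 1))) := by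
  simp only [competeProg, Prog.exec, NExp.eval, RExp.eval, BExp.eval, better, Nat.le_zero]
  split_ifs <;> simp_all

/-- Enters the players at the leaves. -/
def leavesProg (o : ℕ) : Prog :=
  let i := NExp.var (o + 13)
  .loop (.not (.natLe (.var (o + 4)) i))
    ((Prog.setNat (o + 11) ((NExp.var (o + 4)).add i) (i.add (.lit 1))).seq
      (.setVar (o + 13) (i.add (.lit 1))))

/-- Fills the inner nodes, and the table of halves. -/
def nodesProg (o : ℕ) : Prog :=
  let p := NExp.var (o + 14)
  .loop (.natLe (.lit 1) p)
    ((competeProg o).seq ((Prog.setNat (o + 12) (p.add p) p).seq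
      ((Prog.setNat (o + 12) ((p.add p).add (.lit 1)) p).seq (.setVar (o + 14) (p.sub (.lit 1))))))

/-- Builds the tournament tree and resets the edge counter. -/
def buildProg (o : ℕ) : Prog :=
  (Prog.setVar (o + 13) (.lit 0)).seq ((leavesProg o).seq
    ((Prog.setVar (o + 14) ((NExp.var (o + 4)).sub (.lit 1))).seq
      ((nodesProg o).seq (.setVar (o + 13) (.lit 0)))))

/-- Repairs the tournament tree above node `o + 14`. -/
def repairProg (o : ℕ) : Prog :=
  let p := NExp.var (o + 14)
  .loop (.natLe (.lit 2) p) ((Prog.setVar (o + 14) (.get (o + 12) p)).seq (competeProg o))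

/-- Extracts the lightest remaining edge into the variable `o + 17`. -/
def extractProg (o : ℕ) : Prog :=
  let e := NExp.var (o + 17)
  (Prog.setVar (o + 17) ((NExp.get (o + 11) (.lit 1)).sub (.lit 1))).seq
    ((Prog.setVar (o + 14) ((NExp.var (o + 4)).add e)).seq
      ((Prog.setNat (o + 11) (.var (o + 14)) (.lit 0)).seq (repairProg o)))

/-- Follows the links from the vertex in the variable `d` to its representative. -/
def climbProg (o d : ℕ) : Prog :=
  .loop (.natLe (.lit 1) (.get (o + 9) (.var d)))
    (.setVar d (.get (o + 8) ((NExp.get (o + 9) (.var d)).sub (.lit 1))))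

/-- Merges the class of the variable `x` into the class of the variable `y`. -/
def mergeProg (o x y : ℕ) : Prog :=
  let f := NExp.var (o + 5)
  (Prog.setNat (o + 6) f (.var (o + 17))).seq ((Prog.setNat (o + 7) f (.var x)).seq
    ((Prog.setNat (o + 8) f (.var y)).seq ((Prog.setNat (o + 9) (.var x) (f.add (.lit 1))).seq
      ((Prog.setNat (o + 10) (.var y)
        (((NExp.get (o + 10) (.var x)).add (.get (o + 10) (.var y))).add (.lit 1))).seq
        (.setVar (o + 5) (f.add (.lit 1)))))))

/-- Merges the classes of the variables `o + 15` and `o + 16` if they differ. -/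
def uniteProg (o : ℕ) : Prog :=
  let x := NExp.var (o + 15)
  let y := NExp.var (o + 16)
  (Prog.ite (.and (.natLe x y) (.natLe y x)) .skip
    (.ite (.natLe (.get (o + 10) x) (.get (o + 10) y))
      (mergeProg o (o + 15) (o + 16)) (mergeProg o (o + 16) (o + 15)))).seq
    (.setVar (o + 13) ((NExp.var (o + 13)).add (.lit 1)))

/-- Treats the lightest remaining edge. -/
def kruskalStep (o : ℕ) : Prog :=
  (extractProg o).seq
    ((Prog.setVar (o + 15) (.get (o + 1) (.var (o + 17)))).seq ((climbProg o (o + 15)).seq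
      ((Prog.setVar (o + 16) (.get (o + 2) (.var (o + 17)))).seq ((climbProg o (o + 16)).seq
        (uniteProg o)))))

/-- Kruskal's algorithm. -/
def kruskalProg (o : ℕ) : Prog :=
  (buildProg o).seq (.loop (.not (.natLe (.var (o + 4)) (.var (o + 13)))) (kruskalStep o))

/-! ### Correctness and running time of Kruskal's algorithm -/

theorem leavesProg_halts {o : ℕ} {s : State} {M : ℕ} (hM : s.nat (o + 4) 0 = M)
    (hi : s.nat (o + 13) 0 = 0) :
    Halts (leavesProg o) s ((M + 1) * 100)
      (fun s' => ∀ i < M, s'.nat (o + 11) (M + i) = i + 1) := by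
  refine (Halts.for (I := fun t s' => s'.nat (o + 4) 0 = M ∧ s'.nat (o + 13) 0 = t ∧
      ∀ i < t, s'.nat (o + 11) (M + i) = i + 1) (c := 50) ?_ ?_ ⟨hM, hi, by simp⟩ ?_).mono
      le_rfl fun s' h => h.2.2
  · rintro t s' ht ⟨h1, h2, -⟩
    simp [BExp.eval, NExp.eval, h1, h2]
  · rintro t s' ht ⟨h1, h2, h3⟩
    refine Prog.LoopFree.halts (by simp [Prog.LoopFree]) (by simp [Prog.maxCost, NExp.cost]) ?_
    simp only [Prog.exec, NExp.eval, State.setNat_nat]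
    simp [h1, h2, Function.update_apply]
    intro i hi
    split_ifs with h
    · omega
    · exact h3 i (by omega)
  · simp [BExp.cost, NExp.cost]

theorem competeProg_loopFree (o : ℕ) : (competeProg o).LoopFree := by
  simp [competeProg, Prog.LoopFree]

theorem competeProg_maxCost (o : ℕ) : (competeProg o).maxCost ≤ 200 := by
  simp [competeProg, Prog.maxCost, NExp.cost, BExp.cost, RExp.cost]

theorem nodesProg_halts {o : ℕ} {s : State} {M : ℕ} (hp : s.nat (o + 14) 0 = M - 1)
    (hl : ∀ i < M, s.nat (o + 11) (M + i) = i + 1) :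
    Halts (nodesProg o) s ((M + 1) * 500) (fun s' =>
      IsTournament M (s.real (o + 1)) (s'.nat (o + 11)) ∅ ∧
      ∀ q, 2 ≤ q → q < 2 * M → s'.nat (o + 12) q = q / 2) := by
  refine (Halts.for (B := M - 1) (I := fun t s' => s'.nat (o + 14) 0 = M - 1 - t ∧
      s'.real (o + 1) = s.real (o + 1) ∧ (∀ i < M, s'.nat (o + 11) (M + i) = i + 1) ∧
      (∀ p, 1 ≤ p → p < M → M - 1 - t < p → s'.nat (o + 11) p =
        better (s.real (o + 1)) (s'.nat (o + 11) (p + p)) (s'.nat (o + 11) (p + p + 1))) ∧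
      ∀ q, 2 ≤ q → q < 2 * M → 2 * (M - 1 - t) < q - 1 → s'.nat (o + 12) q = q / 2)
      (c := 300) (c' := 500) ?_ ?_ ⟨hp, rfl, hl, ?_, ?_⟩ ?_).mono ?_ ?_
  · rintro t s' ht ⟨h1, -⟩
    simp only [BExp.eval, NExp.eval, h1]; omega
  · rintro t s' ht ⟨h1, h2, h3, h4, h5⟩
    obtain ⟨p, hp⟩ : ∃ p, p = M - 1 - t := ⟨_, rfl⟩
    rw [← hp] at h1 h4 h5
    have hp1 : M - 1 - (t + 1) = p - 1 := by omega
    refine Prog.LoopFree.halts ?_ ?_ ?_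
    · simp [Prog.LoopFree, competeProg_loopFree]
    · have := competeProg_maxCost o
      simp only [Prog.maxCost, NExp.cost]; omega
    · simp only [Prog.exec, competeProg_exec, NExp.eval, State.setNat_nat, State.setNat_real, hp1]
      simp only [Nat.add_left_cancel_iff, Nat.reduceEqDiff, if_false, if_true,
        Function.update_self, h1, h2]
      refine ⟨trivial, trivial, ?_, ?_, ?_⟩
      · intro i hi
        rw [Function.update_of_ne (by omega), h3 i hi]
      · intro q hq hqM hpq
        by_cases hqp : q = p
        · subst hqp
          rw [Function.update_self, Function.update_of_ne (by omega),
            Function.update_of_ne (by omega)]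
        · rw [Function.update_of_ne (by omega), Function.update_of_ne (by omega),
            Function.update_of_ne (by omega), h4 q hq hqM (by omega)]
      · intro q hq hqM hpq
        by_cases hq1 : q = p + p + 1
        · subst hq1; rw [Function.update_self]; omega
        · rw [Function.update_of_ne hq1]
          by_cases hq2 : q = p + p
          · subst hq2; rw [Function.update_self]; omega
          · rw [Function.update_of_ne hq2, h5 q hq hqM (by omega)]
  · intro p h1 h2 h3; omega
  · intro q h1 h2 h3; omega
  · simp [BExp.cost, NExp.cost]
  · exact Nat.mul_le_mul_right _ (by omega)
  · rintro s' ⟨-, h2, h3, h4, h5⟩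
    refine ⟨⟨by simpa using h3, fun p h6 h7 => h4 p h6 h7 (by omega)⟩, fun q h6 h7 => ?_⟩
    exact h5 q h6 h7 (by omega)

theorem buildProg_halts {o : ℕ} {s : State} {M : ℕ} (hM : s.nat (o + 4) 0 = M) :
    Halts (buildProg o) s ((M + 1) * 1000) (fun s' =>
      IsTournament M (s.real (o + 1)) (s'.nat (o + 11)) ∅ ∧
      (∀ q, 2 ≤ q → q < 2 * M → s'.nat (o + 12) q = q / 2) ∧ s'.nat (o + 13) 0 = 0) := by
  have hc : 100 + ((M + 1) * 100 + (100 + ((M + 1) * 500 + 100))) ≤ (M + 1) * 1000 := by omega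
  refine Halts.mono ?_ hc fun _ h => h
  refine (Halts.setNat (by simp [NExp.cost])).seq ?_
  rintro s1 rfl
  refine (leavesProg_halts (M := M) (by simp [State.setNat_nat, hM])
    (by simp [State.setNat_nat, NExp.eval])).frame.seq ?_
  rintro s2 ⟨h2, hf, hr⟩
  refine (Halts.setNat (by simp [NExp.cost])).seq ?_
  rintro s3 rfl
  refine (nodesProg_halts (M := M) ?_ ?_).seq ?_
  · have := hf (o + 4) (by simp [leavesProg, Prog.writesNat])
    simp [State.setNat_nat, NExp.eval, this, hM]
  · simpa [State.setNat_nat, NExp.eval] using h2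
  · rintro s4 ⟨h3, h4⟩
    refine (Halts.setNat (by simp [NExp.cost])).mono le_rfl ?_
    rintro s5 rfl
    have := hr (o + 1) (by simp [leavesProg, Prog.writesReal])
    simp only [State.setNat_real, this, State.setNat_nat] at h3 ⊢
    simp [NExp.eval]
    exact ⟨h3, h4⟩

/-- The node index at least halves in each round, so `l` rounds suffice. The half is read from a
table because the machine cannot divide integers. -/
theorem repairProg_halts {o : ℕ} {s : State} {M l : ℕ} {gone : Finset ℕ} {W : ℕ → ℝ}
    (hW : s.real (o + 1) = W) (hM : 2 * M ≤ 2 ^ l)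
    (hhalf : ∀ q, 2 ≤ q → q < 2 * M → s.nat (o + 12) q = q / 2)
    (hp1 : 1 ≤ s.nat (o + 14) 0) (hp2 : s.nat (o + 14) 0 < 2 * M)
    (hT : IsTournamentBut M W (s.nat (o + 11)) gone (s.nat (o + 14) 0)) :
    Halts (repairProg o) s ((l + 1) * 500) (fun s' => IsTournament M W (s'.nat (o + 11)) gone) := by
  refine (Halts.loop (I := fun t s' => s'.real (o + 1) = W ∧ s'.nat (o + 12) = s.nat (o + 12) ∧
    1 ≤ s'.nat (o + 14) 0 ∧ s'.nat (o + 14) 0 * 2 ^ t < 2 * M ∧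
    IsTournamentBut M W (s'.nat (o + 11)) gone (s'.nat (o + 14) 0)) (B := l) (c := 300) ?_ ?_
    ⟨hW, rfl, hp1, by simpa using hp2, hT⟩ ?_).mono le_rfl ?_
  · rintro t s' ⟨-, -, -, h4, -⟩ hb
    simp only [BExp.eval, NExp.eval] at hb
    have : 2 ^ t < 2 ^ l := by nlinarith [Nat.one_le_two_pow (n := t)]
    exact (Nat.pow_lt_pow_iff_right (by norm_num)).1 this
  · rintro t s' ⟨h1, h2, h3, h4, h5⟩ hb
    simp only [BExp.eval, NExp.eval] at hb
    have hlt : s'.nat (o + 14) 0 < 2 * M := lt_of_le_of_lt (Nat.le_mul_of_pos_right _ (by positivity)) h4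
    have hh := hhalf _ hb hlt
    refine Prog.LoopFree.halts ?_ ?_ ?_
    · simp [Prog.LoopFree, competeProg_loopFree]
    · have := competeProg_maxCost o
      simp only [Prog.maxCost, NExp.cost]; omega
    · simp only [Prog.exec, competeProg_exec, NExp.eval, State.setNat_nat, State.setNat_real]
      simp only [Nat.add_left_cancel_iff, Nat.reduceEqDiff, if_false, if_true,
        Function.update_self, h1, h2, hh]
      refine ⟨trivial, trivial, by omega, ?_, h5.step hlt⟩
      rw [pow_succ]
      have : s'.nat (o + 14) 0 / 2 * 2 ≤ s'.nat (o + 14) 0 := Nat.div_mul_le_self _ _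
      calc _ = s'.nat (o + 14) 0 / 2 * 2 * 2 ^ t := by ring
        _ ≤ s'.nat (o + 14) 0 * 2 ^ t := Nat.mul_le_mul_right _ this
        _ < _ := h4
  · simp [BExp.cost, NExp.cost]
  · rintro s' ⟨hb, t, -, -, -, -, h5⟩
    simp only [BExp.eval, NExp.eval] at hb
    exact h5.finish (by omega)

theorem extractProg_halts {o : ℕ} {s : State} {M l : ℕ} {gone : Finset ℕ} {W : ℕ → ℝ}
    (hW : s.real (o + 1) = W) (hM : s.nat (o + 4) 0 = M) (hMl : 2 * M ≤ 2 ^ l)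
    (hhalf : ∀ q, 2 ≤ q → q < 2 * M → s.nat (o + 12) q = q / 2)
    (hT : IsTournament M W (s.nat (o + 11)) gone) (hgone : gone.card < M) :
    Halts (extractProg o) s ((l + 1) * 800) (fun s' => ∃ e < M, e ∉ gone ∧
      (∀ i < M, i ∉ gone → W e ≤ W i) ∧ s'.nat (o + 17) 0 = e ∧
      IsTournament M W (s'.nat (o + 11)) (insert e gone)) := by
  have hc : 100 + (100 + (100 + (l + 1) * 500)) ≤ (l + 1) * 800 := by omega
  obtain ⟨e, he, heg, h1, hmin⟩ := hT.root hgone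
  refine Halts.mono ?_ hc fun _ h => h
  refine (Halts.setNat (by simp [NExp.cost])).seq ?_
  rintro s1 rfl
  refine (Halts.setNat (by simp [NExp.cost])).seq ?_
  rintro s2 rfl
  refine (Halts.setNat (by simp [NExp.cost])).seq ?_
  rintro s3 rfl
  refine (repairProg_halts (M := M) (l := l) (W := W) (gone := insert e gone) ?_ hMl ?_ ?_ ?_ ?_).frame.mono
    le_rfl ?_
  · simpa [State.setNat_real] using hW
  · simpa [State.setNat_nat] using hhalf
  · simp [State.setNat_nat, NExp.eval, h1, hM]; omega
  · simp [State.setNat_nat, NExp.eval, h1, hM]; omega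
  · simp [State.setNat_nat, NExp.eval, h1, hM]
    exact hT.remove
  · rintro s4 ⟨h, hf, -⟩
    refine ⟨e, he, heg, hmin, ?_, h⟩
    rw [hf (o + 17) (by simp [repairProg, competeProg, Prog.writesNat])]
    simp [State.setNat_nat, NExp.eval, h1]

/-- Every link at least doubles `size + 1`, which stays at most `N ≤ 2 ^ l`; so a chain has at most
`l` links, even though paths are never compressed. -/
theorem climbProg_halts {o d : ℕ} {s : State} {N f l : ℕ} (hd8 : d ≠ o + 8) (hd9 : d ≠ o + 9)
    (hm : IsMergeSeq N f (s.nat (o + 7)) (s.nat (o + 8)))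
    (hl : IsLink f (s.nat (o + 7)) (s.nat (o + 9)))
    (hs : IsSized N f (s.nat (o + 7)) (s.nat (o + 8)) (s.nat (o + 10)))
    (hN : N ≤ 2 ^ l) (hv : s.nat d 0 < N) :
    Halts (climbProg o d) s ((l + 1) * 100) (fun s' => s' =
      s.setNat d 0 (rep (s.nat (o + 7)) (s.nat (o + 8)) f (s.nat d 0))) := by
  refine (Halts.loop (I := fun t s' => ∃ w, s' = s.setNat d 0 w ∧ w < N ∧
    rep (s.nat (o + 7)) (s.nat (o + 8)) f w = rep (s.nat (o + 7)) (s.nat (o + 8)) f (s.nat d 0) ∧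
    2 ^ t ≤ s.nat (o + 10) w + 1) (B := l) (c := 50) ?_ ?_ ⟨s.nat d 0, ?_, hv, rfl, by simp⟩ ?_).mono
    le_rfl ?_
  · rintro t s' ⟨w, rfl, hw, -, h2⟩ hb
    simp [BExp.eval, NExp.eval, State.setNat_nat, hd9.symm] at hb
    rcases hl.eq_zero_or w with h0 | ⟨j, hj, -, rfl⟩
    · omega
    · have h3 := hs.double j hj
      have h4 := hs.lt _ (hm.b_lt j hj)
      have : 2 ^ t < 2 ^ l := by
        have := Nat.one_le_two_pow (n := t)
        omega
      exact (Nat.pow_lt_pow_iff_right (by norm_num)).1 this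
  · rintro t s' ⟨w, rfl, hw, h1, h2⟩ hb
    simp [BExp.eval, NExp.eval, State.setNat_nat, hd9.symm] at hb
    rcases hl.eq_zero_or w with h0 | ⟨j, hj, h3, rfl⟩
    · omega
    · refine (Halts.setNat (by simp [NExp.cost])).mono le_rfl ?_
      rintro s1 rfl
      refine ⟨s.nat (o + 8) j, ?_, hm.b_lt j hj, ?_, ?_⟩
      · simp [NExp.eval, State.setNat_nat, hd9.symm, hd8.symm, State.setNat_setNat, h3]
      · rw [← h1, ← hm.rep_succ_a hj, hm.rep_rep hj le_rfl]
      · have := hs.double j hj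
        rw [pow_succ]; omega
  · simp [State.setNat]
  · simp [BExp.cost, NExp.cost]
  · rintro s' ⟨hb, t, w, rfl, hw, h1, -⟩
    simp [BExp.eval, NExp.eval, State.setNat_nat, hd9.symm] at hb
    rw [← h1, hl.rep_eq_self le_rfl (Or.inl hb)]

/-- The invariant of Kruskal's algorithm, after the edges in `gone` have been treated. -/
structure KruskalInv (o N M : ℕ) (U V : ℕ → ℕ) (W : ℕ → ℝ) (gone : Finset ℕ) (s : State) :
    Prop where
  M_eq : s.nat (o + 4) 0 = M
  card_eq : s.nat (o + 13) 0 = gone.card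
  U_eq : s.nat (o + 1) = U
  V_eq : s.nat (o + 2) = V
  W_eq : s.real (o + 1) = W
  tour : IsTournament M W (s.nat (o + 11)) gone
  half : ∀ q, 2 ≤ q → q < 2 * M → s.nat (o + 12) q = q / 2
  part : IsPartialKruskal N M U V W (s.nat (o + 5) 0) (s.nat (o + 6)) (s.nat (o + 7))
    (s.nat (o + 8)) gone
  link : IsLink (s.nat (o + 5) 0) (s.nat (o + 7)) (s.nat (o + 9))
  sized : IsSized N (s.nat (o + 5) 0) (s.nat (o + 7)) (s.nat (o + 8)) (s.nat (o + 10))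

theorem mergeProg_exec (o x y : ℕ) (s : State) (hx : o + 10 < x) (hy : o + 10 < y) :
    (mergeProg o x y).exec s = ((((((s.setNat (o + 6) (s.nat (o + 5) 0) (s.nat (o + 17) 0)).setNat
      (o + 7) (s.nat (o + 5) 0) (s.nat x 0)).setNat (o + 8) (s.nat (o + 5) 0) (s.nat y 0)).setNat
      (o + 9) (s.nat x 0) (s.nat (o + 5) 0 + 1)).setNat (o + 10) (s.nat y 0)
      (s.nat (o + 10) (s.nat x 0) + s.nat (o + 10) (s.nat y 0) + 1)).setNat (o + 5) 0
      (s.nat (o + 5) 0 + 1)) := by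
  have h6 : x ≠ o + 6 := by omega
  have h7 : x ≠ o + 7 := by omega
  have h8 : x ≠ o + 8 := by omega
  have h9 : x ≠ o + 9 := by omega
  have h10 : x ≠ o + 10 := by omega
  have k6 : y ≠ o + 6 := by omega
  have k7 : y ≠ o + 7 := by omega
  have k8 : y ≠ o + 8 := by omega
  have k9 : y ≠ o + 9 := by omega
  simp [mergeProg, Prog.exec, NExp.eval, State.setNat_nat, *]

theorem uniteProg_halts {o N M : ℕ} {U V : ℕ → ℕ} {W : ℕ → ℝ} {gone : Finset ℕ} {s : State}
    {e : ℕ} (he : e < M) (heg : e ∉ gone) (hmin : ∀ i < M, i ∉ gone → W e ≤ W i)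
    (hU : U e < N) (hV : V e < N) (hM : s.nat (o + 4) 0 = M) (hi : s.nat (o + 13) 0 = gone.card)
    (hUe : s.nat (o + 1) = U) (hVe : s.nat (o + 2) = V) (hWe : s.real (o + 1) = W)
    (htour : IsTournament M W (s.nat (o + 11)) (insert e gone))
    (hhalf : ∀ q, 2 ≤ q → q < 2 * M → s.nat (o + 12) q = q / 2)
    (hpart : IsPartialKruskal N M U V W (s.nat (o + 5) 0) (s.nat (o + 6)) (s.nat (o + 7))
      (s.nat (o + 8)) gone)
    (hlink : IsLink (s.nat (o + 5) 0) (s.nat (o + 7)) (s.nat (o + 9)))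
    (hsized : IsSized N (s.nat (o + 5) 0) (s.nat (o + 7)) (s.nat (o + 8)) (s.nat (o + 10)))
    (h17 : s.nat (o + 17) 0 = e)
    (h15 : s.nat (o + 15) 0 = rep (s.nat (o + 7)) (s.nat (o + 8)) (s.nat (o + 5) 0) (U e))
    (h16 : s.nat (o + 16) 0 = rep (s.nat (o + 7)) (s.nat (o + 8)) (s.nat (o + 5) 0) (V e)) :
    Halts (uniteProg o) s 300 (KruskalInv o N M U V W (insert e gone)) := by
  refine Prog.LoopFree.halts ?_ ?_ ?_
  · simp [uniteProg, mergeProg, Prog.LoopFree]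
  · simp [uniteProg, mergeProg, Prog.maxCost, NExp.cost, BExp.cost]
  have hx : s.nat (o + 15) 0 < N := by rw [h15]; exact hpart.merge.rep_lt le_rfl hU
  have hy : s.nat (o + 16) 0 < N := by rw [h16]; exact hpart.merge.rep_lt le_rfl hV
  have hx' : rep (s.nat (o + 7)) (s.nat (o + 8)) (s.nat (o + 5) 0) (s.nat (o + 15) 0) =
      s.nat (o + 15) 0 := by rw [h15]; exact hpart.merge.rep_rep_self le_rfl _
  have hy' : rep (s.nat (o + 7)) (s.nat (o + 8)) (s.nat (o + 5) 0) (s.nat (o + 16) 0) =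
      s.nat (o + 16) 0 := by rw [h16]; exact hpart.merge.rep_rep_self le_rfl _
  have hroot : ∀ v, rep (s.nat (o + 7)) (s.nat (o + 8)) (s.nat (o + 5) 0) v = v →
      s.nat (o + 9) v = 0 := by
    intro v hv
    rcases hlink.eq_zero_or v with h | ⟨j, hj, -, rfl⟩
    · exact h
    · exact absurd hv (hpart.merge.rep_ne_a hj le_rfl _)
  simp only [uniteProg]
  rw [Prog.exec_seq]
  by_cases hxy : s.nat (o + 15) 0 = s.nat (o + 16) 0
  · rw [Prog.exec_ite_pos (by simp [BExp.eval, NExp.eval, hxy])]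
    simp only [Prog.exec, NExp.eval]
    have hp := hpart.reject he heg hmin (by rw [← h15, ← h16, hxy])
    constructor <;> simp [State.setNat_nat, State.setNat_real, *]
    exact hhalf
  · rw [Prog.exec_ite_neg (by simpa [BExp.eval, NExp.eval, ← le_antisymm_iff] using hxy)]
    by_cases hle : s.nat (o + 10) (s.nat (o + 15) 0) ≤ s.nat (o + 10) (s.nat (o + 16) 0)
    · rw [Prog.exec_ite_pos (by simpa [BExp.eval, NExp.eval] using hle), mergeProg_exec _ _ _ _ (by omega) (by omega)]
      simp only [Prog.exec, NExp.eval]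
      have hp := hpart.accept he heg hmin hxy hx hy (Or.inl ⟨h15.symm, h16.symm⟩)
      have hl := hlink.snoc (hroot _ hx')
      have hs := hsized.snoc hpart.merge hxy hx' hy' hx hy hle
      constructor <;> simp [State.setNat_nat, State.setNat_real, hM, hi, hUe, hVe, hWe, heg, h17]
      exacts [htour, hhalf, hp, hl, hs]
    · rw [Prog.exec_ite_neg (by simpa [BExp.eval, NExp.eval] using hle), mergeProg_exec _ _ _ _ (by omega) (by omega)]
      simp only [Prog.exec, NExp.eval]
      have hp := hpart.accept he heg hmin (Ne.symm hxy) hy hx (Or.inr ⟨h15.symm, h16.symm⟩)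
      have hl := hlink.snoc (hroot _ hy')
      have hs := hsized.snoc hpart.merge (Ne.symm hxy) hy' hx' hy hx (by omega)
      constructor <;> simp [State.setNat_nat, State.setNat_real, hM, hi, hUe, hVe, hWe, heg, h17]
      exacts [htour, hhalf, hp, hl, hs]

theorem kruskalStep_halts {o N M l : ℕ} {U V : ℕ → ℕ} {W : ℕ → ℝ} {gone : Finset ℕ} {s : State}
    (hMl : 2 * M ≤ 2 ^ l) (hN : N ≤ 2 ^ l) (hU : ∀ i < M, U i < N) (hV : ∀ i < M, V i < N)
    (h : KruskalInv o N M U V W gone s) (hgone : gone.card < M) :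
    Halts (kruskalStep o) s ((l + 1) * 2000) (fun s' => ∃ gone' : Finset ℕ,
      gone'.card = gone.card + 1 ∧ KruskalInv o N M U V W gone' s') := by
  have hc : (l + 1) * 800 + (100 + ((l + 1) * 100 + (100 + ((l + 1) * 100 + 300)))) ≤
      (l + 1) * 2000 := by omega
  refine Halts.mono ?_ hc fun _ h => h
  refine (extractProg_halts h.W_eq h.M_eq hMl h.half h.tour hgone).frame.seq ?_
  rintro s1 ⟨⟨e, he, heg, hmin, h17, htour⟩, hf, hr⟩
  have hw : ∀ d, d ≠ 17 → d ≠ 14 → d ≠ 11 → s1.nat (o + d) = s.nat (o + d) := by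
    intro d h1 h2 h3
    apply hf
    simp [extractProg, repairProg, competeProg, Prog.writesNat, h1, h2, h3]
  have hWr : s1.real (o + 1) = W := by
    rw [hr (o + 1) (by simp [extractProg, repairProg, competeProg, Prog.writesReal]), h.W_eq]
  refine (Halts.setNat (by simp [NExp.cost])).seq ?_
  rintro s2 rfl
  have hUe : s1.nat (o + 1) e = U e := by rw [hw 1 (by simp) (by simp) (by simp), h.U_eq]
  have hVe : s1.nat (o + 2) e = V e := by rw [hw 2 (by simp) (by simp) (by simp), h.V_eq]
  have e4 := hw 4 (by simp) (by simp) (by simp)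
  have e5 := hw 5 (by simp) (by simp) (by simp)
  have e6 := hw 6 (by simp) (by simp) (by simp)
  have e7 := hw 7 (by simp) (by simp) (by simp)
  have e8 := hw 8 (by simp) (by simp) (by simp)
  have e9 := hw 9 (by simp) (by simp) (by simp)
  have e10 := hw 10 (by simp) (by simp) (by simp)
  have e12 := hw 12 (by simp) (by simp) (by simp)
  have e13 := hw 13 (by simp) (by simp) (by simp)
  refine (climbProg_halts (N := N) (l := l) (f := s.nat (o + 5) 0) (by omega) (by omega)
    ?_ ?_ ?_ hN ?_).seq ?_
  · simpa [State.setNat_nat, e7, e8] using h.part.merge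
  · simpa [State.setNat_nat, e7, e9] using h.link
  · simpa [State.setNat_nat, e7, e8, e10] using h.sized
  · simpa [State.setNat_nat, NExp.eval, h17, hUe] using hU e he
  rintro s3 rfl
  refine (Halts.setNat (by simp [NExp.cost])).seq ?_
  rintro s4 rfl
  refine (climbProg_halts (N := N) (l := l) (f := s.nat (o + 5) 0) (by omega) (by omega)
    ?_ ?_ ?_ hN ?_).seq ?_
  · simpa [State.setNat_nat, e7, e8] using h.part.merge
  · simpa [State.setNat_nat, e7, e9] using h.link
  · simpa [State.setNat_nat, e7, e8, e10] using h.sized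
  · simpa [State.setNat_nat, NExp.eval, h17, hVe] using hV e he
  rintro s5 rfl
  refine (uniteProg_halts (N := N) (M := M) (U := U) (V := V) (W := W) (gone := gone) he heg hmin
    (hU e he) (hV e he) ?_ ?_ ?_ ?_ ?_ ?_ ?_ ?_ ?_ ?_ ?_ ?_ ?_).mono le_rfl
    fun s' h' => ⟨_, Finset.card_insert_of_notMem heg, h'⟩
  · simpa [State.setNat_nat, e4] using h.M_eq
  · simpa [State.setNat_nat, e13] using h.card_eq
  · simpa [State.setNat_nat, hw 1] using h.U_eq
  · simpa [State.setNat_nat, hw 2] using h.V_eq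
  · simpa [State.setNat_real] using hWr
  · simpa [State.setNat_nat] using htour
  · simpa [State.setNat_nat, e12] using h.half
  · simpa [State.setNat_nat, e5, e6, e7, e8] using h.part
  · simpa [State.setNat_nat, e5, e7, e9] using h.link
  · simpa [State.setNat_nat, e5, e7, e8, e10] using h.sized
  · simpa [State.setNat_nat] using h17
  · simp [State.setNat_nat, NExp.eval, e5, e7, e8, h17, hUe]
  · simp [State.setNat_nat, NExp.eval, e5, e7, e8, h17, hVe]

/-- What Kruskal's algorithm leaves in the memory. -/
structure KruskalDone (o N M : ℕ) (U V : ℕ → ℕ) (W : ℕ → ℝ) (s : State) : Prop where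
  kruskal : IsKruskal N M U V W (s.nat (o + 5) 0) (s.nat (o + 6)) (s.nat (o + 7)) (s.nat (o + 8))
  link : IsLink (s.nat (o + 5) 0) (s.nat (o + 7)) (s.nat (o + 9))
  sized : IsSized N (s.nat (o + 5) 0) (s.nat (o + 7)) (s.nat (o + 8)) (s.nat (o + 10))

theorem kruskalProg_halts {o N M l : ℕ} {s : State} (hMl : 2 * M ≤ 2 ^ l)
    (hN : 0 < M → N ≤ 2 ^ l) (hM : s.nat (o + 4) 0 = M) (hU : ∀ i < M, s.nat (o + 1) i < N)
    (hV : ∀ i < M, s.nat (o + 2) i < N) (h5 : s.nat (o + 5) 0 = 0)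
    (h9 : s.nat (o + 9) = fun _ => 0) (h10 : s.nat (o + 10) = fun _ => 0) :
    Halts (kruskalProg o) s ((M + 1) * ((l + 1) * 4000))
      (KruskalDone o N M (s.nat (o + 1)) (s.nat (o + 2)) (s.real (o + 1))) := by
  have hc : (M + 1) * 1000 + (M + 1) * ((l + 1) * 3000) ≤ (M + 1) * ((l + 1) * 4000) := by
    rw [← Nat.mul_add]; exact Nat.mul_le_mul_left _ (by omega)
  refine Halts.mono ?_ hc fun _ h => h
  refine (buildProg_halts hM).frame.seq ?_
  rintro s1 ⟨⟨h1, h2, h3⟩, hf, hr⟩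
  have hw : ∀ d, d ≠ 11 → d ≠ 12 → d ≠ 13 → d ≠ 14 → s1.nat (o + d) = s.nat (o + d) := by
    intro d k1 k2 k3 k4
    apply hf
    simp [buildProg, leavesProg, nodesProg, competeProg, Prog.writesNat, k1, k2, k3, k4]
  have hWr : s1.real (o + 1) = s.real (o + 1) :=
    hr (o + 1) (by simp [buildProg, leavesProg, nodesProg, competeProg, Prog.writesReal])
  refine (Halts.for (B := M) (c := (l + 1) * 2000) (I := fun t s' => ∃ gone : Finset ℕ,
    gone.card = t ∧
    KruskalInv o N M (s.nat (o + 1)) (s.nat (o + 2)) (s.real (o + 1)) gone s') ?_ ?_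
    ⟨∅, rfl, ?_⟩ ?_).mono le_rfl ?_
  · rintro t s' ht ⟨gone, rfl, h⟩
    simp [BExp.eval, NExp.eval, h.M_eq, h.card_eq]
  · rintro t s' ht ⟨gone, rfl, h⟩
    exact kruskalStep_halts hMl (hN (by omega)) hU hV h ht
  · have e5 : s1.nat (o + 5) 0 = 0 := by rw [hw 5 (by simp) (by simp) (by simp) (by simp), h5]
    have e9 := (hw 9 (by simp) (by simp) (by simp) (by simp)).trans h9
    have e10 := (hw 10 (by simp) (by simp) (by simp) (by simp)).trans h10
    refine ⟨?_, by simpa using h3, ?_, ?_, hWr, h1, h2, ?_, ?_, ?_⟩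
    · rw [hw 4 (by simp) (by simp) (by simp) (by simp), hM]
    · exact hw 1 (by simp) (by simp) (by simp) (by simp)
    · exact hw 2 (by simp) (by simp) (by simp) (by simp)
    · rw [e5]
      refine ⟨⟨?_, ?_, ?_, ?_, ?_⟩, ?_, ?_, ?_, ?_, ?_, ?_, ?_⟩ <;> simp
    · rw [e5, e9]
      constructor <;> simp
    · rw [e5, e10]
      constructor
      · simp
      · intro v hv; exact Nat.zero_lt_of_lt hv
      · intro v hv _
        refine Finset.card_eq_one.2 ⟨v, ?_⟩
        ext w
        rw [Finset.mem_filter, Finset.mem_range, Finset.mem_singleton]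
        exact ⟨fun h => h.2, fun h => ⟨h ▸ hv, h⟩⟩
  · simp [BExp.cost, NExp.cost]; omega
  · rintro s' ⟨gone, hcard, h⟩
    exact ⟨h.part.isKruskal hcard, h.link, h.sized⟩

/-! ## The weights of the cuts -/

/-- The weight of the edges that leave the class of `r` after `j` mergers. -/
def cutWeight (m : ℕ) (u v : ℕ → ℕ) (c : ℕ → ℝ) (a b : ℕ → ℕ) (j r : ℕ) : ℝ :=
  ∑ i ∈ Finset.range m, if (rep a b j (u i) = r ↔ rep a b j (v i) = r) then 0 else c i

/-- The weight of the edges whose ends are joined by the `j`-th merger. -/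
def joinWeight (m : ℕ) (u v : ℕ → ℕ) (c : ℕ → ℝ) (a b : ℕ → ℕ) (j : ℕ) : ℝ :=
  ∑ i ∈ Finset.range m, if rep a b j (u i) ≠ rep a b j (v i) ∧
    rep a b (j + 1) (u i) = rep a b (j + 1) (v i) then c i else 0

/-- The edges between the two merged classes leave both of them but not their union, so they are
subtracted twice. -/
theorem cutWeight_succ_b {m N f : ℕ} {u v : ℕ → ℕ} {c : ℕ → ℝ} {a b : ℕ → ℕ}
    (h : IsMergeSeq N f a b) {j : ℕ} (hj : j < f) :
    cutWeight m u v c a b (j + 1) (b j) = cutWeight m u v c a b j (a j) +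
      cutWeight m u v c a b j (b j) -
        (joinWeight m u v c a b j + joinWeight m u v c a b j) := by
  have hne := h.ne j hj
  simp only [cutWeight, joinWeight, ← Finset.sum_add_distrib, ← Finset.sum_sub_distrib]
  refine Finset.sum_congr rfl fun i _ => ?_
  simp only [rep]
  by_cases h1 : rep a b j (u i) = a j <;> by_cases h2 : rep a b j (v i) = a j <;>
    by_cases h3 : rep a b j (u i) = b j <;> by_cases h4 : rep a b j (v i) = b j <;>
    simp_all [eq_comm]

theorem cutWeight_succ_of_ne {m : ℕ} {u v : ℕ → ℕ} {c : ℕ → ℝ} {a b : ℕ → ℕ} {j r : ℕ}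
    (hra : r ≠ a j) (hrb : r ≠ b j) :
    cutWeight m u v c a b (j + 1) r = cutWeight m u v c a b j r := by
  have key : ∀ w, rep a b (j + 1) w = r ↔ rep a b j w = r := by
    intro w
    simp only [rep]
    split_ifs with h1
    · rw [h1]; exact ⟨fun h => absurd h.symm hrb, fun h => absurd h.symm hra⟩
    · rfl
  simp only [cutWeight, key]

/-! ## The mergers that join the ends of the edges -/

/-- Climbs from the variables `41` and `42` to the merger that joins them, which is left in the
variable `43`. -/
def meetProg : Prog :=
  let x := NExp.var 41
  let y := NExp.var 42
  let lx := NExp.get 9 x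
  let ly := NExp.get 9 y
  .loop (.not (.and (.natLe x y) (.natLe y x)))
    (.ite (.and (.natLe (.lit 1) lx) (.not (.and (.natLe (.lit 1) ly) (.natLe ly lx))))
      ((Prog.setVar 43 (lx.sub (.lit 1))).seq (.setVar 41 (.get 8 (.var 43))))
      ((Prog.setVar 43 (ly.sub (.lit 1))).seq (.setVar 42 (.get 8 (.var 43)))))

/-- The vertex with the earlier link is moved. The other one keeps its role through that merger, so
the two positions are again the representatives of `u` and `v` at one common time, now `j + 1`. -/
theorem meet_step {N f : ℕ} {a b link : ℕ → ℕ} (hm : IsMergeSeq N f a b) (hl : IsLink f a link)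
    {u v x y T : ℕ} (hT : T ≤ f) (hx : x = rep a b T u) (hy : y = rep a b T v) (hxy : x ≠ y)
    {j : ℕ} (hj : j < f) (hxj : a j = x) (hyj : link y = 0 ∨ j + 1 < link y) :
    b j = rep a b (j + 1) u ∧ y = rep a b (j + 1) v ∧ rep a b j u ≠ rep a b j v := by
  have hTj : T ≤ j := by
    by_contra h
    exact hm.rep_ne_a (Nat.lt_of_not_le h) hT u (by rw [hxj, hx])
  have h1 : rep a b j u = x := by
    rw [← hm.rep_rep hTj hj.le, ← hx, ← hxj, hm.rep_a j hj]
  have h2 : rep a b j v = y := by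
    rw [← hm.rep_rep hTj hj.le, ← hy, hl.rep_eq_self hj.le (by omega)]
  refine ⟨by simp [rep, h1, hxj], ?_, by rwa [h1, h2]⟩
  simp only [rep, h2]
  rw [if_neg (by rw [hxj]; exact hxy.symm)]

/-- The positions are always the representatives of `u` and `v` at a common time `T`, and they
differed just before the merger recorded last; when they agree, that merger is the one sought. Each
round at least doubles the product of the two class sizes, hence the factor `2 * l`. -/
theorem meetProg_halts {s : State} {N f l u v : ℕ} {a b : ℕ → ℕ}
    (hb : s.nat 8 = b) (hm : IsMergeSeq N f a b) (hl : IsLink f a (s.nat 9))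
    (hs : IsSized N f a b (s.nat 10)) (hN : N ≤ 2 ^ l) (hu : u < N) (hv : v < N) (huv : u ≠ v)
    (hrep : rep a b f u = rep a b f v) (h41 : s.nat 41 0 = u) (h42 : s.nat 42 0 = v) :
    Halts meetProg s ((2 * l + 1) * 200) (fun s' => s'.nat 43 0 < f ∧
      rep a b (s'.nat 43 0) u ≠ rep a b (s'.nat 43 0) v ∧
      rep a b (s'.nat 43 0 + 1) u = rep a b (s'.nat 43 0 + 1) v) := by
  refine (Halts.loop (I := fun t s' => s'.nat 8 = b ∧ s'.nat 9 = s.nat 9 ∧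
    2 ^ t ≤ (s.nat 10 (s'.nat 41 0) + 1) * (s.nat 10 (s'.nat 42 0) + 1) ∧
    ∃ T ≤ f, s'.nat 41 0 = rep a b T u ∧ s'.nat 42 0 = rep a b T v ∧
      (T = 0 ∨ (s'.nat 43 0 + 1 = T ∧
        rep a b (s'.nat 43 0) u ≠ rep a b (s'.nat 43 0) v))) (B := 2 * l) (c := 100) ?_ ?_
      ⟨hb, rfl, ?_, 0, Nat.zero_le _, h41, h42, Or.inl rfl⟩ ?_).mono le_rfl ?_
  · rintro t s' ⟨-, -, hp, T, hT, hx, hy, -⟩ hb'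
    have hne : s'.nat 41 0 ≠ s'.nat 42 0 := by
      intro h; simp [BExp.eval, NExp.eval, h] at hb'
    have hxN : s'.nat 41 0 < N := by rw [hx]; exact hm.rep_lt hT hu
    have hyN : s'.nat 42 0 < N := by rw [hy]; exact hm.rep_lt hT hv
    have hx1 : s.nat 10 (s'.nat 41 0) + 1 ≤ 2 ^ l := (hs.lt _ hxN).trans_le hN
    have hy1 : s.nat 10 (s'.nat 42 0) + 1 ≤ 2 ^ l := (hs.lt _ hyN).trans_le hN
    have hlt : (s.nat 10 (s'.nat 41 0) + 1) * (s.nat 10 (s'.nat 42 0) + 1) < 2 ^ l * 2 ^ l := by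
      -- Two different positions cannot both be final representatives, because `u` and `v` end in
      -- one class. One of them has an outgoing link, and the doubling along it makes its size
      -- strictly smaller than the maximum.
      have hone : s.nat 10 (s'.nat 41 0) + 1 < 2 ^ l ∨ s.nat 10 (s'.nat 42 0) + 1 < 2 ^ l := by
        rcases hl.eq_zero_or (s'.nat 41 0) with h0 | ⟨j, hj, -, he⟩
        · rcases hl.eq_zero_or (s'.nat 42 0) with h0' | ⟨j, hj, -, he⟩
          · exfalso
            have e1 := hl.rep_eq_self (b := b) le_rfl (Or.inl h0)
            have e2 := hl.rep_eq_self (b := b) le_rfl (Or.inl h0')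
            rw [hx, hm.rep_rep hT le_rfl] at e1
            rw [hy, hm.rep_rep hT le_rfl] at e2
            rw [hx, hy, ← e1, ← e2] at hne
            exact hne hrep
          · right
            have h1 := hs.double j hj
            have h2 := hs.lt _ (hm.b_lt j hj)
            rw [he] at h1; omega
        · left
          have h1 := hs.double j hj
          have h2 := hs.lt _ (hm.b_lt j hj)
          rw [he] at h1; omega
      rcases hone with h | h
      · exact Nat.mul_lt_mul_of_lt_of_le h hy1 (by omega)
      · exact Nat.mul_lt_mul_of_le_of_lt hx1 h (by omega)
    rw [← pow_add, ← two_mul] at hlt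
    exact (Nat.pow_lt_pow_iff_right (by norm_num)).1 (hp.trans_lt hlt)
  · rintro t s' ⟨h8, h9, hp, T, hT, hx, hy, -⟩ hb'
    have hne : s'.nat 41 0 ≠ s'.nat 42 0 := by
      intro h; simp [BExp.eval, NExp.eval, h] at hb'
    refine Prog.LoopFree.halts (by simp [Prog.LoopFree])
      (by simp [Prog.maxCost, NExp.cost, BExp.cost]) ?_
    have hxr := hl.eq_zero_or (s'.nat 41 0)
    have hyr := hl.eq_zero_or (s'.nat 42 0)
    by_cases hmove : 1 ≤ s.nat 9 (s'.nat 41 0) ∧ ¬ (1 ≤ s.nat 9 (s'.nat 42 0) ∧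
        s.nat 9 (s'.nat 42 0) ≤ s.nat 9 (s'.nat 41 0))
    · rw [Prog.exec_ite_pos (by simpa only [BExp.eval, NExp.eval, h9] using hmove)]
      rcases hxr with h0 | ⟨j, hj, hlj, haj⟩
      · omega
      obtain ⟨e1, e2, e3⟩ := meet_step hm hl hT hx hy hne hj haj (by omega)
      have hd := hs.double j hj
      rw [haj] at hd
      simp only [Prog.exec, NExp.eval, State.setNat_nat]
      simp [h8, h9, hlj]
      refine ⟨?_, j + 1, hj, e1, e2, Or.inr ⟨rfl, e3⟩⟩
      rw [pow_succ]; nlinarith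
    · rw [Prog.exec_ite_neg (by simpa only [BExp.eval, NExp.eval, h9] using hmove)]
      rcases hyr with h0 | ⟨j, hj, hlj, haj⟩
      · exfalso
        have hx0 : s.nat 9 (s'.nat 41 0) = 0 := by omega
        have e1 := hl.rep_eq_self (b := b) le_rfl (Or.inl hx0)
        have e2 := hl.rep_eq_self (b := b) le_rfl (Or.inl h0)
        rw [hx, hm.rep_rep hT le_rfl] at e1
        rw [hy, hm.rep_rep hT le_rfl] at e2
        rw [hx, hy, ← e1, ← e2] at hne
        exact hne hrep
      -- The links of different vertices carry different time stamps, so the comparison is strict.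
      have hlt : s.nat 9 (s'.nat 41 0) = 0 ∨ j + 1 < s.nat 9 (s'.nat 41 0) := by
        rcases hxr with h0 | ⟨i, hi, hli, hai⟩
        · exact Or.inl h0
        · right
          have hij : i ≠ j := by
            rintro rfl; exact hne (hai.symm.trans haj)
          omega
      obtain ⟨e1, e2, e3⟩ := meet_step hm hl hT hy hx hne.symm hj haj hlt
      have hd := hs.double j hj
      rw [haj] at hd
      simp only [Prog.exec, NExp.eval, State.setNat_nat]
      simp [h8, h9, hlj]
      refine ⟨?_, j + 1, hj, e2, e1, Or.inr ⟨rfl, e3.symm⟩⟩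
      rw [pow_succ]; nlinarith
  · rw [pow_zero]; exact Nat.mul_pos (by omega) (by omega)
  · simp [BExp.cost, NExp.cost]
  · rintro s' ⟨hb', t, -, -, -, T, hT, hx, hy, h⟩
    have heq : s'.nat 41 0 = s'.nat 42 0 := by
      simp [BExp.eval, NExp.eval] at hb'; omega
    rcases h with rfl | ⟨rfl, h⟩
    · exact absurd (by simpa [rep] using hx.symm.trans (heq.trans hy)) huv
    · exact ⟨by omega, h, by rw [← hx, ← hy, heq]⟩

/-- Adds up the capacities of the edges at every vertex, and of those joined by every merger. -/
def joinProg : Prog :=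
  let i := NExp.var 40
  let c := RExp.get 0 i
  .loop (.not (.natLe (.var 4) i))
    ((Prog.setVar 41 (.get 1 i)).seq ((Prog.setVar 42 (.get 2 i)).seq (meetProg.seq
      ((Prog.setReal 3 (.var 43) ((RExp.get 3 (.var 43)).add c)).seq
        ((Prog.setReal 2 (.get 1 i) ((RExp.get 2 (.get 1 i)).add c)).seq
          ((Prog.setReal 2 (.get 2 i) ((RExp.get 2 (.get 2 i)).add c)).seq
            (.setVar 40 (i.add (.lit 1)))))))))

theorem merger_unique {N f : ℕ} {a b : ℕ → ℕ} (hm : IsMergeSeq N f a b) {u v i j : ℕ}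
    (hi : i < f) (hj : j < f) (h1 : rep a b i u ≠ rep a b i v)
    (h2 : rep a b (i + 1) u = rep a b (i + 1) v) (h3 : rep a b j u ≠ rep a b j v)
    (h4 : rep a b (j + 1) u = rep a b (j + 1) v) : i = j := by
  rcases lt_trichotomy i j with h | h | h
  · exact absurd (hm.rep_eq_of_le (Nat.succ_le_of_lt h) hj.le h2) h3
  · exact h
  · exact absurd (hm.rep_eq_of_le (Nat.succ_le_of_lt h) hi.le h4) h1

theorem joinProg_halts {s : State} {N M f l : ℕ} {a b u v : ℕ → ℕ} {c : ℕ → ℝ}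
    (hu : s.nat 1 = u) (hv : s.nat 2 = v) (hM : s.nat 4 0 = M) (hb : s.nat 8 = b)
    (hc : s.real 0 = c) (h40 : s.nat 40 0 = 0) (h2 : s.real 2 = fun _ => 0)
    (h3 : s.real 3 = fun _ => 0) (hm : IsMergeSeq N f a b) (hl : IsLink f a (s.nat 9))
    (hs : IsSized N f a b (s.nat 10)) (hN : 0 < M → N ≤ 2 ^ l) (huN : ∀ i < M, u i < N)
    (hvN : ∀ i < M, v i < N) (huv : ∀ i < M, u i ≠ v i)
    (hrep : ∀ i < M, rep a b f (u i) = rep a b f (v i)) :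
    Halts joinProg s ((M + 1) * ((l + 1) * 1000)) (fun s' =>
      (∀ j < f, s'.real 3 j = joinWeight M u v c a b j) ∧
      ∀ r, s'.real 2 r = cutWeight M u v c a b 0 r) := by
  refine (Halts.for (B := M) (I := fun t s' => s'.nat 1 = u ∧ s'.nat 2 = v ∧ s'.nat 4 0 = M ∧
    s'.nat 8 = b ∧ s'.nat 9 = s.nat 9 ∧ s'.nat 10 = s.nat 10 ∧ s'.real 0 = c ∧ s'.nat 40 0 = t ∧
    (∀ j < f, s'.real 3 j = joinWeight t u v c a b j) ∧
    ∀ r, s'.real 2 r = cutWeight t u v c a b 0 r) (c := 50 + (50 + ((2 * l + 1) * 200 + 200)))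
    ?_ ?_ ⟨hu, hv, hM, hb, rfl, rfl, hc, h40, ?_, ?_⟩ ?_).mono le_rfl ?_
  · rintro t s' ht ⟨-, -, h4, -, -, -, -, h40, -⟩
    simp [BExp.eval, NExp.eval, h4, h40]
  · rintro t s' ht ⟨e1, e2, e4, e8, e9, e10, e0, e40, eJ, eD⟩
    refine (Halts.setNat (by simp [NExp.cost])).seq ?_
    rintro s1 rfl
    refine (Halts.setNat (by simp [NExp.cost])).seq ?_
    rintro s2 rfl
    refine (meetProg_halts (a := a) (b := b) (N := N) (f := f) (l := l) (u := u t) (v := v t)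
      ?_ hm ?_ ?_ (hN (by omega)) (huN t ht) (hvN t ht) (huv t ht) (hrep t ht) ?_ ?_).frame.seq ?_
    · simpa [State.setNat_nat] using e8
    · simpa [State.setNat_nat, e9] using hl
    · simpa [State.setNat_nat, e10] using hs
    · simp [State.setNat_nat, NExp.eval, e1, e40]
    · simp [State.setNat_nat, NExp.eval, e2, e40]
    rintro s3 ⟨⟨hj, hj1, hj2⟩, hf, hr⟩
    have w : ∀ d, d ≠ 41 → d ≠ 42 → d ≠ 43 → s3.nat d = s'.nat d := by
      intro d h1 h2 h3
      rw [hf d (by simp [meetProg, Prog.writesNat, h1, h2, h3])]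
      simp [State.setNat_nat, h1, h2]
    have wr : s3.real = s'.real := by
      funext d
      rw [hr d (by simp [meetProg, Prog.writesReal])]
      simp [State.setNat_real]
    generalize hj' : s3.nat 43 0 = j at hj hj1 hj2
    refine Prog.LoopFree.halts (by simp [Prog.LoopFree])
      (by simp [Prog.maxCost, NExp.cost, RExp.cost]) ?_
    have i1 := (w 1 (by simp) (by simp) (by simp)).trans e1
    have i2 := (w 2 (by simp) (by simp) (by simp)).trans e2
    have i40 : s3.nat 40 0 = t := by rw [w 40 (by simp) (by simp) (by simp), e40]
    simp only [Prog.exec, NExp.eval, RExp.eval, State.setNat_nat, State.setNat_real,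
      State.setReal_real, State.setReal_nat]
    simp only [i1, i2, i40, hj', wr, e0, Nat.reduceEqDiff, if_false, if_true,
      Function.update_self, OfNat.one_ne_ofNat, OfNat.zero_ne_ofNat]
    refine ⟨trivial, trivial, ?_, ?_, ?_, ?_, trivial, trivial, ?_, ?_⟩
    · rw [w 4 (by simp) (by simp) (by simp), e4]
    · rw [w 8 (by simp) (by simp) (by simp), e8]
    · rw [w 9 (by simp) (by simp) (by simp), e9]
    · rw [w 10 (by simp) (by simp) (by simp), e10]
    · intro i hi
      rw [joinWeight, Finset.sum_range_succ, ← joinWeight, ← eJ i hi]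
      by_cases hij : i = j
      · subst hij; rw [Function.update_self, if_pos ⟨hj1, hj2⟩]
      · rw [Function.update_of_ne hij, if_neg, add_zero]
        exact fun h => hij (merger_unique hm hi hj h.1 h.2 hj1 hj2)
    · intro r
      have hne := huv t ht
      rw [cutWeight, Finset.sum_range_succ, ← cutWeight, ← eD r]
      simp only [rep]
      by_cases h1 : r = u t
      · subst h1; simp [hne, Ne.symm hne]
      · by_cases h2 : r = v t
        · subst h2; simp [hne, Ne.symm hne]
        · simp [h1, h2, Ne.symm h1, Ne.symm h2]
  · intro j hj; simp [h3, joinWeight]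
  · intro r; simp [h2, cutWeight]
  · simp [BExp.cost, NExp.cost]; omega
  · rintro s' ⟨-, -, -, -, -, -, -, -, h⟩
    exact h

/-! ## The candidate cuts

The `e`-th of the `2 * f` candidate cuts is one of the two classes joined by merger `e / 2`. -/

/-- The representative of the `e`-th candidate class. -/
def side (a b : ℕ → ℕ) (e : ℕ) : ℕ := if e % 2 = 0 then a (e / 2) else b (e / 2)

theorem side_even (a b : ℕ → ℕ) (j : ℕ) : side a b (j + j) = a j := by
  have h1 : (j + j) % 2 = 0 := by omega
  have h2 : (j + j) / 2 = j := by omega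
  simp [side, h1, h2]

theorem side_odd (a b : ℕ → ℕ) (j : ℕ) : side a b (j + j + 1) = b j := by
  have h1 : (j + j + 1) % 2 = 1 := by omega
  have h2 : (j + j + 1) / 2 = j := by omega
  simp [side, h1, h2]

/-- Computes the weights of the candidate cuts. -/
def weighProg : Prog :=
  let i := NExp.var 40
  let da := RExp.get 2 (.get 7 i)
  let db := RExp.get 2 (.get 8 i)
  .loop (.not (.natLe (.var 5) i))
    ((Prog.setReal 21 (i.add i) da).seq ((Prog.setReal 21 ((i.add i).add (.lit 1)) db).seq
      ((Prog.setReal 2 (.get 8 i) ((da.add db).sub ((RExp.get 3 i).add (.get 3 i)))).seq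
        (.setVar 40 (i.add (.lit 1))))))

/-- Real array `2` is kept correct only at current representatives. This suffices, since both
classes of a merger are represented at that time and the entry of `a t` is never needed later. -/
theorem weighProg_halts {s : State} {N M f : ℕ} {a b u v : ℕ → ℕ} {c : ℕ → ℝ}
    (hf : s.nat 5 0 = f) (ha : s.nat 7 = a) (hb : s.nat 8 = b) (h40 : s.nat 40 0 = 0)
    (hm : IsMergeSeq N f a b) (h3 : ∀ j < f, s.real 3 j = joinWeight M u v c a b j)
    (h2 : ∀ r, s.real 2 r = cutWeight M u v c a b 0 r) :
    Halts weighProg s ((f + 1) * 100) (fun s' =>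
      ∀ e < 2 * f, s'.real 21 e = cutWeight M u v c a b (e / 2) (side a b e)) := by
  refine (Halts.for (B := f) (I := fun t s' => s'.nat 5 0 = f ∧ s'.nat 7 = a ∧ s'.nat 8 = b ∧
    s'.nat 40 0 = t ∧ s'.real 3 = s.real 3 ∧
    (∀ r, rep a b t r = r → s'.real 2 r = cutWeight M u v c a b t r) ∧
    ∀ e < 2 * t, s'.real 21 e = cutWeight M u v c a b (e / 2) (side a b e)) (c := 70)
    ?_ ?_ ⟨hf, ha, hb, h40, rfl, fun r _ => h2 r, by simp⟩ ?_).mono le_rfl ?_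
  · rintro t s' ht ⟨e5, -, -, e40, -⟩
    simp [BExp.eval, NExp.eval, e5, e40]
  · rintro t s' ht ⟨e5, e7, e8, e40, e3, eD, eW⟩
    refine Prog.LoopFree.halts (by simp [Prog.LoopFree])
      (by simp [Prog.maxCost, NExp.cost, RExp.cost]) ?_
    have hDa := eD (a t) (hm.rep_a t ht)
    have hDb := eD (b t) (hm.rep_b t ht)
    simp only [Prog.exec, NExp.eval, RExp.eval, State.setNat_nat, State.setNat_real,
      State.setReal_real, State.setReal_nat]
    simp only [e5, e7, e8, e40, e3, Nat.reduceEqDiff, if_false, if_true,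
      Function.update_self]
    refine ⟨trivial, trivial, trivial, trivial, trivial, ?_, ?_⟩
    · intro r hr
      by_cases hrb : r = b t
      · subst hrb
        rw [Function.update_self, cutWeight_succ_b hm ht, hDa, hDb, h3 t ht]
      · have hra : r ≠ a t := by
          rintro rfl; exact hm.rep_ne_a (Nat.lt_succ_self t) ht _ hr
        rw [Function.update_of_ne hrb, cutWeight_succ_of_ne hra hrb]
        exact eD r (hm.rep_eq_self_of_le (Nat.le_succ t) ht hr)
    · intro e he
      by_cases h1 : e = t + t + 1
      · subst h1
        have : (t + t + 1) / 2 = t := by omega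
        rw [Function.update_self, side_odd, this, hDb]
      · by_cases h2 : e = t + t
        · subst h2
          have : (t + t) / 2 = t := by omega
          rw [Function.update_of_ne h1, Function.update_self, side_even, this, hDa]
        · rw [Function.update_of_ne h1, Function.update_of_ne h2]
          exact eW e (by omega)
  · simp [BExp.cost, NExp.cost]
  · rintro s' ⟨-, -, -, -, -, -, h⟩
    exact h

/-! ### Candidate classes as intervals -/

/-- The indicator of the class of `r` after `j` mergers. -/
def classVec (n : ℕ) (a b : ℕ → ℕ) (j r : ℕ) : Fin n → ℝ :=
  fun v => if rep a b j v = r then 1 else 0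

/-- The span of the indicators of the classes after all mergers. -/
def rootSpan (n f : ℕ) (a b : ℕ → ℕ) : Submodule ℝ (Fin n → ℝ) :=
  Submodule.span ℝ ((classVec n a b f) '' (reps n a b f))

theorem classVec_succ_b {n f : ℕ} {a b : ℕ → ℕ} (h : IsMergeSeq n f a b) {j : ℕ} (hj : j < f) :
    classVec n a b (j + 1) (b j) = classVec n a b j (a j) + classVec n a b j (b j) := by
  have hne := h.ne j hj
  funext v
  simp only [classVec, rep, Pi.add_apply]
  by_cases h1 : rep a b j v = a j
  · simp [h1, hne]
  · simp [h1]

theorem classVec_succ_of_ne {n : ℕ} {a b : ℕ → ℕ} {j r : ℕ} (hra : r ≠ a j) (hrb : r ≠ b j) :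
    classVec n a b (j + 1) r = classVec n a b j r := by
  funext v
  simp only [classVec, rep]
  by_cases h1 : rep a b j v = a j
  · simp [h1, Ne.symm hra, Ne.symm hrb]
  · simp [h1]

/-- The classes after `j` or more mergers are intervals: up to `rootSpan`, the indicator of a class
is the difference of the potentials `g` at its two ends. -/
structure IsIntervals (n f : ℕ) (a b L R U V : ℕ → ℕ) (g : ℕ → Fin n → ℝ) (j : ℕ) : Prop where
  mem : ∀ r < n, rep a b j r = r → classVec n a b j r - (g (R r) - g (L r)) ∈ rootSpan n f a b
  left : ∀ r, L r = 0 ∨ (j < L r ∧ L r ≤ f)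
  right : ∀ r, R r = 0 ∨ (j < R r ∧ R r ≤ f)
  cand : ∀ e, 2 * j ≤ e → e < 2 * f →
    classVec n a b (e / 2) (side a b e) - (g (V e) - g (U e)) ∈ rootSpan n f a b
  candU : ∀ e, 2 * j ≤ e → e < 2 * f → U e = 0 ∨ (j < U e ∧ U e ≤ f)
  candV : ∀ e, 2 * j ≤ e → e < 2 * f → V e = 0 ∨ (j < V e ∧ V e ≤ f)

/-- Undoing merger `j` cuts the interval of the merged class at the new point `j + 1`: the part of
`b j` lies to its left and the part of `a j` to its right. The potential of this point is chosen so
that the left part is exact; the right part then follows because the indicator of the union is the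
sum of both. -/
theorem IsIntervals.step {n f : ℕ} {a b L R U V : ℕ → ℕ} {g : ℕ → Fin n → ℝ} {j : ℕ}
    (h : IsIntervals n f a b L R U V g (j + 1)) (hm : IsMergeSeq n f a b) (hj : j < f) :
    IsIntervals n f a b (Function.update L (a j) (j + 1))
      (Function.update (Function.update R (a j) (R (b j))) (b j) (j + 1))
      (Function.update (Function.update U (j + j) (j + 1)) (j + j + 1) (L (b j)))
      (Function.update (Function.update V (j + j) (R (b j))) (j + j + 1) (j + 1))
      (Function.update g (j + 1) (g (L (b j)) + classVec n a b j (b j))) j := by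
  have hne := hm.ne j hj
  -- All end points in use are `0` or later than `j + 1`, so defining the potential at `j + 1`
  -- disturbs none of them.
  have hold : ∀ p, p = 0 ∨ (j + 1 < p ∧ p ≤ f) →
      Function.update g (j + 1) (g (L (b j)) + classVec n a b j (b j)) p = g p :=
    fun p hp => Function.update_of_ne (by omega) _ _
  have hA : classVec n a b j (a j) -
      (g (R (b j)) - (g (L (b j)) + classVec n a b j (b j))) ∈ rootSpan n f a b := by
    have := h.mem (b j) (hm.b_lt j hj) (hm.rep_succ_b hj)
    rw [classVec_succ_b hm hj] at this
    convert this using 1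
    abel
  have hB : classVec n a b j (b j) -
      ((g (L (b j)) + classVec n a b j (b j)) - g (L (b j))) ∈ rootSpan n f a b := by
    rw [add_sub_cancel_left, sub_self]
    exact zero_mem _
  have hcand : ∀ e, 2 * j ≤ e → e = j + j ∨ e = j + j + 1 ∨ 2 * (j + 1) ≤ e := by
    intro e he; omega
  have hj0 : (j + j) / 2 = j := by omega
  have hj1 : (j + j + 1) / 2 = j := by omega
  refine ⟨?_, ?_, ?_, ?_, ?_, ?_⟩
  · intro r hr hrep
    by_cases h1 : r = b j
    · subst h1
      rw [Function.update_self, Function.update_of_ne (Ne.symm hne), Function.update_self,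
        hold _ (h.left _)]
      exact hB
    · by_cases h2 : r = a j
      · subst h2
        rw [Function.update_of_ne hne, Function.update_self, Function.update_self,
          Function.update_self, hold _ (h.right _)]
        exact hA
      · rw [Function.update_of_ne h1, Function.update_of_ne h2, Function.update_of_ne h2,
          hold _ (h.right _), hold _ (h.left _), ← classVec_succ_of_ne h2 h1]
        exact h.mem r hr (by simp [rep, hrep, h2])
  · intro r
    have := h.left r
    simp only [Function.update_apply]
    split_ifs <;> omega
  · intro r
    have := h.right r
    have := h.right (b j)
    simp only [Function.update_apply]
    split_ifs <;> omega
  · intro e he hef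
    rcases hcand e he with rfl | rfl | he
    · have e1 : Function.update (Function.update V (j + j) (R (b j))) (j + j + 1) (j + 1) (j + j) =
          R (b j) := by simp
      have e2 : Function.update (Function.update U (j + j) (j + 1)) (j + j + 1) (L (b j)) (j + j) =
          j + 1 := by simp
      rw [hj0, side_even, e1, e2, hold _ (h.right _), Function.update_self]
      exact hA
    · have e1 : Function.update (Function.update V (j + j) (R (b j))) (j + j + 1) (j + 1)
          (j + j + 1) = j + 1 := by simp
      have e2 : Function.update (Function.update U (j + j) (j + 1)) (j + j + 1) (L (b j))
          (j + j + 1) = L (b j) := by simp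
      rw [hj1, side_odd, e1, e2, hold _ (h.left _), Function.update_self]
      exact hB
    · have n1 : e ≠ j + j + 1 := by omega
      have n2 : e ≠ j + j := by omega
      have e1 : Function.update (Function.update V (j + j) (R (b j))) (j + j + 1) (j + 1) e =
          V e := by simp [n1, n2]
      have e2 : Function.update (Function.update U (j + j) (j + 1)) (j + j + 1) (L (b j)) e =
          U e := by simp [n1, n2]
      rw [e1, e2, hold _ (h.candU e he hef), hold _ (h.candV e he hef)]
      exact h.cand e he hef
  · intro e he hef
    have h1 := h.left (b j)
    have h2 := fun he => h.candU e he hef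
    simp only [Function.update_apply]
    split_ifs
    · omega
    · omega
    · have := h2 (by omega); omega
  · intro e he hef
    have h1 := h.right (b j)
    have h2 := fun he => h.candV e he hef
    simp only [Function.update_apply]
    split_ifs
    · omega
    · omega
    · have := h2 (by omega); omega

/-- Computes the ends of the candidate cuts as intervals. -/
def intervalProg : Prog :=
  let i := NExp.var 40
  let a := NExp.get 7 i
  let b := NExp.get 8 i
  .loop (.natLe (.lit 1) i)
    ((Prog.setVar 40 (i.sub (.lit 1))).seq
      ((Prog.setNat 21 (i.add i) (i.add (.lit 1))).seq
        ((Prog.setNat 22 (i.add i) (.get 45 b)).seq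
          ((Prog.setNat 21 ((i.add i).add (.lit 1)) (.get 44 b)).seq
            ((Prog.setNat 22 ((i.add i).add (.lit 1)) (i.add (.lit 1))).seq
              ((Prog.setNat 44 a (i.add (.lit 1))).seq
                ((Prog.setNat 45 a (.get 45 b)).seq (.setNat 45 b (i.add (.lit 1))))))))))

theorem intervalProg_halts {s : State} {n f : ℕ} {a b : ℕ → ℕ} (ha : s.nat 7 = a)
    (hb : s.nat 8 = b) (h40 : s.nat 40 0 = f) (h44 : s.nat 44 = fun _ => 0)
    (h45 : s.nat 45 = fun _ => 0) (hm : IsMergeSeq n f a b) :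
    Halts intervalProg s ((f + 1) * 200) (fun s' => ∃ g : ℕ → Fin n → ℝ, ∀ e < 2 * f,
      classVec n a b (e / 2) (side a b e) - (g (s'.nat 22 e) - g (s'.nat 21 e)) ∈
        rootSpan n f a b ∧ s'.nat 21 e < f + 1 ∧ s'.nat 22 e < f + 1) := by
  refine (Halts.for (B := f) (I := fun t s' => s'.nat 7 = a ∧ s'.nat 8 = b ∧
    s'.nat 40 0 = f - t ∧ ∃ g, IsIntervals n f a b (s'.nat 44) (s'.nat 45) (s'.nat 21) (s'.nat 22)
      g (f - t)) (c := 100) ?_ ?_ ⟨ha, hb, h40, 0, ?_⟩ ?_).mono le_rfl ?_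
  · rintro t s' ht ⟨-, -, e40, -⟩
    simp only [BExp.eval, NExp.eval, e40]; omega
  · rintro t s' ht ⟨e7, e8, e40, g, hg⟩
    refine Prog.LoopFree.halts (by simp [Prog.LoopFree])
      (by simp [Prog.maxCost, NExp.cost]) ?_
    obtain ⟨j, hj⟩ : ∃ j, j = f - (t + 1) := ⟨_, rfl⟩
    have hj1 : f - t = j + 1 := by omega
    rw [← hj]
    rw [hj1] at e40 hg
    have hstep := hg.step hm (by omega)
    simp only [Prog.exec, NExp.eval, State.setNat_nat]
    simp only [e7, e8, e40, Nat.reduceEqDiff, if_false, if_true,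
      Function.update_self, Nat.add_sub_cancel]
    exact ⟨trivial, trivial, trivial, _, hstep⟩
  -- Before any split all end points are `0` and the potential vanishes, which suits the final
  -- classes since their indicators lie in `rootSpan`.
  · rw [Nat.sub_zero, h44, h45]
    refine ⟨fun r hr hrep => ?_, fun _ => Or.inl rfl, fun _ => Or.inl rfl, ?_, ?_, ?_⟩
    · simp only [Pi.zero_apply, sub_zero]
      exact Submodule.subset_span ⟨r, by simpa [reps] using ⟨hr, hrep⟩, rfl⟩
    all_goals intro e h1 h2; omega
  · simp [BExp.cost, NExp.cost]
  · rintro s' ⟨-, -, -, g, hg⟩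
    rw [Nat.sub_self] at hg
    refine ⟨g, fun e he => ⟨hg.cand e (by omega) he, ?_, ?_⟩⟩
    · have := hg.candU e (by omega) he; omega
    · have := hg.candV e (by omega) he; omega

/-! ## The chosen cuts -/

/-- Marks the first accepted candidates, as many as the variable `46` says. -/
def markProg : Prog :=
  let i := NExp.var 40
  .loop (.not (.natLe (.var 46) i))
    ((Prog.setNat 47 (.get 26 i) (.lit 1)).seq (.setVar 40 (i.add (.lit 1))))

theorem markProg_halts {s : State} {q : ℕ} (h46 : s.nat 46 0 = q) (h40 : s.nat 40 0 = 0)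
    (h47 : s.nat 47 = fun _ => 0) :
    Halts markProg s ((q + 1) * 50) (fun s' =>
      ∀ e, 1 ≤ s'.nat 47 e ↔ ∃ i < q, s.nat 26 i = e) := by
  refine (Halts.for (B := q) (I := fun t s' => s'.nat 46 0 = q ∧ s'.nat 26 = s.nat 26 ∧
    s'.nat 40 0 = t ∧ ∀ e, 1 ≤ s'.nat 47 e ↔ ∃ i < t, s.nat 26 i = e) (c := 20) ?_ ?_
    ⟨h46, rfl, h40, ?_⟩ ?_).mono le_rfl ?_
  · rintro t s' ht ⟨e46, -, e40, -⟩
    simp [BExp.eval, NExp.eval, e46, e40]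
  · rintro t s' ht ⟨e46, e26, e40, h⟩
    refine Prog.LoopFree.halts (by simp [Prog.LoopFree]) (by simp [Prog.maxCost, NExp.cost]) ?_
    simp only [Prog.exec, NExp.eval, State.setNat_nat]
    simp only [e46, e26, e40, Nat.reduceEqDiff, if_false, if_true, Function.update_self]
    refine ⟨trivial, trivial, trivial, fun e => ?_⟩
    rw [Function.update_apply]
    split_ifs with he
    · exact ⟨fun _ => ⟨t, by omega, he.symm⟩, fun _ => le_rfl⟩
    · rw [h e]
      constructor
      · rintro ⟨i, hi, h⟩; exact ⟨i, by omega, h⟩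
      · rintro ⟨i, hi, hie⟩
        refine ⟨i, ?_, hie⟩
        have : i ≠ t := by rintro rfl; exact he hie.symm
        omega
  · simp [h47]
  · simp [BExp.cost, NExp.cost]
  · rintro s' ⟨-, -, -, h⟩
    exact h

/-! ### Labels for the parts cut out by the marked candidates -/

/-- Two vertices have classes with the same label after `j` mergers iff no marked candidate from
these or later mergers separates them. -/
structure IsLabel (f : ℕ) (a b : ℕ → ℕ) (P : ℕ → Prop) (lab : ℕ → ℕ) (j : ℕ) : Prop where
  fresh : ∀ r, lab r = 0 ∨ 2 * j < lab r
  eq_iff : ∀ x y, lab (rep a b j x) = lab (rep a b j y) ↔ ∀ e, 2 * j ≤ e → e < 2 * f → P e →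
    (rep a b (e / 2) x = side a b e ↔ rep a b (e / 2) y = side a b e)

-- When a merger is undone, each of its two classes inherits the label of their union unless it is
-- marked, in which case it gets a label of its own. The new labels `2 * j + 1` and `2 * j + 2` are
-- unused, since by `fresh` the labels so far are `0` or exceed `2 * (j + 1)`.
open Classical in
theorem IsLabel.step {n f : ℕ} {a b : ℕ → ℕ} {P : ℕ → Prop} {lab : ℕ → ℕ} {j : ℕ}
    (h : IsLabel f a b P lab (j + 1)) (hm : IsMergeSeq n f a b) (hj : j < f) :
    IsLabel f a b P (Function.update
      (Function.update lab (a j) (if P (j + j) then j + j + 1 else lab (b j))) (b j)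
        (if P (j + j + 1) then j + j + 2 else lab (b j))) j := by
  have hne := hm.ne j hj
  constructor
  · intro r
    have h1 := h.fresh r
    have h2 := h.fresh (b j)
    simp only [Function.update_apply]
    split_ifs <;> omega
  · intro x y
    have hsplit : (∀ e, 2 * j ≤ e → e < 2 * f → P e →
        (rep a b (e / 2) x = side a b e ↔ rep a b (e / 2) y = side a b e)) ↔
        (P (j + j) → (rep a b j x = a j ↔ rep a b j y = a j)) ∧
        (P (j + j + 1) → (rep a b j x = b j ↔ rep a b j y = b j)) ∧
        lab (rep a b (j + 1) x) = lab (rep a b (j + 1) y) := by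
      have hj0 : (j + j) / 2 = j := by omega
      have hj1 : (j + j + 1) / 2 = j := by omega
      rw [h.eq_iff]
      constructor
      · intro H
        refine ⟨fun hP => ?_, fun hP => ?_, fun e he => H e (by omega)⟩
        · have := H (j + j) (by omega) (by omega) hP
          rwa [hj0, side_even] at this
        · have := H (j + j + 1) (by omega) (by omega) hP
          rwa [hj1, side_odd] at this
      · rintro ⟨h1, h2, h3⟩ e he hef hP
        rcases (by omega : e = j + j ∨ e = j + j + 1 ∨ 2 * (j + 1) ≤ e) with rfl | rfl | he
        · rw [hj0, side_even]; exact h1 hP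
        · rw [hj1, side_odd]; exact h2 hP
        · exact h3 e he hef hP
    rw [hsplit]
    simp only [rep, Function.update_apply]
    have f1 := h.fresh (rep a b j x)
    have f2 := h.fresh (rep a b j y)
    have f3 := h.fresh (b j)
    by_cases hxa : rep a b j x = a j <;> by_cases hxb : rep a b j x = b j <;>
      by_cases hya : rep a b j y = a j <;> by_cases hyb : rep a b j y = b j <;>
      by_cases hP : P (j + j) <;> by_cases hQ : P (j + j + 1) <;>
      simp_all <;> omega

/-- Labels the vertices by the smallest marked classes that contain them. -/
def labelProg : Prog :=
  let i := NExp.var 40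
  let a := NExp.get 7 i
  let b := NExp.get 8 i
  .loop (.natLe (.lit 1) i)
    ((Prog.setVar 40 (i.sub (.lit 1))).seq
      ((Prog.ite (.natLe (.lit 1) (.get 47 (i.add i)))
        (.setNat 48 a ((i.add i).add (.lit 1))) (.setNat 48 a (.get 48 b))).seq
        (.ite (.natLe (.lit 1) (.get 47 ((i.add i).add (.lit 1))))
          (.setNat 48 b ((i.add i).add (.lit 2))) .skip)))

theorem labelProg_halts {s : State} {n f : ℕ} {a b : ℕ → ℕ} (ha : s.nat 7 = a)
    (hb : s.nat 8 = b) (h40 : s.nat 40 0 = f) (h48 : s.nat 48 = fun _ => 0)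
    (hm : IsMergeSeq n f a b) :
    Halts labelProg s ((f + 1) * 200) (fun s' => ∀ x y, s'.nat 48 x = s'.nat 48 y ↔
      ∀ e < 2 * f, 1 ≤ s.nat 47 e →
        (rep a b (e / 2) x = side a b e ↔ rep a b (e / 2) y = side a b e)) := by
  refine (Halts.for (B := f) (I := fun t s' => s'.nat 7 = a ∧ s'.nat 8 = b ∧
    s'.nat 47 = s.nat 47 ∧ s'.nat 40 0 = f - t ∧
    IsLabel f a b (fun e => 1 ≤ s.nat 47 e) (s'.nat 48) (f - t)) (c := 100) ?_ ?_
    ⟨ha, hb, rfl, h40, ?_⟩ ?_).mono le_rfl ?_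
  · rintro t s' ht ⟨-, -, -, e40, -⟩
    simp only [BExp.eval, NExp.eval, e40]; omega
  · rintro t s' ht ⟨e7, e8, e47, e40, hg⟩
    refine Prog.LoopFree.halts (by simp [Prog.LoopFree])
      (by simp [Prog.maxCost, NExp.cost, BExp.cost]) ?_
    obtain ⟨j, hj⟩ : ∃ j, j = f - (t + 1) := ⟨_, rfl⟩
    have hj1 : f - t = j + 1 := by omega
    rw [← hj]
    rw [hj1] at e40 hg
    have hjf : j < f := by omega
    have hne := hm.ne j hjf
    have hstep := hg.step hm hjf
    by_cases hP : 1 ≤ s.nat 47 (j + j) <;> by_cases hQ : 1 ≤ s.nat 47 (j + j + 1) <;>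
      simp only [hP, hQ, if_true, if_false] at hstep <;>
      simp only [Prog.exec, BExp.eval, NExp.eval, State.setNat_nat, Nat.reduceEqDiff, if_true,
        if_false, Function.update_self, e40, e47, e7, e8, Nat.add_sub_cancel, hP, hQ]
    · exact ⟨trivial, trivial, trivial, trivial, hstep⟩
    · rw [Function.update_eq_self_iff.2 (by simp [Ne.symm hne])] at hstep
      exact ⟨trivial, trivial, trivial, trivial, hstep⟩
    · exact ⟨trivial, trivial, trivial, trivial, hstep⟩
    · rw [Function.update_eq_self_iff.2 (by simp [Ne.symm hne])] at hstep
      exact ⟨trivial, trivial, trivial, trivial, hstep⟩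
  · rw [h48, Nat.sub_zero]
    exact ⟨fun _ => Or.inl rfl, fun x y => ⟨fun _ e h1 h2 => by omega, fun _ => rfl⟩⟩
  · simp [BExp.cost, NExp.cost]
  · rintro s' ⟨-, -, -, -, h⟩ x y
    rw [Nat.sub_self] at h
    have := h.eq_iff x y
    simpa [rep] using this

/-- Outputs the edges whose ends have different labels. -/
def outputProg : Prog :=
  let i := NExp.var 40
  let x := NExp.get 48 (.get 1 i)
  let y := NExp.get 48 (.get 2 i)
  .loop (.not (.natLe (.var 4) i))
    ((Prog.ite (.and (.natLe x y) (.natLe y x)) (.setNat 3 i (.lit 0)) (.setNat 3 i (.lit 1))).seq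
      (.setVar 40 (i.add (.lit 1))))

theorem outputProg_halts {s : State} {M : ℕ} (hM : s.nat 4 0 = M) (h40 : s.nat 40 0 = 0) :
    Halts outputProg s ((M + 1) * 100) (fun s' =>
      ∀ i < M, s'.nat 3 i = 1 ↔ s.nat 48 (s.nat 1 i) ≠ s.nat 48 (s.nat 2 i)) := by
  refine (Halts.for (B := M) (I := fun t s' => s'.nat 4 0 = M ∧ s'.nat 40 0 = t ∧
    s'.nat 1 = s.nat 1 ∧ s'.nat 2 = s.nat 2 ∧ s'.nat 48 = s.nat 48 ∧
    ∀ i < t, s'.nat 3 i = 1 ↔ s.nat 48 (s.nat 1 i) ≠ s.nat 48 (s.nat 2 i)) (c := 50) ?_ ?_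
    ⟨hM, h40, rfl, rfl, rfl, by simp⟩ ?_).mono le_rfl ?_
  · rintro t s' ht ⟨e4, e40, -⟩
    simp [BExp.eval, NExp.eval, e4, e40]
  · rintro t s' ht ⟨e4, e40, e1, e2, e48, h⟩
    refine Prog.LoopFree.halts (by simp [Prog.LoopFree])
      (by simp [Prog.maxCost, NExp.cost, BExp.cost]) ?_
    rw [Prog.exec_seq]
    by_cases hb : s.nat 48 (s.nat 1 t) = s.nat 48 (s.nat 2 t)
    · rw [Prog.exec_ite_pos (by simp [BExp.eval, NExp.eval, e40, e48, e1, e2, hb])]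
      simp only [Prog.exec, NExp.eval, State.setNat_nat]
      simp [e4, e40, e1, e2, e48]
      intro i hi
      by_cases hit : i = t
      · subst hit; simp [hb]
      · rw [Function.update_of_ne hit]; exact h i (by omega)
    · rw [Prog.exec_ite_neg (by
        simpa [BExp.eval, NExp.eval, e40, e48, e1, e2, ← le_antisymm_iff] using hb)]
      simp only [Prog.exec, NExp.eval, State.setNat_nat]
      simp [e4, e40, e1, e2, e48]
      intro i hi
      by_cases hit : i = t
      · subst hit; simp [hb]
      · rw [Function.update_of_ne hit]; exact h i (by omega)
  · simp [BExp.cost, NExp.cost]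
  · rintro s' ⟨-, -, -, -, -, h⟩
    exact h

/-! ## The bound for the chosen cuts -/

/-- This is the exchange argument of the greedy algorithm in numerical form. Some member of `S`
weighs at least the last `z`; match the two, remove them and repeat. -/
theorem sum_le_sum_of_card_filter_lt {S : Finset ℕ} {w : ℕ → ℝ} {z : ℕ → ℝ}
    (h : ∀ i < S.card, (S.filter fun r => w r < z i).card ≤ i) :
    ∑ i ∈ Finset.range S.card, z i ≤ ∑ r ∈ S, w r := by
  obtain ⟨p, hp⟩ : ∃ p, p = S.card := ⟨_, rfl⟩
  induction p generalizing S with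
  | zero =>
    rw [← hp]
    rw [Finset.card_eq_zero.1 hp.symm]; simp
  | succ p ih =>
    rw [← hp, Finset.sum_range_succ]
    have hcard : (S.filter fun r => w r < z p).card < S.card :=
      lt_of_le_of_lt (h p (by omega)) (by omega)
    obtain ⟨r, hr, hrf⟩ := Finset.exists_mem_notMem_of_card_lt_card hcard
    have hzr : z p ≤ w r := by
      by_contra hlt
      exact hrf (Finset.mem_filter.2 ⟨hr, not_le.1 hlt⟩)
    have hcard' : (S.erase r).card = p := by rw [Finset.card_erase_of_mem hr]; omega
    have := ih (S := S.erase r) (fun i hi =>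
      (Finset.card_le_card (Finset.filter_subset_filter _ (Finset.erase_subset _ _))).trans
        (h i (by omega))) hcard'.symm
    rw [hcard'] at this
    rw [← Finset.sum_erase_add _ _ hr]
    linarith

/-- A fractional choice of total amount at least `q` is cheapest when it takes the `q` smallest
values. The pivot is `z (q - 1)`: what is missing before `q` costs at most the pivot per unit, and
what is taken from `q` on costs at least that. -/
theorem sum_le_sum_mul_of_le_sum {f q : ℕ} {z t : ℕ → ℝ} (hq : q ≤ f)
    (hz : ∀ i j, i ≤ j → j < f → z i ≤ z j) (hz0 : ∀ i < f, 0 ≤ z i) (ht0 : ∀ i < f, 0 ≤ t i)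
    (ht1 : ∀ i < f, t i ≤ 1) (hsum : (q : ℝ) ≤ ∑ i ∈ Finset.range f, t i) :
    ∑ i ∈ Finset.range q, z i ≤ ∑ i ∈ Finset.range f, t i * z i := by
  rcases Nat.eq_zero_or_pos q with rfl | hq0
  · simpa using Finset.sum_nonneg fun i hi =>
      mul_nonneg (ht0 i (Finset.mem_range.1 hi)) (hz0 i (Finset.mem_range.1 hi))
  · obtain ⟨d, rfl⟩ := Nat.exists_eq_add_of_le hq
    rw [Finset.sum_range_add] at hsum ⊢
    have h1 : ∑ i ∈ Finset.range q, (z i - t i * z i) ≤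
        ∑ i ∈ Finset.range q, (z (q - 1) - t i * z (q - 1)) := by
      refine Finset.sum_le_sum fun i hi => ?_
      rw [Finset.mem_range] at hi
      have e1 := hz i (q - 1) (by omega) (by omega)
      have e2 := ht1 i (by omega)
      nlinarith
    have h2 : ∑ i ∈ Finset.range d, t (q + i) * z (q - 1) ≤
        ∑ i ∈ Finset.range d, t (q + i) * z (q + i) := by
      refine Finset.sum_le_sum fun i hi => ?_
      rw [Finset.mem_range] at hi
      exact mul_le_mul_of_nonneg_left (hz _ _ (by omega) (by omega)) (ht0 _ (by omega))
    rw [Finset.sum_sub_distrib, Finset.sum_sub_distrib, ← Finset.sum_mul, Finset.sum_const,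
      Finset.card_range, nsmul_eq_mul] at h1
    rw [← Finset.sum_mul] at h2
    have h3 := hz0 (q - 1) (by omega)
    nlinarith

/-- Abel summation, with a boundary term that vanishes for `p = f`. -/
theorem sum_increments_mul {f p : ℕ} {τ z : ℕ → ℝ} (h0 : τ 0 = 0) (hp : p ≤ f) :
    ∑ j ∈ Finset.range p, (τ (j + 1) - τ j) * ∑ i ∈ Finset.range (f - j), z i =
      τ p * ∑ i ∈ Finset.range (f - p), z i +
        ∑ j ∈ Finset.range p, τ (j + 1) * z (f - 1 - j) := by
  induction p with
  | zero => simp [h0]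
  | succ p ih =>
    rw [Finset.sum_range_succ, ih (by omega), Finset.sum_range_succ]
    have h1 : f - p = (f - (p + 1)) + 1 := by omega
    have h2 : f - 1 - p = f - (p + 1) := by omega
    rw [h1, Finset.sum_range_succ, h2]
    ring

/-- The weight of the edges between different classes after `j` mergers. -/
def crossWeight (m : ℕ) (u v : ℕ → ℕ) (c : ℕ → ℝ) (a b : ℕ → ℕ) (j : ℕ) : ℝ :=
  ∑ i ∈ Finset.range m, if rep a b j (u i) = rep a b j (v i) then 0 else c i

/-- An edge between different classes leaves exactly the two classes of its ends. -/
theorem sum_cutWeight {n m f : ℕ} {u v : ℕ → ℕ} {c : ℕ → ℝ} {a b : ℕ → ℕ}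
    (hm : IsMergeSeq n f a b) (hu : ∀ i < m, u i < n) (hv : ∀ i < m, v i < n) {j : ℕ}
    (hj : j ≤ f) :
    ∑ r ∈ reps n a b j, cutWeight m u v c a b j r = 2 * crossWeight m u v c a b j := by
  simp only [cutWeight, crossWeight]
  rw [Finset.sum_comm, Finset.mul_sum]
  refine Finset.sum_congr rfl fun i hi => ?_
  rw [Finset.mem_range] at hi
  by_cases h : rep a b j (u i) = rep a b j (v i)
  · simp [h]
  · have h1 : ∀ r ∈ reps n a b j, (if (rep a b j (u i) = r ↔ rep a b j (v i) = r) then (0 : ℝ)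
        else c i) = (if rep a b j (u i) = r then c i else 0) +
          (if rep a b j (v i) = r then c i else 0) := by
      intro r _
      by_cases h2 : rep a b j (u i) = r <;> by_cases h3 : rep a b j (v i) = r <;> simp_all
    rw [Finset.sum_congr rfl h1, Finset.sum_add_distrib, Finset.sum_ite_eq, Finset.sum_ite_eq,
      if_pos, if_pos, if_neg h, two_mul]
    · exact IsMergeSeq.mem_reps.2 ⟨hm.rep_lt hj (hv i hi), hm.rep_rep_self hj _⟩
    · exact IsMergeSeq.mem_reps.2 ⟨hm.rep_lt hj (hu i hi), hm.rep_rep_self hj _⟩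

theorem cutWeight_nonneg {m : ℕ} {u v : ℕ → ℕ} {c : ℕ → ℝ} {a b : ℕ → ℕ}
    (hc : ∀ i < m, 0 ≤ c i) (j r : ℕ) : 0 ≤ cutWeight m u v c a b j r := by
  refine Finset.sum_nonneg fun i hi => ?_
  split_ifs
  · exact le_rfl
  · exact hc i (Finset.mem_range.1 hi)

/-! ### The greedy basis of candidate indicators -/

/-- The indicator of the `e`-th candidate class. -/
abbrev candVec (n : ℕ) (a b : ℕ → ℕ) (e : ℕ) : Fin n → ℝ := classVec n a b (e / 2) (side a b e)

/-- A class that is not final is a candidate. -/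
theorem exists_candidate {n f : ℕ} {a b : ℕ → ℕ} (hm : IsMergeSeq n f a b) {j r r' : ℕ}
    (hj : j ≤ f) (hr : rep a b j r = r) (hr' : rep a b j r' = r') (hne : r ≠ r')
    (hrep : rep a b f r = rep a b f r') :
    ∃ e < 2 * f, classVec n a b j r = candVec n a b e ∧ ∀ m u v c,
      cutWeight m u v c a b j r = cutWeight m u v c a b (e / 2) (side a b e) := by
  obtain ⟨d, hd⟩ : ∃ d, d = f - j := ⟨_, rfl⟩
  induction d generalizing j r' with
  | zero =>
    obtain rfl : j = f := by omega
    exact absurd (by rw [← hr, hrep, hr']) hne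
  | succ d ih =>
    have hjf : j < f := by omega
    have hj0 : (j + j) / 2 = j := by omega
    have hj1 : (j + j + 1) / 2 = j := by omega
    by_cases h1 : r = a j
    · refine ⟨j + j, by omega, ?_, ?_⟩
      · rw [candVec, hj0, side_even, h1]
      · intro m u v c; rw [hj0, side_even, h1]
    · by_cases h2 : r = b j
      · refine ⟨j + j + 1, by omega, ?_, ?_⟩
        · rw [candVec, hj1, side_odd, h2]
        · intro m u v c; rw [hj1, side_odd, h2]
      · have hr1 : rep a b (j + 1) r = r := by simp [rep, hr, h1]
        have hx : rep a b (j + 1) r' ≠ r := by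
          simp only [rep, hr']
          split_ifs
          · exact Ne.symm h2
          · exact Ne.symm hne
        obtain ⟨e, he, e1, e2⟩ := ih (j := j + 1) (r' := rep a b (j + 1) r') hjf hr1
          (hm.rep_rep_self hjf _) (Ne.symm hx) (by rw [hm.rep_rep hjf le_rfl, hrep]) (by omega)
        exact ⟨e, he, by rw [← e1, classVec_succ_of_ne h1 h2],
          fun m u v c => by rw [← e2, cutWeight_succ_of_ne h1 h2]⟩

/-- The span of the final classes and of the first `i` accepted candidates. -/
def acceptedSpan (n f : ℕ) (a b acc' : ℕ → ℕ) (i : ℕ) : Submodule ℝ (Fin n → ℝ) :=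
  rootSpan n f a b ⊔ Submodule.span ℝ ((fun i => candVec n a b (acc' i)) '' (Finset.range i))

theorem acceptedSpan_mono {n f : ℕ} {a b acc' : ℕ → ℕ} {i j : ℕ} (h : i ≤ j) :
    acceptedSpan n f a b acc' i ≤ acceptedSpan n f a b acc' j := by
  refine sup_le_sup_left (Submodule.span_mono (Set.image_mono ?_)) _
  intro x hx
  simp only [Finset.coe_range, Set.mem_Iio] at hx ⊢
  omega

theorem candVec_mem_acceptedSpan {n f : ℕ} {a b acc' : ℕ → ℕ} {i j : ℕ} (h : i < j) :
    candVec n a b (acc' i) ∈ acceptedSpan n f a b acc' j :=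
  Submodule.mem_sup_right (Submodule.subset_span ⟨i, by simpa using h, rfl⟩)

/-- A set of classes whose indicators are spanned by final classes and `i` accepted candidates
has at most `i` members, if every final class has a part outside the set. -/
theorem card_le_of_mem_acceptedSpan {n f : ℕ} {a b acc' : ℕ → ℕ} {j i : ℕ}
    {S : Finset ℕ} {h : ℕ → ℕ} (hS : S ⊆ reps n a b j)
    (hh : ∀ r ∈ S, h (rep a b f r) ∈ reps n a b j ∧ h (rep a b f r) ∉ S ∧
      rep a b f (h (rep a b f r)) = rep a b f r)
    (hspan : ∀ r ∈ S, classVec n a b j r ∈ acceptedSpan n f a b acc' i) : S.card ≤ i := by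
  have hlt : ∀ r ∈ S, r < n := fun r hr => (IsMergeSeq.mem_reps.1 (hS hr)).1
  have hlt' : ∀ r ∈ S, h (rep a b f r) < n := fun r hr => (IsMergeSeq.mem_reps.1 (hh r hr).1).1
  -- Each coordinate compares the value at a class of `S` with the value at the part outside `S` of
  -- the same final class. This kills the final indicators and sends the indicators of the classes
  -- in `S` to the unit vectors, so the images of `i` accepted candidates must span a space of
  -- dimension `S.card`.
  let φ : (Fin n → ℝ) →ₗ[ℝ] (S → ℝ) := LinearMap.pi fun r =>
    LinearMap.proj (R := ℝ) (φ := fun _ => ℝ) (⟨r, hlt r r.2⟩ : Fin n) -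
      LinearMap.proj (⟨h (rep a b f r), hlt' r r.2⟩ : Fin n)
  have hφ : ∀ w r, φ w r = w ⟨r, hlt r r.2⟩ - w ⟨h (rep a b f r), hlt' r r.2⟩ := by
    intro w r; simp [φ]
  have hroot : (rootSpan n f a b).map φ = ⊥ := by
    rw [rootSpan, Submodule.map_span, Submodule.span_eq_bot]
    rintro _ ⟨_, ⟨ρ, hρ, rfl⟩, rfl⟩
    funext r
    simp [hφ, classVec, (hh r r.2).2.2]
  have hsingle : ∀ r : S, φ (classVec n a b j r) = Pi.single r 1 := by
    intro r
    funext r'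
    have h1 := (IsMergeSeq.mem_reps.1 (hS r'.2)).2
    have h2 := (IsMergeSeq.mem_reps.1 (hh r' r'.2).1).2
    have h3 : h (rep a b f r') ≠ r := fun he => (hh r' r'.2).2.1 (he ▸ r.2)
    simp only [hφ, classVec, h1, h2, if_neg h3, sub_zero, Pi.single_apply, Subtype.ext_iff]
  have htop : (acceptedSpan n f a b acc' i).map φ = ⊤ := by
    rw [eq_top_iff, ← (Pi.basisFun ℝ S).span_eq, Submodule.span_le]
    rintro _ ⟨r, rfl⟩
    refine ⟨classVec n a b j r, hspan r r.2, ?_⟩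
    rw [hsingle, Pi.basisFun_apply]
  rw [acceptedSpan, Submodule.map_sup, hroot, bot_sup_eq, Submodule.map_span] at htop
  have h1 := finrank_span_finset_le_card (R := ℝ)
    ((Finset.range i).image fun i => φ (candVec n a b (acc' i)))
  rw [Finset.coe_image, ← Set.image_image φ, Set.finrank, htop, finrank_top] at h1
  have h2 : ((Finset.range i).image fun i => φ (candVec n a b (acc' i))).card ≤ i := by
    simpa using Finset.card_image_le (s := Finset.range i)
      (f := fun i => φ (candVec n a b (acc' i)))
  simpa using h1.trans h2

/-- The data of the two runs of Kruskal's algorithm: on the graph, and on the candidate cuts. -/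
structure IsRounding (n m : ℕ) (u v : ℕ → ℕ) (c x : ℕ → ℝ) (f : ℕ) (acc a b : ℕ → ℕ)
    (U V : ℕ → ℕ) (W : ℕ → ℝ) (g : ℕ → Fin n → ℝ) (f' : ℕ) (acc' a' b' : ℕ → ℕ) : Prop where
  u_lt : ∀ i < m, u i < n
  v_lt : ∀ i < m, v i < n
  c_nonneg : ∀ i < m, 0 ≤ c i
  x_nonneg : ∀ i < m, 0 ≤ x i
  kruskal : IsKruskal n m u v x f acc a b
  weight : ∀ e < 2 * f, W e = cutWeight m u v c a b (e / 2) (side a b e)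
  interval : ∀ e < 2 * f, candVec n a b e - (g (V e) - g (U e)) ∈ rootSpan n f a b
  kruskal' : IsKruskal (f + 1) (2 * f) U V W f' acc' a' b'

namespace IsRounding

variable {n m : ℕ} {u v : ℕ → ℕ} {c x : ℕ → ℝ} {f : ℕ} {acc a b : ℕ → ℕ}
  {U V : ℕ → ℕ} {W : ℕ → ℝ} {g : ℕ → Fin n → ℝ} {f' : ℕ} {acc' a' b' : ℕ → ℕ}

/-- The potential difference along an accepted edge is its candidate indicator up to `rootSpan`, so
points connected by the first `j` accepted edges have equal potentials modulo `acceptedSpan`. -/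
theorem potential_sub_mem (h : IsRounding n m u v c x f acc a b U V W g f' acc' a' b') {j : ℕ}
    (hj : j ≤ f') (p : ℕ) : g p - g (rep a' b' j p) ∈ acceptedSpan n f a b acc' j := by
  induction j generalizing p with
  | zero => simp [rep]
  | succ j ih =>
    have ih' : ∀ p, g p - g (rep a' b' j p) ∈ acceptedSpan n f a b acc' (j + 1) :=
      fun p => acceptedSpan_mono (Nat.le_succ j) (ih (by omega) p)
    simp only [rep]
    split_ifs with hp
    · have h1 := ih' p
      have h2 := ih' (U (acc' j))
      have h3 := ih' (V (acc' j))
      have h4 : candVec n a b (acc' j) ∈ acceptedSpan n f a b acc' (j + 1) :=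
        candVec_mem_acceptedSpan (Nat.lt_succ_self j)
      have h5 : candVec n a b (acc' j) - (g (V (acc' j)) - g (U (acc' j))) ∈
          acceptedSpan n f a b acc' (j + 1) :=
        Submodule.mem_sup_left (h.interval _ (h.kruskal'.acc_lt j (by omega)))
      have h6 := Submodule.sub_mem _ h4 h5
      rw [sub_sub_cancel] at h6
      rw [hp] at h1
      rcases h.kruskal'.ends j (by omega) with ⟨e1, e2⟩ | ⟨e1, e2⟩
      · rw [e1] at h2
        rw [e2] at h3
        have := Submodule.add_mem _ (Submodule.sub_mem _ h1 h2) (Submodule.sub_mem _ h3 h6)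
        convert this using 1
        abel
      · rw [e1] at h2
        rw [e2] at h3
        have := Submodule.add_mem _ (Submodule.sub_mem _ h1 h3) (Submodule.add_mem _ h2 h6)
        convert this using 1
        abel
    · exact ih' p

/-- The greedy property in linear form: the bottleneck statement `span` of the second run becomes
spanning by accepted candidates that are no heavier. -/
theorem candVec_mem (h : IsRounding n m u v c x f acc a b U V W g f' acc' a' b') {e : ℕ}
    (he : e < 2 * f) : ∃ j ≤ f', candVec n a b e ∈ acceptedSpan n f a b acc' j ∧
      ∀ j' < j, W (acc' j') ≤ W e := by
  obtain ⟨j, hj, h1, h2⟩ := h.kruskal'.span e he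
  refine ⟨j, hj, ?_, h2⟩
  have e1 := h.potential_sub_mem hj (U e)
  have e2 := h.potential_sub_mem hj (V e)
  have e3 : candVec n a b e - (g (V e) - g (U e)) ∈ acceptedSpan n f a b acc' j :=
    Submodule.mem_sup_left (h.interval e he)
  rw [h1] at e1
  have := Submodule.add_mem _ e3 (Submodule.sub_mem _ e2 e1)
  convert this using 1
  abel

/-- A choice of a heaviest part for every final class. -/
theorem exists_heaviest (h : IsRounding n m u v c x f acc a b U V W g f' acc' a' b') {j : ℕ}
    (hj : j ≤ f) : ∃ top : ℕ → ℕ, ∀ ρ ∈ reps n a b f, top ρ ∈ reps n a b j ∧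
      rep a b f (top ρ) = ρ ∧ ∀ r ∈ reps n a b j, rep a b f r = ρ →
        cutWeight m u v c a b j r ≤ cutWeight m u v c a b j (top ρ) := by
  have hm := h.kruskal.merge
  have key : ∀ ρ, ∃ t, ρ ∈ reps n a b f → t ∈ reps n a b j ∧ rep a b f t = ρ ∧
      ∀ r ∈ reps n a b j, rep a b f r = ρ →
        cutWeight m u v c a b j r ≤ cutWeight m u v c a b j t := by
    intro ρ
    by_cases hρ : ρ ∈ reps n a b f
    · have hρ' := IsMergeSeq.mem_reps.1 hρ
      obtain ⟨t, ht, hmax⟩ := Finset.exists_max_image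
        ((reps n a b j).filter fun r => rep a b f r = ρ) (cutWeight m u v c a b j)
        ⟨ρ, Finset.mem_filter.2 ⟨IsMergeSeq.mem_reps.2
          ⟨hρ'.1, hm.rep_eq_self_of_le hj le_rfl hρ'.2⟩, hρ'.2⟩⟩
      rw [Finset.mem_filter] at ht
      exact ⟨t, fun _ => ⟨ht.1, ht.2, fun r hr hrρ => hmax r (Finset.mem_filter.2 ⟨hr, hrρ⟩)⟩⟩
    · exact ⟨0, fun h => absurd h hρ⟩
  choose top htop using key
  exact ⟨top, htop⟩

/-- The comparison set `S` consists of the classes at level `j` without a heaviest one in each final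
class. What is omitted keeps the rest independent modulo the final classes, and choosing it heaviest
gains the factor `1 - 1/n`. -/
theorem level_bound (h : IsRounding n m u v c x f acc a b U V W g f' acc' a' b') {j : ℕ}
    (hj : j ≤ f) : f - j ≤ f' ∧ ∑ i ∈ Finset.range (f - j), W (acc' i) ≤
      2 * (1 - 1 / (n : ℝ)) * crossWeight m u v c a b j := by
  classical
  have hm := h.kruskal.merge
  obtain ⟨top, htop⟩ := h.exists_heaviest hj
  have hinj : Set.InjOn top (reps n a b f) := by
    intro ρ hρ ρ' hρ' he
    rw [← (htop ρ hρ).2.1, he, (htop ρ' hρ').2.1]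
  have hsub : (reps n a b f).image top ⊆ reps n a b j := by
    intro r hr
    obtain ⟨ρ, hρ, rfl⟩ := Finset.mem_image.1 hr
    exact (htop ρ hρ).1
  obtain ⟨S, hSdef⟩ : ∃ S, S = reps n a b j \ (reps n a b f).image top := ⟨_, rfl⟩
  have hScard : S.card = f - j := by
    rw [hSdef, Finset.card_sdiff_of_subset hsub, Finset.card_image_of_injOn hinj]
    have h1 := hm.card_reps hj
    have h2 := hm.card_reps le_rfl
    omega
  have hSsub : S ⊆ reps n a b j := hSdef ▸ Finset.sdiff_subset
  have hroot : ∀ r ∈ S, rep a b f r ∈ reps n a b f := fun r hr =>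
    IsMergeSeq.mem_reps.2 ⟨hm.rep_lt le_rfl (IsMergeSeq.mem_reps.1 (hSsub hr)).1,
      hm.rep_rep_self le_rfl _⟩
  have hh : ∀ r ∈ S, top (rep a b f r) ∈ reps n a b j ∧ top (rep a b f r) ∉ S ∧
      rep a b f (top (rep a b f r)) = rep a b f r := by
    intro r hr
    refine ⟨(htop _ (hroot r hr)).1, fun hmem => ?_, (htop _ (hroot r hr)).2.1⟩
    rw [hSdef, Finset.mem_sdiff] at hmem
    exact hmem.2 (Finset.mem_image_of_mem _ (hroot r hr))
  have hcand : ∀ r ∈ S, ∃ i ≤ f', classVec n a b j r ∈ acceptedSpan n f a b acc' i ∧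
      ∀ i' < i, W (acc' i') ≤ cutWeight m u v c a b j r := by
    intro r hr
    have h1 := hh r hr
    obtain ⟨e, he, e1, e2⟩ := exists_candidate hm hj (IsMergeSeq.mem_reps.1 (hSsub hr)).2
      (IsMergeSeq.mem_reps.1 h1.1).2 (fun he => h1.2.1 (he ▸ hr)) h1.2.2.symm
    obtain ⟨i, hi, e3, e4⟩ := h.candVec_mem he
    refine ⟨i, hi, e1 ▸ e3, fun i' hi' => ?_⟩
    rw [e2, ← h.weight e he]
    exact e4 i' hi'
  have hf' : f - j ≤ f' := by
    rw [← hScard]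
    refine card_le_of_mem_acceptedSpan (acc' := acc') hSsub hh fun r hr => ?_
    obtain ⟨i, hi, h1, -⟩ := hcand r hr
    exact acceptedSpan_mono hi h1
  refine ⟨hf', ?_⟩
  -- Classes of `S` lighter than the `i`-th accepted candidate are spanned by the earlier ones and
  -- the final classes, so there are at most `i` of them.
  have hgreedy := sum_le_sum_of_card_filter_lt (S := S) (w := cutWeight m u v c a b j)
    (z := fun i => W (acc' i)) (by
      intro i hi
      refine card_le_of_mem_acceptedSpan (f := f) (acc' := acc') (h := top)
        ((Finset.filter_subset _ _).trans hSsub) ?_ ?_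
      · intro r hr
        obtain ⟨h1, h2, h3⟩ := hh r (Finset.mem_filter.1 hr).1
        exact ⟨h1, fun hmem => h2 (Finset.mem_filter.1 hmem).1, h3⟩
      · intro r hr
        obtain ⟨hr, hlt⟩ := Finset.mem_filter.1 hr
        obtain ⟨i', hi', h1, h2⟩ := hcand r hr
        refine acceptedSpan_mono ?_ h1
        by_contra hcon
        exact absurd (h2 i (not_le.1 hcon)) (not_le.2 hlt))
  rw [hScard] at hgreedy
  refine hgreedy.trans ?_
  have hsplit : ∑ r ∈ S, cutWeight m u v c a b j r +
      ∑ ρ ∈ reps n a b f, cutWeight m u v c a b j (top ρ) =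
      2 * crossWeight m u v c a b j := by
    rw [← sum_cutWeight hm h.u_lt h.v_lt hj, hSdef, ← Finset.sum_sdiff hsub,
      Finset.sum_image hinj]
  -- Each final class has at most `n` parts, none heavier than the omitted one.
  have htotal : 2 * crossWeight m u v c a b j ≤
      n * ∑ ρ ∈ reps n a b f, cutWeight m u v c a b j (top ρ) := by
    rw [← sum_cutWeight hm h.u_lt h.v_lt hj, Finset.mul_sum,
      ← Finset.sum_fiberwise_of_maps_to (g := rep a b f) (t := reps n a b f)]
    · refine Finset.sum_le_sum fun ρ hρ => ?_
      refine (Finset.sum_le_card_nsmul _ _ _ fun r hr =>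
        (htop ρ hρ).2.2 r (Finset.mem_filter.1 hr).1 (Finset.mem_filter.1 hr).2).trans ?_
      rw [nsmul_eq_mul]
      refine mul_le_mul_of_nonneg_right ?_ (cutWeight_nonneg h.c_nonneg _ _)
      have h1 := Finset.card_filter_le (reps n a b j) fun r => rep a b f r = ρ
      have h2 := hm.card_reps hj
      exact_mod_cast (by omega : ((reps n a b j).filter fun r => rep a b f r = ρ).card ≤ n)
    · intro r hr
      exact IsMergeSeq.mem_reps.2 ⟨hm.rep_lt le_rfl (IsMergeSeq.mem_reps.1 hr).1,
        hm.rep_rep_self le_rfl _⟩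
  -- For `n = 0` the quotient `1 / n` is `0` by convention, but then there are no classes and
  -- `crossWeight` is `0`.
  rcases Nat.eq_zero_or_pos n with rfl | hn
  · have : S = ∅ := by
      rw [Finset.eq_empty_iff_forall_notMem]
      intro r hr
      exact absurd (IsMergeSeq.mem_reps.1 (hSsub hr)).1 (by omega)
    subst this
    have : reps 0 a b f = ∅ := by simp [reps]
    rw [this] at hsplit
    simp only [Finset.sum_empty, add_zero] at hsplit ⊢
    simp; linarith
  · have hn' : (0 : ℝ) < n := by exact_mod_cast hn
    have h1 : 2 * crossWeight m u v c a b j / n ≤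
        ∑ ρ ∈ reps n a b f, cutWeight m u v c a b j (top ρ) := by
      rw [div_le_iff₀ hn']; linarith
    have h2 : 2 * (1 - 1 / (n : ℝ)) * crossWeight m u v c a b j =
        2 * crossWeight m u v c a b j - 2 * crossWeight m u v c a b j / n := by ring
    rw [h2]; linarith

/-- Level `0` provides `f` independent classes, while a forest on `f + 1` points has at most `f`
edges. -/
theorem card_eq (h : IsRounding n m u v c x f acc a b U V W g f' acc' a' b') : f' = f := by
  have h1 := (h.level_bound (Nat.zero_le f)).1
  have h2 := h.kruskal'.merge.lt_of_pos (Nat.succ_pos f)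
  omega

/-- The accepted candidates, together with the final classes, span everything. -/
theorem acceptedSpan_eq_top (h : IsRounding n m u v c x f acc a b U V W g f' acc' a' b') :
    acceptedSpan n f a b acc' f' = ⊤ := by
  have hm := h.kruskal.merge
  rw [eq_top_iff, ← (Pi.basisFun ℝ (Fin n)).span_eq, Submodule.span_le]
  rintro _ ⟨w, rfl⟩
  have hw : (Pi.basisFun ℝ (Fin n)) w = classVec n a b 0 w := by
    funext w'
    by_cases hww : w' = w
    · subst hww; simp [classVec, rep]
    · simp [classVec, rep, hww, Fin.val_ne_of_ne hww]
  rw [hw]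
  -- A single vertex is a candidate unless it is alone in its final class, and then it is itself
  -- that class.
  by_cases hex : ∃ r' < n, (w : ℕ) ≠ r' ∧ rep a b f w = rep a b f r'
  · obtain ⟨r', -, hne, hr'⟩ := hex
    obtain ⟨e, he, e1, -⟩ := exists_candidate hm (Nat.zero_le f) (r := w) rfl (r' := r') rfl hne hr'
    obtain ⟨i, hi, e3, -⟩ := h.candVec_mem he
    rw [e1]
    exact acceptedSpan_mono hi e3
  · push Not at hex
    have hfix : rep a b f w = w := by
      by_contra hne
      exact hex (rep a b f w) (hm.rep_lt le_rfl w.2) (Ne.symm hne) (hm.rep_rep_self le_rfl _).symm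
    refine Submodule.mem_sup_left (Submodule.subset_span ⟨w, ?_, ?_⟩)
    · exact IsMergeSeq.mem_reps.2 ⟨w.2, hfix⟩
    · funext w'
      simp only [classVec, rep]
      by_cases hww : (w' : ℕ) = w
      · simp [hww, hfix]
      · have := hex w' w'.2 (Ne.symm hww)
        rw [hfix] at this
        simp [hww, Ne.symm this]

/-- The cost of the first `q` accepted candidates. -/
theorem sum_weight_le (h : IsRounding n m u v c x f acc a b U V W g f' acc' a' b') {q : ℕ}
    (hq : q ≤ f) (hfeas : (q : ℝ) ≤ ∑ j ∈ Finset.range f, min 1 (x (acc j))) :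
    ∑ i ∈ Finset.range q, W (acc' i) ≤
      2 * (1 - 1 / (n : ℝ)) * ∑ i ∈ Finset.range m, c i * x i := by
  have hf' := h.card_eq
  subst hf'
  have hxa : ∀ j < f', 0 ≤ x (acc j) := fun j hj => h.x_nonneg _ (h.kruskal.acc_lt j hj)
  -- The index is shifted so that the increments of `τ` start from `0`; level `j` gets the increment
  -- from `τ j` to `τ (j + 1)`.
  obtain ⟨τ, hτ0, hτ1⟩ : ∃ τ : ℕ → ℝ, τ 0 = 0 ∧ ∀ j, τ (j + 1) = min 1 (x (acc j)) :=
    ⟨fun j => Nat.casesOn j 0 fun j => min 1 (x (acc j)), rfl, fun _ => rfl⟩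
  have hτmono : ∀ j < f', 0 ≤ τ (j + 1) - τ j := by
    intro j hj
    rw [hτ1]
    cases j with
    | zero => rw [hτ0, sub_zero]; exact le_min zero_le_one (hxa 0 hj)
    | succ j =>
      rw [hτ1, sub_nonneg]
      exact min_le_min_left _ (h.kruskal.mono j (j + 1) (by omega) hj)
  have h1 : ∑ i ∈ Finset.range q, W (acc' i) ≤
      ∑ i ∈ Finset.range f', τ (f' - 1 - i + 1) * W (acc' i) := by
    refine sum_le_sum_mul_of_le_sum hq (fun i j => h.kruskal'.mono i j) ?_ ?_ ?_ ?_
    · intro i hi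
      have := h.kruskal'.acc_lt i hi
      rw [h.weight _ this]
      exact cutWeight_nonneg h.c_nonneg _ _
    · intro i hi
      rw [hτ1]; exact le_min zero_le_one (hxa _ (by omega))
    · intro i hi
      rw [hτ1]; exact min_le_left _ _
    · simp only [hτ1]
      rwa [Finset.sum_range_reflect (fun j => min 1 (x (acc j)))]
  have h2 : ∑ i ∈ Finset.range f', τ (f' - 1 - i + 1) * W (acc' i) =
      ∑ j ∈ Finset.range f', τ (j + 1) * W (acc' (f' - 1 - j)) := by
    rw [← Finset.sum_range_reflect]
    refine Finset.sum_congr rfl fun j hj => ?_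
    rw [Finset.mem_range] at hj
    rw [show f' - 1 - (f' - 1 - j) = j by omega]
  have h3 := sum_increments_mul (f := f') (p := f') (z := fun i => W (acc' i)) hτ0 le_rfl
  rw [Nat.sub_self, Finset.range_zero, Finset.sum_empty, mul_zero, zero_add] at h3
  have h4 : ∑ j ∈ Finset.range f', (τ (j + 1) - τ j) *
      ∑ i ∈ Finset.range (f' - j), W (acc' i) ≤ ∑ j ∈ Finset.range f', (τ (j + 1) - τ j) *
        (2 * (1 - 1 / (n : ℝ)) * crossWeight m u v c a b j) := by
    refine Finset.sum_le_sum fun j hj => ?_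
    rw [Finset.mem_range] at hj
    exact mul_le_mul_of_nonneg_left (h.level_bound hj.le).2 (hτmono j hj)
  -- Edge by edge: from the time `j₀` given by `span` on, the ends are together and contribute
  -- nothing; before it the increments telescope to `τ j₀ ≤ x i`.
  have h5 : ∑ j ∈ Finset.range f', (τ (j + 1) - τ j) * crossWeight m u v c a b j ≤
      ∑ i ∈ Finset.range m, c i * x i := by
    simp only [crossWeight, Finset.mul_sum]
    rw [Finset.sum_comm]
    refine Finset.sum_le_sum fun i hi => ?_
    rw [Finset.mem_range] at hi
    obtain ⟨j₀, hj₀, he, hle⟩ := h.kruskal.span i hi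
    have hτx : τ j₀ ≤ x i := by
      cases j₀ with
      | zero => rw [hτ0]; exact h.x_nonneg i hi
      | succ j => rw [hτ1]; exact (min_le_right _ _).trans (hle j (Nat.lt_succ_self j))
    have hzero : ∀ j ∈ Finset.range f', j ∉ Finset.range j₀ → (τ (j + 1) - τ j) *
        (if rep a b j (u i) = rep a b j (v i) then 0 else c i) = 0 := by
      intro j hj hj'
      rw [Finset.mem_range] at hj hj'
      rw [if_pos (h.kruskal.merge.rep_eq_of_le (not_lt.1 hj') hj.le he), mul_zero]
    rw [← Finset.sum_subset (Finset.range_subset_range.2 hj₀) hzero]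
    calc ∑ j ∈ Finset.range j₀, (τ (j + 1) - τ j) *
          (if rep a b j (u i) = rep a b j (v i) then 0 else c i)
        ≤ ∑ j ∈ Finset.range j₀, (τ (j + 1) - τ j) * c i := by
          refine Finset.sum_le_sum fun j hj => ?_
          rw [Finset.mem_range] at hj
          refine mul_le_mul_of_nonneg_left ?_ (hτmono j (by omega))
          split_ifs
          · exact h.c_nonneg i hi
          · exact le_rfl
      _ = τ j₀ * c i := by
          rw [← Finset.sum_mul, Finset.sum_range_sub, hτ0, sub_zero]
      _ ≤ c i * x i := by
          rw [mul_comm]; exact mul_le_mul_of_nonneg_left hτx (h.c_nonneg i hi)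
  have h6 : ∑ j ∈ Finset.range f', (τ (j + 1) - τ j) *
      (2 * (1 - 1 / (n : ℝ)) * crossWeight m u v c a b j) = 2 * (1 - 1 / (n : ℝ)) *
        ∑ j ∈ Finset.range f', (τ (j + 1) - τ j) * crossWeight m u v c a b j := by
    rw [Finset.mul_sum]
    exact Finset.sum_congr rfl fun j _ => by ring
  have hn : 0 ≤ 2 * (1 - 1 / (n : ℝ)) := by
    rcases Nat.eq_zero_or_pos n with rfl | hn
    · simp
    · have : (1 : ℝ) ≤ n := by exact_mod_cast hn
      have : 1 / (n : ℝ) ≤ 1 := by rw [div_le_one (by linarith)]; exact this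
      linarith
  calc _ ≤ _ := h1
    _ = _ := h2
    _ = _ := h3.symm
    _ ≤ _ := h4
    _ = _ := h6
    _ ≤ _ := mul_le_mul_of_nonneg_left h5 hn

end IsRounding

/-! ## Forests, components and costs -/

theorem eq_of_reachable {V α : Type*} {H : SimpleGraph V} {φ : V → α}
    (h : ∀ x y, H.Adj x y → φ x = φ y) {x y : V} (hxy : H.Reachable x y) : φ x = φ y := by
  obtain ⟨p⟩ := hxy
  induction p with
  | nil => rfl
  | cons hadj _ ih => exact (h _ _ hadj).trans ih

/-- The edges of the first `i` mergers. -/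
def mergerEdges (n : ℕ) (u v acc : ℕ → ℕ) (i : ℕ) : Set (Sym2 (Fin n)) :=
  {e | ∃ j < i, ∃ x y : Fin n, e = s(x, y) ∧ (x : ℕ) = u (acc j) ∧ (y : ℕ) = v (acc j)}

/-- Representatives are constant on the components of the earlier edges, so the next edge joins two
different components and closes no cycle. -/
theorem isAcyclic_mergerEdges {n m f : ℕ} {u v : ℕ → ℕ} {x : ℕ → ℝ} {acc a b : ℕ → ℕ}
    (h : IsKruskal n m u v x f acc a b) (hu : ∀ i < m, u i < n) (hv : ∀ i < m, v i < n) {i : ℕ}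
    (hi : i ≤ f) : (SimpleGraph.fromEdgeSet (mergerEdges n u v acc i)).IsAcyclic := by
  induction i with
  | zero =>
    have : mergerEdges n u v acc 0 = ∅ := by simp [mergerEdges]
    rw [this, SimpleGraph.fromEdgeSet_empty]
    exact SimpleGraph.isAcyclic_bot
  | succ i ih =>
    have hacc := h.acc_lt i (by omega)
    let p : Fin n := ⟨u (acc i), hu _ hacc⟩
    let q : Fin n := ⟨v (acc i), hv _ hacc⟩
    have hsucc : mergerEdges n u v acc (i + 1) = mergerEdges n u v acc i ∪ {s(p, q)} := by
      ext e
      constructor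
      · rintro ⟨j, hj, y, z, rfl, hy, hz⟩
        rcases Nat.lt_succ_iff_lt_or_eq.1 hj with hj | rfl
        · exact Or.inl ⟨j, hj, y, z, rfl, hy, hz⟩
        · right
          rw [Fin.ext (show (y : ℕ) = p from hy), Fin.ext (show (z : ℕ) = q from hz)]
          rfl
      · rintro (⟨j, hj, hrest⟩ | rfl)
        · exact ⟨j, by omega, hrest⟩
        · exact ⟨i, by omega, p, q, rfl, rfl, rfl⟩
    have hsplit : SimpleGraph.fromEdgeSet (mergerEdges n u v acc (i + 1)) =
        SimpleGraph.fromEdgeSet (mergerEdges n u v acc i) ⊔ SimpleGraph.edge p q := by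
      rw [hsucc, SimpleGraph.edge, SimpleGraph.fromEdgeSet_union]
    rw [hsplit]
    refine SimpleGraph.IsAcyclic.sup_edge_of_not_reachable ?_ (ih (by omega))
    intro hreach
    have heq := eq_of_reachable (φ := fun w : Fin n => rep a b i w) ?_ hreach
    · have hne := h.merge.ne i (by omega)
      rcases h.ends i (by omega) with ⟨e1, e2⟩ | ⟨e1, e2⟩
      · exact hne (by rw [← e1, ← e2]; exact heq)
      · exact hne (by rw [← e1, ← e2]; exact heq.symm)
    · intro y z hyz
      obtain ⟨j, hj, y', z', he, hy, hz⟩ := (SimpleGraph.fromEdgeSet_adj _).1 hyz |>.1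
      have hj1 : rep a b i (y' : ℕ) = rep a b i z' := by
        refine h.merge.rep_eq_of_le (Nat.succ_le_of_lt hj) (by omega) ?_
        rw [hy, hz]
        rcases h.ends j (by omega) with ⟨e1, e2⟩ | ⟨e1, e2⟩ <;> simp [rep, e1, e2]
      rcases Sym2.eq_iff.1 he with ⟨rfl, rfl⟩ | ⟨rfl, rfl⟩
      · exact hj1
      · exact hj1.symm

theorem toArray_apply {α : Type*} [Zero α] {m : ℕ} (w : Fin m → α) (i : Fin m) :
    toArray w i = w i := by
  simp [toArray]

theorem toArray_of_lt {α : Type*} [Zero α] {m : ℕ} (w : Fin m → α) {i : ℕ} (h : i < m) :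
    toArray w i = w ⟨i, h⟩ := by
  simp [toArray, h]

/-- The constraint of the linear program for the light edges among those of the mergers. -/
theorem le_sum_min_of_isFeasible {n m k f : ℕ} {G : SimpleGraph (Fin n)} {x : G.edgeSet → ℝ}
    {ε : Fin m ≃ G.edgeSet} {u v : Fin m → Fin n} {acc a b : ℕ → ℕ}
    (hε : ∀ i, (ε i : Sym2 (Fin n)) = s(u i, v i)) (hx : IsFeasible G k x)
    (h : IsKruskal n m (toArray fun i => (u i : ℕ)) (toArray fun i => (v i : ℕ))
      (toArray fun i => x (ε i)) f acc a b) :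
    (f : ℝ) + k - n ≤ ∑ j ∈ Finset.range f, min 1 (toArray (fun i => x (ε i)) (acc j)) := by
  classical
  set X := toArray fun i => x (ε i) with hX
  -- The constraint is applied only to the merging edges of value below `1`, where the truncation
  -- has no effect; each of the others contributes exactly `1` to both sides.
  let J := (Finset.range f).filter fun j => X (acc j) < 1
  let J' : Finset (Fin m) := Finset.univ.filter fun i => ∃ j ∈ J, acc j = i
  have hJ' : J'.map Fin.valEmbedding = J.image acc := by
    ext i
    simp only [J', Finset.mem_map, Finset.mem_filter, Finset.mem_univ, true_and, Finset.mem_image,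
      Fin.valEmbedding_apply]
    constructor
    · rintro ⟨i, ⟨j, hj, he⟩, rfl⟩; exact ⟨j, hj, he⟩
    · rintro ⟨j, hj, rfl⟩
      exact ⟨⟨acc j, h.acc_lt j (Finset.mem_range.1 (Finset.mem_filter.1 hj).1)⟩, ⟨j, hj, rfl⟩, rfl⟩
  have hinj : Set.InjOn acc J := fun i hi j hj he =>
    h.acc_injective (Finset.mem_range.1 (Finset.mem_filter.1 hi).1)
      (Finset.mem_range.1 (Finset.mem_filter.1 hj).1) he
  have hcard : J'.card = J.card := by
    rw [← Finset.card_map Fin.valEmbedding, hJ', Finset.card_image_of_injOn hinj]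
  have hsum : ∑ i ∈ J', x (ε i) = ∑ j ∈ J, X (acc j) := by
    rw [← Finset.sum_image hinj, ← hJ', Finset.sum_map]
    exact Finset.sum_congr rfl fun i _ => (toArray_apply (fun i => x (ε i)) i).symm
  have hforest : IsForest G (J'.map ε.toEmbedding) := by
    refine SimpleGraph.IsAcyclic.anti (SimpleGraph.fromEdgeSet_mono ?_)
      (isAcyclic_mergerEdges h ?_ ?_ le_rfl)
    · rintro _ ⟨e, he, rfl⟩
      obtain ⟨i, hi, rfl⟩ := Finset.mem_map.1 (Finset.mem_coe.1 he)
      obtain ⟨j, hj, hji⟩ := (Finset.mem_filter.1 hi).2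
      refine ⟨j, Finset.mem_range.1 (Finset.mem_filter.1 hj).1, u i, v i, hε i, ?_, ?_⟩
      · rw [hji, toArray_apply]
      · rw [hji, toArray_apply]
    · intro i hi; rw [toArray_of_lt _ hi]; exact (u _).2
    · intro i hi; rw [toArray_of_lt _ hi]; exact (v _).2
  have hfeas := hx.2 _ hforest
  rw [Finset.card_map, Finset.sum_map, hcard] at hfeas
  simp only [Equiv.coe_toEmbedding, hsum] at hfeas
  have hmin : ∑ j ∈ Finset.range f, min 1 (X (acc j)) =
      ∑ j ∈ J, X (acc j) + ((f : ℝ) - J.card) := by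
    rw [← Finset.sum_filter_add_sum_filter_not _ fun j => X (acc j) < 1]
    congr 1
    · exact Finset.sum_congr rfl fun j hj => min_eq_right (Finset.mem_filter.1 hj).2.le
    · rw [Finset.sum_congr rfl fun j hj => min_eq_left (not_lt.1 (Finset.mem_filter.1 hj).2)]
      have h1 := Finset.card_filter_add_card_filter_not (s := Finset.range f) fun j => X (acc j) < 1
      rw [Finset.card_range] at h1
      rw [Finset.sum_const, nsmul_eq_mul, mul_one, eq_sub_iff_add_eq', ← Nat.cast_add]
      exact_mod_cast h1
  linarith

/-- The components that are left if the chosen candidates separate no edge. -/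
theorem IsRounding.le_card_connectedComponent {n m : ℕ} {u v : ℕ → ℕ} {c x : ℕ → ℝ} {f : ℕ}
    {acc a b : ℕ → ℕ} {U V : ℕ → ℕ} {W : ℕ → ℝ} {g : ℕ → Fin n → ℝ} {f' : ℕ} {acc' a' b' : ℕ → ℕ}
    (h : IsRounding n m u v c x f acc a b U V W g f' acc' a' b') {q : ℕ} (hq : q ≤ f)
    {H : SimpleGraph (Fin n)} (hroot : ∀ y z : Fin n, H.Adj y z → rep a b f y = rep a b f z)
    (hcand : ∀ i < q, ∀ y z : Fin n, H.Adj y z →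
      candVec n a b (acc' i) y = candVec n a b (acc' i) z) :
    n ≤ Nat.card H.ConnectedComponent + (f - q) := by
  classical
  have hf' := h.card_eq
  subst hf'
  have : Fintype H.ConnectedComponent := Fintype.ofFinite _
  let φ : (H.ConnectedComponent → ℝ) →ₗ[ℝ] (Fin n → ℝ) :=
    LinearMap.funLeft ℝ ℝ H.connectedComponentMk
  -- The range of `φ` consists of the functions constant on components. Its dimension is at most
  -- their number, and only the last `f' - q` basis members may lie outside it.
  have hrange : ∀ w : Fin n → ℝ, (∀ y z, H.Adj y z → w y = w z) → w ∈ LinearMap.range φ := by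
    intro w hw
    refine ⟨fun C => w C.out, ?_⟩
    funext y
    exact eq_of_reachable hw (SimpleGraph.ConnectedComponent.exact (Quot.out_eq _))
  let S := (Finset.Ico q f').image fun i => candVec n a b (acc' i)
  have htop : LinearMap.range φ ⊔ Submodule.span ℝ (S : Set (Fin n → ℝ)) = ⊤ := by
    rw [eq_top_iff, ← h.acceptedSpan_eq_top]
    refine sup_le ?_ ?_
    · refine le_trans ?_ le_sup_left
      rw [rootSpan, Submodule.span_le]
      rintro _ ⟨ρ, -, rfl⟩
      refine hrange _ fun y z hyz => ?_
      simp only [classVec, hroot y z hyz]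
    · rw [Submodule.span_le]
      rintro _ ⟨i, hi, rfl⟩
      rw [Finset.coe_range, Set.mem_Iio] at hi
      by_cases hiq : i < q
      · exact Submodule.mem_sup_left (hrange _ (hcand i hiq))
      · refine Submodule.mem_sup_right (Submodule.subset_span ?_)
        exact Finset.mem_coe.2 (Finset.mem_image_of_mem _ (Finset.mem_Ico.2 ⟨by omega, hi⟩))
  have h1 := Submodule.finrank_add_le_finrank_add_finrank (LinearMap.range φ)
    (Submodule.span ℝ (S : Set (Fin n → ℝ)))
  rw [htop, finrank_top, Module.finrank_fin_fun] at h1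
  have h2 := LinearMap.finrank_range_le φ
  rw [Module.finrank_fintype_fun_eq_card, ← Nat.card_eq_fintype_card] at h2
  have h3 := finrank_span_finset_le_card (R := ℝ) S
  have h4 : S.card ≤ f' - q := by
    simpa using Finset.card_image_le (s := Finset.Ico q f') (f := fun i => candVec n a b (acc' i))
  rw [Set.finrank] at h3
  omega

/-- The cost of the edges separated by the first `q` accepted candidates. -/
theorem IsRounding.sum_cost_le {n m : ℕ} {u v : ℕ → ℕ} {c x : ℕ → ℝ} {f : ℕ}
    {acc a b : ℕ → ℕ} {U V : ℕ → ℕ} {W : ℕ → ℝ} {g : ℕ → Fin n → ℝ} {f' : ℕ} {acc' a' b' : ℕ → ℕ}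
    (h : IsRounding n m u v c x f acc a b U V W g f' acc' a' b') {q : ℕ} (hq : q ≤ f)
    {S : Finset ℕ} (hS : ∀ i ∈ S, i < m ∧ ∃ t < q, ¬ (rep a b (acc' t / 2) (u i) = side a b (acc' t)
      ↔ rep a b (acc' t / 2) (v i) = side a b (acc' t))) :
    ∑ i ∈ S, c i ≤ ∑ t ∈ Finset.range q, W (acc' t) := by
  have hf' := h.card_eq
  have h1 : ∑ t ∈ Finset.range q, W (acc' t) = ∑ i ∈ Finset.range m, ∑ t ∈ Finset.range q,
      if (rep a b (acc' t / 2) (u i) = side a b (acc' t) ↔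
        rep a b (acc' t / 2) (v i) = side a b (acc' t)) then 0 else c i := by
    rw [Finset.sum_comm]
    refine Finset.sum_congr rfl fun t ht => ?_
    rw [h.weight _ (h.kruskal'.acc_lt t (by rw [Finset.mem_range] at ht; omega))]
    rfl
  have hnonneg : ∀ i < m, ∀ t, (0 : ℝ) ≤ if (rep a b (acc' t / 2) (u i) = side a b (acc' t) ↔
        rep a b (acc' t / 2) (v i) = side a b (acc' t)) then 0 else c i := by
    intro i hi t
    split_ifs
    · exact le_rfl
    · exact h.c_nonneg i hi
  rw [h1]
  -- A separated edge is paid for once on the left, but on the right by every chosen candidate that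
  -- separates it.
  refine (Finset.sum_le_sum fun i hi => ?_).trans (Finset.sum_le_sum_of_subset_of_nonneg
    (fun i hi => Finset.mem_range.2 (hS i hi).1)
    fun i hi _ => Finset.sum_nonneg fun t _ => hnonneg i (Finset.mem_range.1 hi) t)
  obtain ⟨him, t, ht, hsep⟩ := hS i hi
  refine le_trans ?_ (Finset.single_le_sum (fun t _ => hnonneg i him t) (Finset.mem_range.2 ht))
  rw [if_neg hsep]

/-! ### The whole program -/

/-- The rounding algorithm. -/
def roundingProg : Prog :=
  (Prog.setVar 4 (.get 0 (.lit 1))).seq ((kruskalProg 0).seq (joinProg.seq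
    ((Prog.setVar 40 (.lit 0)).seq (weighProg.seq
      ((Prog.setVar 40 (.var 5)).seq (intervalProg.seq
        ((Prog.setVar 24 ((NExp.var 5).add (.var 5))).seq ((kruskalProg 20).seq
          ((Prog.setVar 46 (((NExp.var 5).add (.get 0 (.lit 2))).sub (.get 0 (.lit 0)))).seq
            ((Prog.setVar 40 (.lit 0)).seq (markProg.seq
              ((Prog.setVar 40 (.var 5)).seq (labelProg.seq
                ((Prog.setVar 40 (.lit 0)).seq outputProg))))))))))))))

theorem writesNat_kruskalProg (o : ℕ) {d : ℕ} (hd : d ∈ (kruskalProg o).writesNat) :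
    o + 4 < d ∧ d < o + 18 := by
  simp only [kruskalProg, buildProg, leavesProg, nodesProg, competeProg, kruskalStep, extractProg,
    repairProg, climbProg, uniteProg, mergeProg, Prog.writesNat, List.mem_append, List.mem_cons,
    List.not_mem_nil, or_false, false_or] at hd
  omega

theorem writesReal_kruskalProg (o : ℕ) : (kruskalProg o).writesReal = [] := by
  simp [kruskalProg, buildProg, leavesProg, nodesProg, competeProg, kruskalStep, extractProg,
    repairProg, climbProg, uniteProg, mergeProg, Prog.writesReal]

theorem roundingProg_time (m l : ℕ) :
    100 + ((m + 1) * ((l + 1) * 4000) + ((m + 1) * ((l + 1) * 1000) + (100 +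
      ((m + 1) * 100 + (100 + ((m + 1) * 200 + (100 + ((m + 1) * ((l + 1) * 8000) + (100 + (100 +
      ((m + 1) * 50 + (100 + ((m + 1) * 200 + (100 + (m + 1) * 100)))))))))))))) ≤
      (m + 1) * ((l + 1) * 20000) := by
  have hP : m + 1 ≤ (m + 1) * (l + 1) := Nat.le_mul_of_pos_right _ (Nat.succ_pos l)
  simp only [← Nat.mul_assoc]
  generalize (m + 1) * (l + 1) = p at hP ⊢
  omega

/-- The second run of Kruskal's algorithm has `2 * f ≤ 2 * m` edges and hence fewer than `4 * m`
tree nodes when it has any edge, which explains `hml`. Its arrays start at base `20`, away from the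
results of the first run. -/
theorem roundingProg_halts {n m k l : ℕ} {u v : Fin m → Fin n} {c x : Fin m → ℝ}
    (hml : 4 * m ≤ 2 ^ l) (hnl : 0 < m → n ≤ 2 ^ l) (huv : ∀ i, u i ≠ v i) (hc : ∀ i, 0 ≤ c i)
    (hx : ∀ i, 0 ≤ x i) (hk : k ≤ n) :
    Halts roundingProg (inputState k u v c x) ((m + 1) * ((l + 1) * 20000)) (fun s =>
      ∃ (f : ℕ) (acc a b U V : ℕ → ℕ) (W : ℕ → ℝ) (g : ℕ → Fin n → ℝ) (f' : ℕ)
        (acc' a' b' : ℕ → ℕ),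
        IsRounding n m (toArray fun i => (u i : ℕ)) (toArray fun i => (v i : ℕ)) (toArray c)
          (toArray x) f acc a b U V W g f' acc' a' b' ∧
        ∀ i < m, s.nat 3 i = 1 ↔ ∃ t < f + k - n,
          ¬ (rep a b (acc' t / 2) (toArray (fun i => (u i : ℕ)) i) = side a b (acc' t) ↔
            rep a b (acc' t / 2) (toArray (fun i => (v i : ℕ)) i) = side a b (acc' t))) := by
  generalize hs0 : inputState k u v c x = s0
  have hu_lt : ∀ i < m, toArray (fun i => (u i : ℕ)) i < n := by
    intro i hi; rw [toArray_of_lt _ hi]; exact (u _).2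
  have hv_lt : ∀ i < m, toArray (fun i => (v i : ℕ)) i < n := by
    intro i hi; rw [toArray_of_lt _ hi]; exact (v _).2
  have i0 : s0.nat 0 = toArray ![n, m, k] := by rw [← hs0]; rfl
  have i1 : s0.nat 1 = toArray (fun i => (u i : ℕ)) := by rw [← hs0]; rfl
  have i2 : s0.nat 2 = toArray (fun i => (v i : ℕ)) := by rw [← hs0]; rfl
  have iz : ∀ d, 3 ≤ d → s0.nat d = fun _ => 0 := by
    intro d hd
    have h0 : d ≠ 0 := by omega
    have h1 : d ≠ 1 := by omega
    have h2 : d ≠ 2 := by omega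
    rw [← hs0]; simp [inputState, h0, h1, h2]
  have r0 : s0.real 0 = toArray c := by rw [← hs0]; rfl
  have r1 : s0.real 1 = toArray x := by rw [← hs0]; rfl
  have rz : ∀ d, 2 ≤ d → s0.real d = fun _ => 0 := by
    intro d hd
    have h0 : d ≠ 0 := by omega
    have h1 : d ≠ 1 := by omega
    rw [← hs0]; simp [inputState, h0, h1]
  set uA := toArray (fun i => (u i : ℕ)) with huA
  set vA := toArray (fun i => (v i : ℕ)) with hvA
  clear hs0
  refine Halts.mono ?_ (roundingProg_time m l) fun _ h => h
  refine (Halts.setNat (by simp [NExp.cost])).seq ?_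
  rintro s1 rfl
  have hm1 : ((s0.setNat 4 0 (s0.nat 0 1)).nat (0 + 4) 0) = m := by
    simp [State.setNat_nat, i0, toArray]
  refine (kruskalProg_halts (o := 0) (N := n) (M := m) (l := l) (by omega) hnl hm1 ?_ ?_ ?_ ?_
    ?_).frame.seq ?_
  · simpa [State.setNat_nat, NExp.eval, i1] using hu_lt
  · simpa [State.setNat_nat, NExp.eval, i2] using hv_lt
  · simp [State.setNat_nat, iz]
  · simp [State.setNat_nat, iz]
  · simp [State.setNat_nat, iz]
  rintro s2 ⟨⟨hK, hL, hZ⟩, hf, hr⟩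
  simp only [Nat.zero_add] at hK hL hZ hf hr hm1
  have w2 : ∀ d, d < 4 ∨ 18 ≤ d → s2.nat d = s0.nat d := by
    intro d hd
    rw [hf d (fun h => by have := writesNat_kruskalProg 0 h; omega), State.setNat_nat,
      if_neg (by omega)]
  have w24 : s2.nat 4 0 = m := by
    rw [hf 4 (fun h => by have := writesNat_kruskalProg 0 h; omega), hm1]
  have v2 : s2.real = s0.real := by
    funext d
    rw [hr d (by simp [writesReal_kruskalProg]), State.setNat_real]
  rw [State.setNat_nat, State.setNat_nat, State.setNat_real, if_neg (by simp), if_neg (by simp),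
    i1, i2, r1] at hK
  clear hf hr hm1
  generalize hfe : s2.nat 5 0 = f at hK hL hZ
  generalize hae : s2.nat 7 = a at hK hL hZ
  generalize hbe : s2.nat 8 = b at hK hL hZ
  generalize hacce : s2.nat 6 = acc at hK
  have hfm : f ≤ m := hK.le
  refine (joinProg_halts (N := n) (M := m) (f := f) (l := l) (a := a) (b := b) (u := uA) (v := vA)
    (c := toArray c) ?_ ?_ w24 hbe ?_ ?_ ?_ ?_ hK.merge hL hZ hnl hu_lt hv_lt ?_
    fun i hi => hK.rep_eq hi).frame.seq ?_
  · rw [w2 1 (by omega), i1]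
  · rw [w2 2 (by omega), i2]
  · rw [v2, r0]
  · rw [w2 40 (by omega), iz 40 (by omega)]
  · rw [v2, rz 2 (by omega)]
  · rw [v2, rz 3 (by omega)]
  · intro i hi he
    rw [huA, hvA, toArray_of_lt _ hi, toArray_of_lt _ hi] at he
    exact huv _ (Fin.ext he)
  rintro s3 ⟨⟨hJ, hD⟩, hf, -⟩
  have w3 : ∀ d, d < 40 ∨ 43 < d → s3.nat d = s2.nat d := fun d hd => hf d (by
    simp [joinProg, meetProg, Prog.writesNat]; omega)
  clear hf
  refine (Halts.setNat (by simp [NExp.cost])).seq ?_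
  rintro s4 rfl
  refine ((weighProg_halts (N := n) (M := m) (f := f) (a := a) (b := b) (u := uA) (v := vA)
    (c := toArray c) ?_ ?_ ?_ ?_ hK.merge ?_ ?_).frame.mono
    (Nat.mul_le_mul_right 100 (Nat.succ_le_succ hfm)) fun _ h => h).seq ?_
  · simp [State.setNat_nat, w3, hfe]
  · simp [State.setNat_nat, w3, hae]
  · simp [State.setNat_nat, w3, hbe]
  · simp [State.setNat_nat, NExp.eval]
  · exact hJ
  · exact hD
  rintro s5 ⟨hW, hf, -⟩
  have w5 : ∀ d, d < 40 ∨ 43 < d → s5.nat d = s2.nat d := fun d hd => by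
    rw [hf d (by simp [weighProg, Prog.writesNat]; omega), State.setNat_nat, if_neg (by omega),
      w3 d hd]
  clear hf w3 hJ hD
  refine (Halts.setNat (by simp [NExp.cost])).seq ?_
  rintro s6 rfl
  refine ((intervalProg_halts (n := n) (f := f) (a := a) (b := b) ?_ ?_ ?_ ?_ ?_
    hK.merge).frame.mono (Nat.mul_le_mul_right 200 (Nat.succ_le_succ hfm)) fun _ h => h).seq ?_
  · simp [State.setNat_nat, w5, hae]
  · simp [State.setNat_nat, w5, hbe]
  · simp [State.setNat_nat, w5, NExp.eval, hfe]
  · simp [State.setNat_nat, w5, w2, iz]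
  · simp [State.setNat_nat, w5, w2, iz]
  rintro s7 ⟨⟨g, hg⟩, hf, hr⟩
  have w7 : ∀ d, d < 21 ∨ (22 < d ∧ d < 40) ∨ 45 < d → s7.nat d = s2.nat d := fun d hd => by
    rw [hf d (by simp [intervalProg, Prog.writesNat]; omega), State.setNat_nat, if_neg (by omega),
      w5 d (by omega)]
  have v7 : s7.real = s5.real := by
    funext d
    rw [hr d (by simp [intervalProg, Prog.writesReal]), State.setNat_real]
  clear hf hr w5
  refine (Halts.setNat (by simp [NExp.cost])).seq ?_
  rintro s8 rfl
  have hkt : (2 * f + 1) * ((l + 1) * 4000) ≤ (m + 1) * ((l + 1) * 8000) := by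
    have h1 : (2 * f + 1) * ((l + 1) * 4000) ≤ (2 * (m + 1)) * ((l + 1) * 4000) :=
      Nat.mul_le_mul_right _ (by omega)
    calc _ ≤ _ := h1
      _ = _ := by ring
  have hfl : f + 1 ≤ 4 * m + 1 := by omega
  refine ((kruskalProg_halts (o := 20) (N := f + 1) (M := 2 * f) (l := l) (by omega) ?_ ?_ ?_ ?_ ?_
    ?_ ?_).frame.mono hkt fun _ h => h).seq ?_
  · intro h0; omega
  · simp [State.setNat_nat, NExp.eval, w7, hfe]; omega
  · intro i hi
    simpa [State.setNat_nat] using (hg i hi).2.1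
  · intro i hi
    simpa [State.setNat_nat] using (hg i hi).2.2
  · simp [State.setNat_nat, w7, w2, iz]
  · simp [State.setNat_nat, w7, w2, iz]
  · simp [State.setNat_nat, w7, w2, iz]
  rintro s9 ⟨⟨hK', -, -⟩, hf, -⟩
  simp only [Nat.reduceAdd, NExp.eval] at hK' hf
  have w9 : ∀ d, d < 21 ∨ 45 < d → s9.nat d = s2.nat d := fun d hd => by
    rw [hf d (fun h => by have := writesNat_kruskalProg 20 h; omega), State.setNat_nat,
      if_neg (by omega), w7 d (by omega)]
  rw [State.setNat_nat, State.setNat_nat, State.setNat_real, if_neg (by simp), if_neg (by simp),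
    v7] at hK'
  clear hf w7
  have hround : IsRounding n m uA vA (toArray c) (toArray x) f acc a b (s7.nat 21) (s7.nat 22)
      (s5.real 21) g (s9.nat 25 0) (s9.nat 26) (s9.nat 27) (s9.nat 28) := by
    refine ⟨hu_lt, hv_lt, ?_, ?_, hK, hW, fun e he => (hg e he).1, hK'⟩
    · intro i hi; rw [toArray_of_lt _ hi]; exact hc _
    · intro i hi; rw [toArray_of_lt _ hi]; exact hx _
  generalize hacce' : s9.nat 26 = acc' at hround
  generalize hqe : f + k - n = q
  have hq : q ≤ m := by omega
  have hqf : q ≤ f := by omega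
  refine (Halts.setNat (by simp [NExp.cost])).seq ?_
  rintro s10 rfl
  refine (Halts.setNat (by simp [NExp.cost])).seq ?_
  rintro s11 rfl
  refine ((markProg_halts (q := q) ?_ ?_ ?_).frame.mono
    (Nat.mul_le_mul_right 50 (Nat.succ_le_succ hq)) fun _ h => h).seq ?_
  · simp [State.setNat_nat, NExp.eval, w9, w2, i0, hfe, toArray, ← hqe]
  · simp [State.setNat_nat, NExp.eval]
  · simp [State.setNat_nat, w9, w2, iz]
  rintro s12 ⟨hmark, hf, -⟩
  have w12 : ∀ d, d < 21 ∨ 47 < d → s12.nat d = s2.nat d := fun d hd => by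
    rw [hf d (by simp [markProg, Prog.writesNat]; omega), State.setNat_nat, if_neg (by omega),
      State.setNat_nat, if_neg (by omega), w9 d (by omega)]
  rw [State.setNat_nat, if_neg (by simp), State.setNat_nat, if_neg (by simp), hacce'] at hmark
  clear hf w9
  refine (Halts.setNat (by simp [NExp.cost])).seq ?_
  rintro s13 rfl
  refine ((labelProg_halts (n := n) (f := f) (a := a) (b := b) ?_ ?_ ?_ ?_ hK.merge).frame.mono
    (Nat.mul_le_mul_right 200 (Nat.succ_le_succ hfm)) fun _ h => h).seq ?_
  · simp [State.setNat_nat, w12, hae]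
  · simp [State.setNat_nat, w12, hbe]
  · simp [State.setNat_nat, NExp.eval, w12, hfe]
  · simp [State.setNat_nat, w12, w2, iz]
  rintro s14 ⟨hlab, hf, -⟩
  have w14 : ∀ d, d < 21 → s14.nat d = s2.nat d := fun d hd => by
    rw [hf d (by simp [labelProg, Prog.writesNat]; omega), State.setNat_nat, if_neg (by omega),
      w12 d (by omega)]
  clear hf w12
  refine (Halts.setNat (by simp [NExp.cost])).seq ?_
  rintro s15 rfl
  refine (outputProg_halts (M := m) ?_ ?_).mono le_rfl ?_
  · simp [State.setNat_nat, w14, w24]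
  · simp [State.setNat_nat, NExp.eval]
  rintro s16 hout
  refine ⟨f, acc, a, b, _, _, _, g, _, _, _, _, hround, fun i hi => ?_⟩
  have hout' := hout i hi
  simp only [State.setNat_nat, Nat.reduceEqDiff, OfNat.one_ne_ofNat, if_false,
    w14 1 (by omega), w14 2 (by omega), w2 1 (by omega), w2 2 (by omega), i1, i2] at hout'
  rw [hout', Ne, hlab]
  simp only [State.setNat_nat, Nat.reduceEqDiff, if_false, hmark]
  rw [hqe]
  simp only [not_forall, exists_prop]
  constructor
  · rintro ⟨e, he, ⟨t, ht, rfl⟩, hne⟩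
    exact ⟨t, ht, hne⟩
  · rintro ⟨t, ht, hne⟩
    exact ⟨acc' t, hround.kruskal'.acc_lt t (by rw [hround.card_eq]; omega), ⟨t, ht, rfl⟩, hne⟩

/-- Since `m ≤ n ^ 2`, logarithms of `m` and of `n` differ by a constant factor. Without edges the
running time is constant and is covered by the summand `1`. -/
theorem exists_log_bound {n m : ℕ} (hm : m ≤ n * n) (hn : 0 < m → 2 ≤ n) :
    ∃ l, 4 * m ≤ 2 ^ l ∧ (0 < m → n ≤ 2 ^ l) ∧
      (((m + 1) * ((l + 1) * 20000) : ℕ) : ℝ) ≤ 1000000 * (m * Real.log n + 1) := by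
  rcases Nat.eq_zero_or_pos m with rfl | hm0
  · exact ⟨0, by simp, by simp, by norm_num⟩
  · have hn2 := hn hm0
    have hlt : n < 2 ^ (Nat.log 2 n + 1) := Nat.lt_pow_succ_log_self (by norm_num) n
    have hL : 1 ≤ Nat.log 2 n := Nat.log_pos (by norm_num) hn2
    have hlog : (Nat.log 2 n : ℝ) ≤ 2 * Real.log n := by
      have h1 := Real.natLog_le_logb n 2
      rw [Real.logb, le_div_iff₀ (Real.log_pos (by norm_num))] at h1
      have h2 : (1 : ℝ) / 2 ≤ Real.log 2 := by have := Real.log_two_gt_d9; linarith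
      have h3 : (0 : ℝ) ≤ Nat.log 2 n := Nat.cast_nonneg _
      push_cast at h1
      nlinarith
    generalize Nat.log 2 n = L at hlt hL hlog
    -- With `n < 2 ^ (L + 1)` the exponent is exactly what `4 * n ^ 2` needs.
    refine ⟨2 * L + 4, ?_, fun _ => ?_, ?_⟩
    · have : n * n ≤ 2 ^ (L + 1) * 2 ^ (L + 1) := Nat.mul_le_mul hlt.le hlt.le
      have e : 2 ^ (2 * L + 4) = 4 * (2 ^ (L + 1) * 2 ^ (L + 1)) := by ring
      omega
    · exact hlt.le.trans (Nat.pow_le_pow_right (by norm_num) (by omega))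
    · have h1 : (m + 1) * ((2 * L + 4 + 1) * 20000) ≤ 280000 * (m * L) := by nlinarith
      have h2 : (m : ℝ) * L ≤ m * (2 * Real.log n) :=
        mul_le_mul_of_nonneg_left hlog (Nat.cast_nonneg _)
      have h3 : (((m + 1) * ((2 * L + 4 + 1) * 20000) : ℕ) : ℝ) ≤ 280000 * ((m : ℝ) * L) := by
        exact_mod_cast h1
      nlinarith

end KCut

/-! ### The theorem -/

theorem mainTheorem3 :
    ∃ (P : RealRAM.Prog) (A : ℝ),
      ∀ (n m k : ℕ) (G : SimpleGraph (Fin n)) [Fintype G.edgeSet]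
        (c x : G.edgeSet → ℝ)
        (ε : Fin m ≃ G.edgeSet) (u v : Fin m → Fin n),
        (∀ i, (ε i : Sym2 (Fin n)) = s(u i, v i)) →
        (∀ e, 0 < c e) →
        KCut.IsFeasible G k x →
        ∃ (s : RealRAM.State) (T : ℕ) (C : Finset G.edgeSet),
          RealRAM.Run P (KCut.inputState k u v (fun i => c (ε i)) (fun i => x (ε i))) s T ∧
          (T : ℝ) ≤ A * ((m : ℝ) * Real.log (n : ℝ) + 1) ∧
          KCut.Outputs ε s C ∧
          KCut.IsKCut G k C ∧
          ∑ e ∈ C, c e ≤ 2 * (1 - 1 / (n : ℝ)) * ∑ e, c e * x e := by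
  classical
  refine ⟨KCut.roundingProg, 1000000, ?_⟩
  intro n m k G _ c x ε u v hε hc hx
  have hadj : ∀ i, G.Adj (u i) (v i) := by
    intro i
    rw [← SimpleGraph.mem_edgeSet, ← hε i]
    exact (ε i).2
  have huv : ∀ i, u i ≠ v i := fun i => (hadj i).ne
  have hmn : m ≤ n * n := by
    have hinj : Function.Injective fun i : Fin m => (u i, v i) := by
      intro i j hij
      simp only [Prod.mk.injEq] at hij
      exact ε.injective (Subtype.ext (by rw [hε, hε, hij.1, hij.2]))
    simpa using Fintype.card_le_of_injective _ hinj
  have hn2 : 0 < m → 2 ≤ n := by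
    intro hm
    have h1 := huv ⟨0, hm⟩
    by_contra hlt
    exact h1 (Fin.ext (by omega))
  -- The constraint for the empty forest; it ensures that no more than `f` candidates are demanded.
  have hkn : k ≤ n := by
    have := hx.2 ∅ (by simp [KCut.IsForest])
    simp only [Finset.card_empty, Nat.cast_zero, zero_add, Finset.sum_empty, sub_nonpos] at this
    exact_mod_cast this
  obtain ⟨l, hml, hnl, htime⟩ := KCut.exists_log_bound hmn hn2
  obtain ⟨s, T, hrun, hT, f, acc, a, b, U, V, W, g, f', acc', a', b', hR, hout⟩ :=
    KCut.roundingProg_halts (k := k) (u := u) (v := v) (c := fun i => c (ε i))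
      (x := fun i => x (ε i)) hml hnl huv (fun i => (hc _).le) (fun i => hx.1 _) hkn
  have hfn : f ≤ n := by have := hR.kruskal.merge.card_reps le_rfl; omega
  have hqf : f + k - n ≤ f := by omega
  let S : Finset (Fin m) := Finset.univ.filter fun i => s.nat 3 i = 1
  have hSmem : ∀ i, ε i ∈ S.map ε.toEmbedding ↔ s.nat 3 i = 1 := by
    intro i; simp [S]
  refine ⟨s, T, S.map ε.toEmbedding, hrun, (Nat.cast_le.2 hT).trans htime, hSmem, ?_, ?_⟩
  · have hedge : ∀ y z : Fin n, (G.deleteEdges ((fun e : G.edgeSet => (e : Sym2 (Fin n))) ''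
        (S.map ε.toEmbedding : Set G.edgeSet))).Adj y z →
        ∃ i : Fin m, s.nat 3 i ≠ 1 ∧ ((y = u i ∧ z = v i) ∨ (y = v i ∧ z = u i)) := by
      intro y z hyz
      rw [SimpleGraph.deleteEdges_adj] at hyz
      obtain ⟨i, hi⟩ := ε.surjective ⟨s(y, z), hyz.1⟩
      refine ⟨i, fun h1 => hyz.2 ⟨ε i, (hSmem i).2 h1, by rw [hi]⟩, ?_⟩
      have h2 := hε i
      rw [hi] at h2
      exact Sym2.eq_iff.1 h2
    have hcard := hR.le_card_connectedComponent hqf (H := G.deleteEdges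
      ((fun e : G.edgeSet => (e : Sym2 (Fin n))) '' (S.map ε.toEmbedding : Set G.edgeSet))) ?_ ?_
    · rw [KCut.IsKCut]; omega
    · intro y z hyz
      obtain ⟨i, -, h⟩ := hedge y z hyz
      have hrep := hR.kruskal.rep_eq i.2
      rw [KCut.toArray_apply, KCut.toArray_apply] at hrep
      rcases h with ⟨rfl, rfl⟩ | ⟨rfl, rfl⟩
      · exact hrep
      · exact hrep.symm
    · intro t ht y z hyz
      obtain ⟨i, hi, h⟩ := hedge y z hyz
      rw [Ne, hout i i.2, KCut.toArray_apply, KCut.toArray_apply] at hi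
      have hiff : _ ↔ _ := not_not.1 fun hne => hi ⟨t, ht, hne⟩
      rcases h with ⟨rfl, rfl⟩ | ⟨rfl, rfl⟩
      · simp only [KCut.candVec, KCut.classVec, hiff]
      · simp only [KCut.candVec, KCut.classVec, hiff]
  · have hfeas : ((f + k - n : ℕ) : ℝ) ≤ ∑ j ∈ Finset.range f,
        min 1 (KCut.toArray (fun i => x (ε i)) (acc j)) := by
      rcases le_total n (f + k) with h | h
      · have := KCut.le_sum_min_of_isFeasible hε hx hR.kruskal
        rw [Nat.cast_sub h, Nat.cast_add]
        exact this
      · rw [Nat.sub_eq_zero_of_le h, Nat.cast_zero]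
        exact Finset.sum_nonneg fun j hj => le_min zero_le_one
          (hR.x_nonneg _ (hR.kruskal.acc_lt j (Finset.mem_range.1 hj)))
    have h1 := hR.sum_weight_le hqf hfeas
    have h2 := hR.sum_cost_le hqf (S := S.map Fin.valEmbedding) (by
      intro i hi
      obtain ⟨i', hi', rfl⟩ := Finset.mem_map.1 hi
      exact ⟨i'.2, (hout i' i'.2).1 (Finset.mem_filter.1 hi').2⟩)
    rw [Finset.sum_map] at h2
    have h3 : ∑ i ∈ Finset.range m, KCut.toArray (fun i => c (ε i)) i *
        KCut.toArray (fun i => x (ε i)) i = ∑ e, c e * x e := by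
      rw [Finset.sum_range, ← Equiv.sum_comp ε]
      exact Finset.sum_congr rfl fun i _ => by rw [KCut.toArray_apply, KCut.toArray_apply]
    rw [h3] at h1
    rw [Finset.sum_map]
    refine le_trans (le_of_eq ?_) (h2.trans h1)
    exact Finset.sum_congr rfl fun i _ => (KCut.toArray_apply (fun i => c (ε i)) i).symm
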